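/- Let $p\ge 2$ be an integer and let $U_+,U_-\subset\mathbb Z$ be finite disjoint sets such that $U_+\cup U_-$ is non-empty and simply connected, that is, no element of $\mathbb Z\setminus(U_+\cup U_-)$ lies between two elements of $U_+\cup U_-$. Put $N=|U_+|+|U_-|$ and $\phi^{(0)}=\sum_{n\in U_+}\delta_n-\sum_{n\in U_-}\delta_n$. There is $\rho>0$ such that for every $\delta\in(0,1)$ there are $\epsilon_0>0$ and $C>0$ with the following properties for all $\epsilon\in(0,\epsilon_0)$ and with the constant $C$ independent of $\epsilon$ and $\Omega$. The stationary equation $(1-\phi_n^{2p})\phi_n=\epsilon(\phi_{n+1}-2\phi_n+\phi_{n-1})$, $n\in\mathbb Z$, has exactly one real solution $\phi\in l^2(\mathbb Z)$ with $\|\phi-\phi^{(0)}\|_{l^2}<\rho$ (the discrete soliton), and $\|\phi-\phi^{(0)}\|_{l^2}\le C\epsilon$. Let $(\Delta u)_n=u_{n+1}-2u_n+u_{n-1}$, let $V$ be multiplication by $\phi_n^{2p}$, and let $$\mathcal L=\begin{bmatrix}-\epsilon\Delta+I-(1+p)V & -pV\\ pV & \epsilon\Delta-I+(1+p)V\end{bmatrix}\quad\text{on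 } l^2(\mathbb Z)\times l^2(\mathbb Z),\qquad R(\Omega)=(\mathcal L-\Omega I)^{-1}$$ be the linearization at the soliton and its resolvent. Write $B_\delta(0)=\{|\Omega|<\delta\}$ and $\sigma_c=[1,1+4\epsilon]\cup[-1-4\epsilon,-1]$. Then: 1. $R(\Omega)$ exists as a bounded operator on $l^2(\mathbb Z)\times l^2(\mathbb Z)$ for every $\Omega\in\mathbb C\setminus(B_\delta(0)\cup\sigma_c)$; in particular $\mathcal L$ has no eigenvalues there (no internal modes). 2. In $B_\delta(0)$ the resolvent $R$ has, apart from finitely many poles, no singularities, and it has exactly $2N$ poles there, counted with multiplicity (the multiplicity of a pole is the finite dimension of the generalized eigenspace of $\mathcal L$). 3. For every $\Omega\in\sigma_c$, edges included, the limits $R^\pm(\Omega)=\lim_{\mu\downarrow0}R(\Omega\pm i\mu)$ exist as bounded operators $l^1_1\times l^1_1\to l^\infty\times l^\infty$, and $$\|R^\pm(\Omega)\|_{l^1_1\times l^1_1\to l^\infty\times l^\infty}\le C\epsilon^{-1}$$ (so the edges of the bands are not resonances). Here $l^q_s$ is the space of sequences with $\{(1+n^2)^{s/2}u_n\}\in l^q(\mathbb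 Z)$, and the limits are taken in the operator norm $l^1_1\times l^1_1\to l^\infty_{-s}\times l^\infty_{-s}$ for every $s>0$. -/

import Mathlib

open Set Filter Topology
open scoped ENNReal

noncomputable section

namespace DNLS

/-- The complex sequence space `l^q(ℤ)`. -/
abbrev Seq (q : ℝ≥0∞) : Type := lp (fun _ : ℤ => ℂ) q

/-- The space `l²(ℤ)` of real sequences, in which the discrete solitons live. -/
abbrev RealSeq : Type := lp (fun _ : ℤ => ℝ) 2

/-! ### Algebraically weighted sequence spaces -/

/-- The weight `(1 + n²)^{s/2}`. -/
def weight (s : ℝ) (n : ℤ) : ℝ := (1 + (n : ℝ) ^ 2) ^ (s / 2)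

/-- The sequence `(1 + n²)^{s/2} u_n`. -/
def weighted (s : ℝ) : (ℤ → ℂ) →ₗ[ℂ] (ℤ → ℂ) where
  toFun u n := (weight s n : ℂ) * u n
  map_add' u v := by ext n; simp [mul_add]
  map_smul' c u := by ext n; simp; ring

/-- The sequences `u` such that `(1 + n²)^{s/2} u_n` belongs to `l^q(ℤ)`. -/
def wSubmodule (q : ℝ≥0∞) (s : ℝ) : Submodule ℂ (ℤ → ℂ) where
  carrier := {u | Memℓp (weighted s u) q}
  add_mem' {u v} hu hv := by
    simp only [mem_ofPred_eq, map_add] at *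
    exact Memℓp.add hu hv
  zero_mem' := by
    simp only [mem_ofPred_eq, map_zero]
    exact zero_memℓp
  smul_mem' c u hu := by
    simp only [mem_ofPred_eq, map_smul] at *
    exact Memℓp.const_smul hu c

/-- The weighted space `l^q_s(ℤ)`. -/
def WSeq (q : ℝ≥0∞) (s : ℝ) : Type := wSubmodule q s

namespace WSeq

variable {q : ℝ≥0∞} {s : ℝ}

instance : AddCommGroup (WSeq q s) := inferInstanceAs (AddCommGroup (wSubmodule q s))

instance : Module ℂ (WSeq q s) := inferInstanceAs (Module ℂ (wSubmodule q s))

/-- The underlying sequence. -/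
def val (u : WSeq q s) : ℤ → ℂ := Subtype.val (p := (· ∈ wSubmodule q s)) u

/-- The linear injection `l^q_s(ℤ) → l^q(ℤ)`, `u ↦ (1 + n²)^{s/2} u_n`, which induces the norm. -/
def toSeq (q : ℝ≥0∞) (s : ℝ) : WSeq q s →ₗ[ℂ] Seq q where
  toFun u := ⟨weighted s u.val, u.2⟩
  map_add' u v := by
    ext n
    exact congrFun (map_add (weighted s) u.val v.val) n
  map_smul' c u := by
    ext n
    exact congrFun (map_smul (weighted s) c u.val) n

theorem weight_pos (s : ℝ) (n : ℤ) : 0 < weight s n := by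
  unfold weight; positivity

theorem toSeq_injective (q : ℝ≥0∞) (s : ℝ) : Function.Injective (toSeq q s) := by
  intro u v h
  refine Subtype.ext (funext fun n => ?_)
  have h1 : (weight s n : ℂ) * u.val n = (weight s n : ℂ) * v.val n :=
    congrArg (fun w : Seq q => (w : ℤ → ℂ) n) h
  exact mul_left_cancel₀ (by exact_mod_cast (weight_pos s n).ne') h1

instance [Fact (1 ≤ q)] : NormedAddCommGroup (WSeq q s) :=
  NormedAddCommGroup.induced (WSeq q s) (Seq q) (toSeq q s) (toSeq_injective q s)

instance [Fact (1 ≤ q)] : NormedSpace ℂ (WSeq q s) :=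
  NormedSpace.induced ℂ (WSeq q s) (Seq q) (toSeq q s)

theorem norm_def [Fact (1 ≤ q)] (u : WSeq q s) : ‖u‖ = ‖toSeq q s u‖ := rfl

end WSeq

/-- `l¹₁(ℤ) ⊆ l²(ℤ)`. -/
theorem memℓp_two_of_wSeq (u : WSeq 1 1) : Memℓp u.val 2 := by
  have h1 : Memℓp (weighted 1 u.val) 1 := u.2
  have h2 : Memℓp u.val 1 := by
    refine h1.norm.mono ?_
    intro n
    have hw : (1 : ℝ) ≤ weight 1 n := by
      unfold weight
      exact Real.one_le_rpow (by nlinarith [sq_nonneg (n : ℝ)]) (by norm_num)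
    have : ‖weighted 1 u.val n‖ = weight 1 n * ‖u.val n‖ := by
      simp [weighted, abs_of_pos (WSeq.weight_pos 1 n)]
    rw [this]
    nlinarith [norm_nonneg (u.val n)]
  exact h2.of_exponent_ge (by norm_num)

/-- The inclusion `l¹₁ × l¹₁ ⊆ l² × l²`. -/
def incl (F : WSeq 1 1 × WSeq 1 1) : Seq 2 × Seq 2 :=
  (⟨F.1.val, memℓp_two_of_wSeq F.1⟩, ⟨F.2.val, memℓp_two_of_wSeq F.2⟩)

/-! ### Discrete solitons -/

/-- The limiting configuration: `1` on `U₊`, `-1` on `U₋`, `0` elsewhere. -/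
def limitConfig (Up Um : Finset ℤ) : RealSeq :=
  ∑ n ∈ Up, lp.single 2 n (1 : ℝ) - ∑ n ∈ Um, lp.single 2 n (1 : ℝ)

/-- The stationary dNLS equation
`(1 - φ_n^{2p}) φ_n = ε (φ_{n+1} - 2 φ_n + φ_{n-1})`. -/
def IsStationary (p : ℕ) (ε : ℝ) (φ : RealSeq) : Prop :=
  ∀ n : ℤ, (1 - φ n ^ (2 * p)) * φ n = ε * (φ (n + 1) - 2 * φ n + φ (n - 1))

/-- A set of sites is simply connected if no other lattice site lies between two of its
elements. -/
def IsSimplyConnected (U : Finset ℤ) : Prop :=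
  ∀ a ∈ U, ∀ b ∈ U, ∀ n : ℤ, a < n → n < b → n ∈ U

/-! ### The linearization -/

theorem memℓp_shift (k : ℤ) (u : Seq 2) : Memℓp (fun n => u (n + k)) 2 := by
  have h2 : 0 < (2 : ℝ≥0∞).toReal := by norm_num
  exact memℓp_gen ((lp.memℓp u |>.summable h2).comp_injective (add_left_injective k))

/-- The shift `(S_k u)_n = u_{n+k}` on `l²(ℤ)`. -/
def shift (k : ℤ) : Seq 2 →L[ℂ] Seq 2 :=
  LinearMap.mkContinuous
    { toFun := fun u => ⟨fun n => u (n + k), memℓp_shift k u⟩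
      map_add' := fun u v => by ext n; rfl
      map_smul' := fun c u => by ext n; rfl } 1 (by
    intro u
    have h2 : 0 < (2 : ℝ≥0∞).toReal := by norm_num
    refine lp.norm_le_of_tsum_le h2 (by positivity) ?_
    rw [one_mul, lp.norm_rpow_eq_tsum h2]
    exact ((Equiv.addRight k).tsum_eq (fun n => ‖u n‖ ^ (2 : ℝ≥0∞).toReal)).le)

/-- The discrete Laplacian `(Δu)_n = u_{n+1} - 2 u_n + u_{n-1}` on `l²(ℤ)`. -/
def laplacian : Seq 2 →L[ℂ] Seq 2 :=
  shift 1 - (2 : ℂ) • ContinuousLinearMap.id ℂ (Seq 2) + shift (-1)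

/-- Multiplication by `φ_n^{2p}` on `l²(ℤ)`. -/
def potential (p : ℕ) (φ : RealSeq) : Seq 2 →L[ℂ] Seq 2 :=
  lp.mapCLM 2 (fun n : ℤ => ((φ n : ℂ) ^ (2 * p)) • ContinuousLinearMap.id ℂ ℂ)
    (K := ‖φ‖ ^ (2 * p)) (by positivity) (by
    intro n
    refine ContinuousLinearMap.opNorm_le_bound _ (by positivity) fun x => ?_
    have h : ‖φ n‖ ≤ ‖φ‖ := lp.norm_apply_le_norm (by norm_num) φ n
    have h' : ‖φ n‖ ^ (2 * p) ≤ ‖φ‖ ^ (2 * p) := pow_le_pow_left₀ (norm_nonneg _) h _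
    simpa using mul_le_mul_of_nonneg_right h' (norm_nonneg x))

/-- The linearization of the dNLS equation at `φ`, as an operator on `l² × l²` in the variables
`a = u + iw`, `b = u - iw`:
`L = [[-εΔ + I - (1+p)V, -pV], [pV, εΔ - I + (1+p)V]]` with `V = φ^{2p}`. -/
def linearization (p : ℕ) (ε : ℝ) (φ : RealSeq) :
    (Seq 2 × Seq 2) →L[ℂ] (Seq 2 × Seq 2) :=
  let I := ContinuousLinearMap.id ℂ (Seq 2)
  let V := potential p φ
  let A := -((ε : ℂ) • laplacian) + I - ((1 + p : ℕ) : ℂ) • V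
  let B := (p : ℂ) • V
  (A.coprod (-B)).prod (B.coprod (-A))

theorem laplacian_apply (u : Seq 2) (n : ℤ) :
    laplacian u n = u (n + 1) - 2 * u n + u (n - 1) := rfl

theorem potential_apply (p : ℕ) (φ : RealSeq) (u : Seq 2) (n : ℤ) :
    potential p φ u n = (φ n : ℂ) ^ (2 * p) * u n := rfl

theorem linearization_fst (p : ℕ) (ε : ℝ) (φ : RealSeq) (a b : Seq 2) (n : ℤ) :
    (linearization p ε φ (a, b)).1 n =
      -ε * (a (n + 1) - 2 * a n + a (n - 1)) + a n
        - (φ n : ℂ) ^ (2 * p) * ((1 + p) * a n + p * b n) := by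
  change (-((ε : ℂ) * laplacian a n) + a n - ((1 + p : ℕ) : ℂ) * potential p φ a n)
    + -((p : ℂ) * potential p φ b n) = _
  rw [laplacian_apply, potential_apply, potential_apply]
  push_cast
  ring

theorem linearization_snd (p : ℕ) (ε : ℝ) (φ : RealSeq) (a b : Seq 2) (n : ℤ) :
    (linearization p ε φ (a, b)).2 n =
      ε * (b (n + 1) - 2 * b n + b (n - 1)) - b n
        + (φ n : ℂ) ^ (2 * p) * (p * a n + (1 + p) * b n) := by
  change (p : ℂ) * potential p φ a n
    + -(-((ε : ℂ) * laplacian b n) + b n - ((1 + p : ℕ) : ℂ) * potential p φ b n) = _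
  rw [laplacian_apply, potential_apply, potential_apply]
  push_cast
  ring

/-! ### Resolvent, poles and boundary values -/

/-- `L - Ω I` on `l² × l²`. -/
def shifted (L : (Seq 2 × Seq 2) →L[ℂ] (Seq 2 × Seq 2)) (Ω : ℂ) :
    (Seq 2 × Seq 2) →L[ℂ] (Seq 2 × Seq 2) :=
  L - Ω • ContinuousLinearMap.id ℂ (Seq 2 × Seq 2)

/-- `Ω` is a regular point: `L - Ω I` has a bounded inverse on `l² × l²`. -/
def IsRegular (L : (Seq 2 × Seq 2) →L[ℂ] (Seq 2 × Seq 2)) (Ω : ℂ) : Prop :=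
  IsUnit (shifted L Ω)

/-- The resolvent `R(Ω) = (L - Ω I)⁻¹` (equal to `0` by convention if `Ω` is not regular). -/
def res (L : (Seq 2 × Seq 2) →L[ℂ] (Seq 2 × Seq 2)) (Ω : ℂ) :
    (Seq 2 × Seq 2) →L[ℂ] (Seq 2 × Seq 2) :=
  Ring.inverse (shifted L Ω)

/-- The generalized eigenspace `⋃ₖ ker (L - z I)^k`; if `z` is a pole of the resolvent, this is the
range of the residue of the resolvent at `z`, and its dimension is the multiplicity of the pole. -/
def genEigenspace (L : (Seq 2 × Seq 2) →L[ℂ] (Seq 2 × Seq 2)) (z : ℂ) :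
    Submodule ℂ (Seq 2 × Seq 2) :=
  Module.End.maxGenEigenspace (L : Module.End ℂ (Seq 2 × Seq 2)) z

/-- In the open set `D` the resolvent of `L` is regular except for finitely many poles, and the
multiplicities of these poles are finite and add up to `m`. -/
def HasExactlyPoles (L : (Seq 2 × Seq 2) →L[ℂ] (Seq 2 × Seq 2)) (D : Set ℂ) (m : ℕ) : Prop :=
  ∃ P : Finset ℂ,
    (∀ z : ℂ, z ∈ P ↔ z ∈ D ∧ ¬ IsRegular L z) ∧
    (∀ z ∈ P, MeromorphicAt (res L) z ∧ meromorphicOrderAt (res L) z < 0 ∧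
      FiniteDimensional ℂ (genEigenspace L z)) ∧
    ∑ z ∈ P, Module.finrank ℂ (genEigenspace L z) = m

/-- The two bands `[1, 1+4ε] ∪ [-1-4ε, -1]` of the continuous spectrum. -/
def bands (ε : ℝ) : Set ℝ := Icc 1 (1 + 4 * ε) ∪ Icc (-1 - 4 * ε) (-1)

/-- `T : l¹₁ × l¹₁ → l^∞ × l^∞` is the limit, as `μ ↓ 0`, of the resolvents `R(Ω + iσμ)`
(`σ = 1`: limit from above, `σ = -1`: limit from below). The limit is taken in the operator norm
from `l¹₁ × l¹₁` to `l^∞_{-s} × l^∞_{-s}`, for every `s > 0`; in particular every entry of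
`R(Ω + iσμ)F` converges to the corresponding entry of `TF`. -/
def IsBoundaryValue (L : (Seq 2 × Seq 2) →L[ℂ] (Seq 2 × Seq 2)) (σ Ω : ℝ)
    (T : (WSeq 1 1 × WSeq 1 1) →L[ℂ] (Seq ∞ × Seq ∞)) : Prop :=
  ∀ s : ℝ, 0 < s → ∀ η : ℝ, 0 < η → ∀ᶠ μ : ℝ in 𝓝[>] 0,
    IsRegular L (Ω + σ * μ * Complex.I) ∧
    ∀ (F : WSeq 1 1 × WSeq 1 1) (n : ℤ),
      weight (-s) n * ‖(res L (Ω + σ * μ * Complex.I) (incl F)).1 n - (T F).1 n‖ ≤ η * ‖F‖ ∧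
      weight (-s) n * ‖(res L (Ω + σ * μ * Complex.I) (incl F)).2 n - (T F).2 n‖ ≤ η * ‖F‖

end DNLS

end

noncomputable section

namespace DNLS

/-! ### Existence, uniqueness and decay of the discrete soliton -/

/-! The mechanism is the anti-continuum limit ε → 0, in which the sites decouple. With U = U₊ ∪ U₋ =
[a, b] as core, the limiting linearization acts on a core site by p[[-1, -1], [1, 1]], whose square
is zero, and on any other site by diag(1, -1). Its spectrum is 0, with algebraic multiplicity 2N,
and ±1 with infinite multiplicity. What has to be controlled is how the coupling ε turns ±1 into
bands.

The soliton comes from a contraction: dividing by the derivative of (1 - x^{2p})x at 0 or ±1, which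
has modulus at least 1, gives a fixed point problem with a small Lipschitz remainder
(`exists_soliton`). Solving the stationary equation for φ_n off the core gains a factor ε per site.
Hence φ^{2p} differs from the indicator of the core by O(ε) on the core, and by O(ε²) with an
ε-independent exponential rate off it (`soliton_potential_bound`).

Poles: in operator norm on l² the linearization is within O(ε) of N + J, with N nilpotent on the
core and J an involution off it. A Riccati equation (`Splitting.exists_riccati`) supplies a
similarity to a block triangular operator. Its finite block, of size 2N, has all its eigenvalues in
the disk of radius δ; the other block minus z is invertible for z in that disk. The poles are
therefore the roots of the characteristic polynomial of the finite block, and their multiplicities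
add up to its degree (`BlockTriangular.hasExactlyPoles`).

Norm perturbation fails near the bands, whose width is also O(ε). There the lattice is cut at the
core: the decoupled operator is the nilpotent matrix on [a, b] and a Dirichlet Laplacian on each of
the two half-lines outside. Its resolvent is explicit, with half-line spectral parameters l
satisfying ε(l + l⁻¹) = 2ε + 1 ∓ Ω and |l| ≤ 1. The Dirichlet Green function is a finite geometric
sum in l, bounded by the distance of the source to the core even at l = ±1. So the band edges are
harmless from l¹₁ to l^∞, and the free resolvent is O(ε⁻¹). Simple connectedness of U matters here:
the complement of the core consists of two half-lines and no bounded gap.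

Restoring the coupling gives an equation (1 + A)u = v, in which A is the free resolvent composed
with the perturbation. A is not small in the sup norm: the core feeds the outside with strength ε ·
ε⁻¹ = O(1). The feedback to the core, however, is O(ε), and the potential off the core contributes
ε² · ε⁻¹. In a norm giving core values a large fixed factor k, A contracts by 1/2, uniformly in Ω
with |Ω| ≥ δ, in l in the closed disk, and in weights n^s with 0 ≤ s ≤ 1 (`exists_contraction`).
This yields regularity off the bands (`isRegular_of_isUnit`), a bounded limit on them, and, because
the free resolvents are Hölder continuous up to the boundary in weighted norms, convergence to that
limit (`exists_boundaryValue`). -/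

/-- The nonlinearity `x ↦ (1 - x^{2p}) x` is, near each of its zeros `0, ±1`, a small Lipschitz
perturbation of its linearization; the perturbation extends to a globally Lipschitz function. -/
theorem exists_lipschitz_remainder (p : ℕ) (c : ℝ) (hc : (1 - c ^ (2 * p)) * c = 0) :
    ∃ ρ : ℝ, 0 < ρ ∧ ∀ r : ℝ, 0 < r → r ≤ ρ → ∃ q : ℝ → ℝ, q 0 = 0 ∧
      (∀ x y, |q x - q y| ≤ 1 / 4 * |x - y|) ∧
      ∀ x, |x| ≤ r → q x = (1 - (2 * p + 1) * c ^ (2 * p)) * x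
        - (1 - (c + x) ^ (2 * p)) * (c + x) := by
  have hd : HasStrictDerivAt (fun x : ℝ => (1 - (c + x) ^ (2 * p)) * (c + x))
      (1 - (2 * p + 1) * c ^ (2 * p)) 0 := by
    have h1 : HasStrictDerivAt (fun x : ℝ => c + x) 1 0 := (hasStrictDerivAt_id 0).const_add c
    have h2 := ((h1.fun_pow (2 * p)).const_sub 1).mul h1
    refine h2.congr_deriv ?_
    rcases Nat.eq_zero_or_pos p with rfl | hp
    · simp
    · have : c ^ (2 * p) = c ^ (2 * p - 1) * c := by
        rw [← pow_succ]; congr 1; omega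
      simp only [add_zero]
      rw [this]; push_cast; ring
  obtain ⟨s, hs, hA⟩ := hd.hasStrictFDerivAt.approximates_deriv_on_nhds
    (c := 1 / 4) (Or.inr (by norm_num))
  obtain ⟨ρ, hρ, hball⟩ := Metric.mem_nhds_iff.mp hs
  refine ⟨ρ / 2, by positivity, fun r hr hrρ => ?_⟩
  -- The retraction onto [-r, r] is 1-Lipschitz and the identity there, so composing with it makes
  -- the local bound from strict differentiability global.
  set cl : ℝ → ℝ := fun x => max (-r) (min r x) with hcl
  have hcl_mem : ∀ x, |cl x| ≤ r := fun x =>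
    abs_le.2 ⟨le_max_left _ _, max_le (by linarith) (min_le_left _ _)⟩
  have hcl_lip : ∀ x y, |cl x - cl y| ≤ |x - y| := fun x y => by
    refine (abs_max_sub_max_le_max _ _ _ _).trans ?_
    rw [sub_self, abs_zero, max_eq_right (abs_nonneg _)]
    refine (abs_min_sub_min_le_max _ _ _ _).trans ?_
    rw [sub_self, abs_zero, max_eq_right (abs_nonneg _)]
  have hcl_id : ∀ x, |x| ≤ r → cl x = x := fun x hx => by
    obtain ⟨h1, h2⟩ := abs_le.1 hx
    simp [hcl, h1, h2]
  refine ⟨fun x => (1 - (2 * p + 1) * c ^ (2 * p)) * cl x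
      - (1 - (c + cl x) ^ (2 * p)) * (c + cl x), ?_, ?_, ?_⟩
  · have : cl 0 = 0 := hcl_id 0 (by simpa using hr.le)
    simp [this, hc]
  · intro x y
    have hx : cl x ∈ s := hball (by simpa using (hcl_mem x).trans_lt (by linarith))
    have hy : cl y ∈ s := hball (by simpa using (hcl_mem y).trans_lt (by linarith))
    have h := hA _ hx _ hy
    simp only [Real.norm_eq_abs, ContinuousLinearMap.toSpanSingleton_apply, smul_eq_mul] at h
    rw [abs_sub_comm] at h
    have h4 : ((1 / 4 : NNReal) : ℝ) = 1 / 4 := by norm_num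
    rw [h4] at h
    refine le_trans (le_of_eq ?_) (h.trans (mul_le_mul_of_nonneg_left (hcl_lip x y) (by norm_num)))
    congr 1; ring
  · intro x hx
    simp only [hcl_id x hx]

theorem memℓp_real_shift (k : ℤ) (u : RealSeq) : Memℓp (fun n => u (n + k)) 2 := by
  have h2 : 0 < (2 : ℝ≥0∞).toReal := by norm_num
  exact memℓp_gen ((lp.memℓp u |>.summable h2).comp_injective (add_left_injective k))

/-- The shift on real sequences. -/
def realShift (k : ℤ) (u : RealSeq) : RealSeq := ⟨fun n => u (n + k), memℓp_real_shift k u⟩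

theorem norm_realShift_le (k : ℤ) (u : RealSeq) : ‖realShift k u‖ ≤ ‖u‖ := by
  have h2 : 0 < (2 : ℝ≥0∞).toReal := by norm_num
  refine lp.norm_le_of_tsum_le h2 (by positivity) ?_
  rw [lp.norm_rpow_eq_tsum h2]
  exact ((Equiv.addRight k).tsum_eq (fun n => ‖u n‖ ^ (2 : ℝ≥0∞).toReal)).le

theorem realShift_sub (k : ℤ) (u v : RealSeq) :
    realShift k (u - v) = realShift k u - realShift k v := rfl

/-- The discrete Laplacian on real sequences. -/
def realLaplacian (u : RealSeq) : RealSeq := realShift 1 u - (2 : ℝ) • u + realShift (-1) u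

theorem realLaplacian_apply (u : RealSeq) (n : ℤ) :
    realLaplacian u n = u (n + 1) - 2 * u n + u (n - 1) := rfl

theorem norm_realLaplacian_le (u : RealSeq) : ‖realLaplacian u‖ ≤ 4 * ‖u‖ := by
  have h := norm_add_le (realShift 1 u - (2 : ℝ) • u) (realShift (-1) u)
  have h' := norm_sub_le (realShift 1 u) ((2 : ℝ) • u)
  have h1 := norm_realShift_le 1 u
  have h2 := norm_realShift_le (-1) u
  have h3 : ‖(2 : ℝ) • u‖ = 2 * ‖u‖ := by rw [norm_smul]; norm_num
  unfold realLaplacian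
  linarith

theorem realLaplacian_sub (u v : RealSeq) :
    realLaplacian (u - v) = realLaplacian u - realLaplacian v := by
  unfold realLaplacian
  rw [realShift_sub, realShift_sub, smul_sub]; abel

/-- Pointwise domination in `l²` with a factor. -/
theorem norm_le_mul_of_forall_le {E : Type*} [NormedAddCommGroup E]
    {u v : lp (fun _ : ℤ => E) 2} {c : ℝ} (hc : 0 ≤ c)
    (h : ∀ n, ‖u n‖ ≤ c * ‖v n‖) : ‖u‖ ≤ c * ‖v‖ := by
  have h2 : 0 < (2 : ℝ≥0∞).toReal := by norm_num
  refine lp.norm_le_of_forall_sum_le h2 (by positivity) fun s => ?_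
  calc ∑ i ∈ s, ‖u i‖ ^ (2 : ℝ≥0∞).toReal
      ≤ ∑ i ∈ s, c ^ (2 : ℝ≥0∞).toReal * ‖v i‖ ^ (2 : ℝ≥0∞).toReal := by
        refine Finset.sum_le_sum fun i _ => ?_
        rw [← Real.mul_rpow hc (norm_nonneg _)]
        exact Real.rpow_le_rpow (norm_nonneg _) (h i) h2.le
    _ ≤ c ^ (2 : ℝ≥0∞).toReal * ‖v‖ ^ (2 : ℝ≥0∞).toReal := by
        rw [← Finset.mul_sum]
        exact mul_le_mul_of_nonneg_left (lp.sum_rpow_le_norm_rpow h2 v s) (by positivity)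
    _ = (c * ‖v‖) ^ (2 : ℝ≥0∞).toReal := (Real.mul_rpow hc (norm_nonneg _)).symm

theorem memℓp_of_forall_le {E F : Type*} [NormedAddCommGroup E] [NormedAddCommGroup F]
    {f : ℤ → E} {g : ℤ → F} {q : ℝ≥0∞} (hg : Memℓp g q) (c : ℝ)
    (h : ∀ n, ‖f n‖ ≤ c * ‖g n‖) : Memℓp f q :=
  (hg.norm.const_mul c).mono h

/-- Contraction mapping for pointwise nonlinear equations with a small discrete Laplacian. -/
theorem exists_unique_perturbation (g : ℤ → ℝ → ℝ) (d : ℤ → ℝ) (φ₀ : RealSeq)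
    (hg0 : ∀ n, g n 0 = 0) (hg : ∀ n x y, |g n x - g n y| ≤ 1 / 4 * |x - y|)
    (hd : ∀ n, |d n| ≤ 1) (ε : ℝ) (hε : 0 < ε) (hε' : ε ≤ 1 / 16) :
    ∃ ψ : RealSeq, (∀ n, ψ n = g n (ψ n) + d n * (ε * realLaplacian (φ₀ + ψ) n)) ∧
      ‖ψ‖ ≤ 8 * ε * ‖φ₀‖ ∧
      ∀ χ : RealSeq, (∀ n, χ n = g n (χ n) + d n * (ε * realLaplacian (φ₀ + χ) n)) → χ = ψ := by
  have hG : ∀ ψ : RealSeq, Memℓp (fun n => g n (ψ n)) 2 := fun ψ =>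
    memℓp_of_forall_le (lp.memℓp ψ) (1 / 4) fun n => by
      have := hg n (ψ n) 0
      simpa [hg0] using this
  have hD : ∀ ψ : RealSeq, Memℓp (fun n => d n * (ε * realLaplacian (φ₀ + ψ) n)) 2 := fun ψ =>
    memℓp_of_forall_le (lp.memℓp (realLaplacian (φ₀ + ψ))) ε fun n => by
      simp only [Real.norm_eq_abs, abs_mul, abs_of_pos hε]
      have := mul_le_mul_of_nonneg_right (hd n)
        (by positivity : 0 ≤ ε * |realLaplacian (φ₀ + ψ) n|)
      linarith
  set G : RealSeq → RealSeq := fun ψ => ⟨_, hG ψ⟩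
  set D : RealSeq → RealSeq := fun ψ => ⟨_, hD ψ⟩
  have hGl : ∀ ψ χ, ‖G ψ - G χ‖ ≤ 1 / 4 * ‖ψ - χ‖ := fun ψ χ =>
    norm_le_mul_of_forall_le (by norm_num) fun n => hg n (ψ n) (χ n)
  have hDl : ∀ ψ χ, ‖D ψ - D χ‖ ≤ 1 / 4 * ‖ψ - χ‖ := fun ψ χ => by
    have h1 : ‖D ψ - D χ‖ ≤ ε * ‖realLaplacian (ψ - χ)‖ := by
      refine norm_le_mul_of_forall_le hε.le fun n => ?_
      have h0 : realLaplacian (ψ - χ) = realLaplacian (φ₀ + ψ) - realLaplacian (φ₀ + χ) := by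
        rw [← realLaplacian_sub]; congr 1; abel
      have h2 : (D ψ - D χ : RealSeq) n = d n * (ε * realLaplacian (ψ - χ) n) := by
        rw [h0]
        change d n * (ε * realLaplacian (φ₀ + ψ) n) - d n * (ε * realLaplacian (φ₀ + χ) n) =
          d n * (ε * (realLaplacian (φ₀ + ψ) n - realLaplacian (φ₀ + χ) n))
        ring
      rw [h2]
      simp only [Real.norm_eq_abs, abs_mul, abs_of_pos hε]
      have := mul_le_mul_of_nonneg_right (hd n)
        (by positivity : 0 ≤ ε * |realLaplacian (ψ - χ) n|)
      linarith
    have h2 := norm_realLaplacian_le (ψ - χ)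
    nlinarith [norm_nonneg (ψ - χ)]
  -- The constant 1/2 is 1/4 from the nonlinear remainder plus 4ε ≤ 1/4 from the Laplacian.
  have hK : ContractingWith (1 / 2) fun ψ => G ψ + D ψ := by
    refine ⟨by rw [← NNReal.coe_lt_coe]; norm_num, LipschitzWith.of_dist_le_mul fun ψ χ => ?_⟩
    rw [dist_eq_norm, dist_eq_norm, add_sub_add_comm]
    have := norm_add_le (G ψ - G χ) (D ψ - D χ)
    have h1 := hGl ψ χ
    have h2 := hDl ψ χ
    have : ((1 / 2 : NNReal) : ℝ) = 1 / 2 := by norm_num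
    rw [this]; linarith
  have hfix : ∀ ψ : RealSeq, (∀ n, ψ n = g n (ψ n) + d n * (ε * realLaplacian (φ₀ + ψ) n)) ↔
      Function.IsFixedPt (fun ψ => G ψ + D ψ) ψ := fun ψ => by
    constructor
    · intro h
      exact lp.ext (funext fun n => (h n).symm)
    · intro h n
      exact (congrArg (fun w : RealSeq => w n) h).symm
  set ψ := ContractingWith.fixedPoint _ hK
  have hψ : Function.IsFixedPt (fun ψ => G ψ + D ψ) ψ := hK.fixedPoint_isFixedPt
  refine ⟨ψ, (hfix ψ).2 hψ, ?_, fun χ hχ => hK.fixedPoint_unique ((hfix χ).1 hχ)⟩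
  have e1 : ψ = (G ψ - G 0) + (D ψ - D 0) + D 0 := by
    have h0 : G 0 = 0 := lp.ext (funext fun n => hg0 n)
    rw [h0]
    have : G ψ + D ψ = ψ := hψ
    rw [sub_zero, add_assoc, sub_add_cancel, this]
  have e2 : ‖D 0‖ ≤ ε * ‖realLaplacian φ₀‖ := by
    refine norm_le_mul_of_forall_le hε.le fun n => ?_
    change |d n * (ε * realLaplacian (φ₀ + 0) n)| ≤ _
    rw [add_zero]
    simp only [Real.norm_eq_abs, abs_mul, abs_of_pos hε]
    have := mul_le_mul_of_nonneg_right (hd n)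
      (by positivity : 0 ≤ ε * |realLaplacian φ₀ n|)
    linarith
  have e3 := norm_realLaplacian_le φ₀
  have e4 : ‖ψ‖ ≤ ‖G ψ - G 0‖ + ‖D ψ - D 0‖ + ‖D 0‖ := by
    conv_lhs => rw [e1]
    exact norm_add₃_le
  have e5 := hGl ψ 0
  have e6 := hDl ψ 0
  rw [sub_zero] at e5 e6
  nlinarith [norm_nonneg φ₀]

theorem limitConfig_apply {Up Um : Finset ℤ} (n : ℤ) :
    limitConfig Up Um n = (if n ∈ Up then 1 else 0) - (if n ∈ Um then 1 else 0) := by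
  have h : ∀ U : Finset ℤ, (∑ k ∈ U, lp.single 2 k (1 : ℝ) : RealSeq) n = if n ∈ U then 1 else 0 := by
    intro U
    rw [lp.coeFn_sum, Finset.sum_apply]
    simp only [lp.single_apply, Pi.single_apply]
    simp
  change (∑ k ∈ Up, lp.single 2 k (1 : ℝ) : RealSeq) n - (∑ k ∈ Um, lp.single 2 k (1 : ℝ) : RealSeq) n = _
  rw [h, h]

theorem limitConfig_cases {Up Um : Finset ℤ} (h : Disjoint Up Um) (n : ℤ) :
    (n ∈ Up ∪ Um ∧ (limitConfig Up Um n = 1 ∨ limitConfig Up Um n = -1)) ∨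
    (n ∉ Up ∪ Um ∧ limitConfig Up Um n = 0) := by
  rw [limitConfig_apply]
  by_cases h1 : n ∈ Up
  · have h2 : n ∉ Um := Finset.disjoint_left.1 h h1
    left; simp [h1, h2]
  · by_cases h2 : n ∈ Um <;> simp [h1, h2]

/-- The discrete soliton. The radius of uniqueness can be taken arbitrarily small. -/
theorem exists_soliton (p : ℕ) (hp : 1 ≤ p) {Up Um : Finset ℤ} (hdisj : Disjoint Up Um) :
    ∃ ρ : ℝ, 0 < ρ ∧ ρ ≤ 1 / 2 ∧ ∃ ε₀ : ℝ, 0 < ε₀ ∧ ∃ C : ℝ, 0 < C ∧ ∀ ε, 0 < ε → ε < ε₀ →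
      ∃ φ : RealSeq, IsStationary p ε φ ∧ ‖φ - limitConfig Up Um‖ < ρ ∧
        (∀ ψ : RealSeq, IsStationary p ε ψ → ‖ψ - limitConfig Up Um‖ < ρ → ψ = φ) ∧
        ‖φ - limitConfig Up Um‖ ≤ C * ε := by
  have hp' : (1 : ℝ) ≤ p := by exact_mod_cast hp
  have hp0 : 2 * p ≠ 0 := by omega
  obtain ⟨r0, h0, H0⟩ := exists_lipschitz_remainder p 0 (by simp)
  obtain ⟨r1, h1, H1⟩ := exists_lipschitz_remainder p 1 (by simp)
  obtain ⟨r2, h2, H2⟩ := exists_lipschitz_remainder p (-1) (by simp [pow_mul])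
  set ρ := min (1 / 2) (min r0 (min r1 r2)) with hρ
  have hρpos : 0 < ρ := by positivity
  obtain ⟨q0, A0, B0, C0⟩ := H0 ρ hρpos (by simp [hρ])
  obtain ⟨q1, A1, B1, C1⟩ := H1 ρ hρpos (by simp [hρ])
  obtain ⟨q2, A2, B2, C2⟩ := H2 ρ hρpos (by simp [hρ])
  set φ₀ := limitConfig Up Um
  have key : ∀ n : ℤ, ∃ (g : ℝ → ℝ) (d : ℝ), g 0 = 0 ∧ (∀ x y, |g x - g y| ≤ 1 / 4 * |x - y|) ∧
      |d| ≤ 1 ∧ d ≠ 0 ∧ ∀ x, |x| ≤ ρ →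
        x - g x = d * ((1 - (φ₀ n + x) ^ (2 * p)) * (φ₀ n + x)) := by
    -- D is the derivative of the nonlinearity at c: 1 for c = 0 and -2p for c = ±1. Since |D| ≥ 1,
    -- division by D does not increase the Lipschitz constant.
    have aux : ∀ (c : ℝ) (q : ℝ → ℝ), q 0 = 0 → (∀ x y, |q x - q y| ≤ 1 / 4 * |x - y|) →
        (∀ x, |x| ≤ ρ → q x = (1 - (2 * p + 1) * c ^ (2 * p)) * x
        - (1 - (c + x) ^ (2 * p)) * (c + x)) → 1 ≤ |1 - (2 * p + 1) * c ^ (2 * p)| →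
        ∃ (g : ℝ → ℝ) (d : ℝ), g 0 = 0 ∧ (∀ x y, |g x - g y| ≤ 1 / 4 * |x - y|) ∧
        |d| ≤ 1 ∧ d ≠ 0 ∧ ∀ x, |x| ≤ ρ →
          x - g x = d * ((1 - (c + x) ^ (2 * p)) * (c + x)) := by
      intro c q A B C hD
      set D := 1 - (2 * p + 1) * c ^ (2 * p)
      have hD0 : D ≠ 0 := by
        intro h; rw [h] at hD; norm_num at hD
      refine ⟨fun x => D⁻¹ * q x, D⁻¹, by simp [A], fun x y => ?_, ?_, inv_ne_zero hD0, ?_⟩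
      · rw [← mul_sub, abs_mul, abs_inv]
        have := inv_le_one_of_one_le₀ hD
        exact (mul_le_of_le_one_left (abs_nonneg _) this).trans (B x y)
      · rw [abs_inv]; exact inv_le_one_of_one_le₀ hD
      · intro x hx
        simp only [C x hx]
        field_simp; ring
    intro n
    rcases limitConfig_cases hdisj n with ⟨-, h | h⟩ | ⟨-, h⟩
    · rw [show φ₀ n = 1 from h]
      refine aux 1 q1 A1 B1 C1 ?_
      rw [one_pow, abs_of_nonpos (by linarith)]; linarith
    · rw [show φ₀ n = -1 from h]
      refine aux (-1) q2 A2 B2 C2 ?_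
      rw [pow_mul, neg_one_sq, one_pow, abs_of_nonpos (by linarith)]; linarith
    · rw [show φ₀ n = 0 from h]
      refine aux 0 q0 A0 B0 C0 ?_
      simp [hp0]
  choose g d hg0 hg hd hd0 hgd using key
  -- An l²-ball of radius ρ is pointwise in [-ρ, ρ], where the truncated and the true nonlinearity
  -- coincide. Global uniqueness for the truncated problem thus gives uniqueness in the ball.
  have hequiv : ∀ (ε : ℝ) (φ : RealSeq), ‖φ - φ₀‖ ≤ ρ → (IsStationary p ε φ ↔
      ∀ n, (φ - φ₀) n = g n ((φ - φ₀) n) + d n * (ε * realLaplacian (φ₀ + (φ - φ₀)) n)) := by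
    intro ε φ hφ
    refine forall_congr' fun n => ?_
    have hx : |(φ - φ₀) n| ≤ ρ := (lp.norm_apply_le_norm (by norm_num) (φ - φ₀) n).trans hφ
    have h := hgd n _ hx
    have e : φ₀ n + (φ - φ₀) n = φ n := add_sub_cancel (φ₀ n) (φ n)
    rw [e] at h
    rw [add_sub_cancel, realLaplacian_apply, ← sub_eq_iff_eq_add', h, mul_right_inj' (hd0 n)]
  set M := ‖φ₀‖
  -- The fixed point has norm at most 8εM; the second bound on ε puts it inside the ball of radius
  -- ρ.
  refine ⟨ρ, hρpos, min_le_left _ _, min (1 / 16) (ρ / (8 * M + 1)), by positivity,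
    8 * M + 1, by positivity, fun ε hε hε0 => ?_⟩
  obtain ⟨ψ, hψ, hn, hu⟩ := exists_unique_perturbation g d φ₀ hg0 hg hd ε hε
    (hε0.le.trans (min_le_left _ _))
  have hlt : ε * (8 * M + 1) < ρ := by
    rw [← lt_div_iff₀ (by positivity)]
    exact hε0.trans_le (min_le_right _ _)
  have hnρ : ‖ψ‖ < ρ := by nlinarith
  refine ⟨φ₀ + ψ, ?_, ?_, ?_, ?_⟩
  · rw [hequiv ε _ (by rw [add_sub_cancel_left]; exact hnρ.le), add_sub_cancel_left]
    exact hψ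
  · rw [add_sub_cancel_left]; exact hnρ
  · intro χ hχ hχn
    rw [← hu (χ - φ₀) ((hequiv ε χ hχn.le).1 hχ), add_sub_cancel]
  · rw [add_sub_cancel_left]; nlinarith

/-! ### Decay of the soliton off its core -/

/-- Distance of a site to the interval `[a, b]`. -/
def siteDist (a b n : ℤ) : ℕ := (n - b).toNat + (a - n).toNat

theorem siteDist_eq_zero {a b n : ℤ} : siteDist a b n = 0 ↔ a ≤ n ∧ n ≤ b := by
  unfold siteDist; omega

theorem exists_Icc_of_isSimplyConnected {U : Finset ℤ} (hne : U.Nonempty)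
    (h : IsSimplyConnected U) : ∃ a b : ℤ, a ≤ b ∧ ∀ n, n ∈ U ↔ a ≤ n ∧ n ≤ b := by
  refine ⟨U.min' hne, U.max' hne, U.min'_le _ (U.max'_mem hne), fun n => ?_⟩
  refine ⟨fun hn => ⟨U.min'_le _ hn, U.le_max' _ hn⟩, fun ⟨h1, h2⟩ => ?_⟩
  rcases h1.eq_or_lt with h1 | h1
  · rw [← h1]; exact U.min'_mem hne
  rcases h2.eq_or_lt with h2 | h2
  · rw [h2]; exact U.max'_mem hne
  exact h _ (U.min'_mem hne) _ (U.max'_mem hne) n h1 h2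

/-- Exponential decay of the soliton away from its core. -/
theorem soliton_decay {p : ℕ} (hp : 1 ≤ p) {ε : ℝ} (hε : 0 < ε) (hε' : ε ≤ 1 / 16) {φ : RealSeq}
    (hφ : IsStationary p ε φ) {a b : ℤ} (hab : a ≤ b) (h2 : ∀ n, |φ n| ≤ 2)
    (hsmall : ∀ n, siteDist a b n ≠ 0 → |φ n| ≤ 1 / 2) (k : ℕ) :
    ∀ n, k ≤ siteDist a b n → |φ n| ≤ 2 * (8 * ε) ^ k := by
  induction k with
  | zero => intro n _; simpa using h2 n
  | succ k ih =>
    intro n hn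
    have e := hφ n
    have hs := hsmall n (by omega)
    have i1 := ih (n + 1) (by unfold siteDist at *; omega)
    have i2 := ih (n - 1) (by unfold siteDist at *; omega)
    have hq : φ n ^ (2 * p) ≤ 1 / 4 := by
      rw [pow_mul]
      have h1 : φ n ^ 2 ≤ 1 / 4 := by
        rw [← sq_abs]; nlinarith [abs_nonneg (φ n)]
      calc (φ n ^ 2) ^ p ≤ (φ n ^ 2) ^ 1 :=
            pow_le_pow_of_le_one (sq_nonneg _) (by linarith) hp
        _ ≤ 1 / 4 := by rwa [pow_one]
    have e1 : (1 - φ n ^ (2 * p) + 2 * ε) * φ n = ε * (φ (n + 1) + φ (n - 1)) := by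
      linear_combination e
    have e2 : (1 - φ n ^ (2 * p) + 2 * ε) * |φ n| = ε * |φ (n + 1) + φ (n - 1)| := by
      rw [← abs_of_pos (show 0 < 1 - φ n ^ (2 * p) + 2 * ε by linarith), ← abs_mul, e1, abs_mul,
        abs_of_pos hε]
    have e3 := abs_add_le (φ (n + 1)) (φ (n - 1))
    -- Off the core the diagonal coefficient 1 - φ^{2p} + 2ε is at least 1/2, so the equation bounds
    -- |φ n| by 2ε times the sum over the two neighbours, each at distance at least k.
    have e4 : 1 / 2 * |φ n| ≤ (1 - φ n ^ (2 * p) + 2 * ε) * |φ n| :=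
      mul_le_mul_of_nonneg_right (by linarith) (abs_nonneg _)
    have e5 : ε * |φ (n + 1) + φ (n - 1)| ≤ ε * (4 * (8 * ε) ^ k) :=
      mul_le_mul_of_nonneg_left (by linarith) hε.le
    rw [pow_succ]
    nlinarith

/-- The potential `φ^{2p}` of the soliton is close to the characteristic function of the core. -/
theorem soliton_potential_bound (p : ℕ) (hp : 1 ≤ p) {Up Um : Finset ℤ} (hdisj : Disjoint Up Um)
    {a b : ℤ} (hab : a ≤ b) (hU : ∀ n, n ∈ Up ∪ Um ↔ a ≤ n ∧ n ≤ b) (C : ℝ) (hC : 0 < C) :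
    ∃ ε₁ : ℝ, 0 < ε₁ ∧ ∃ K : ℝ, 0 < K ∧ ∀ ε, 0 < ε → ε < ε₁ → ∀ φ : RealSeq,
      IsStationary p ε φ → ‖φ - limitConfig Up Um‖ ≤ C * ε →
      (∀ n, siteDist a b n = 0 → |φ n ^ (2 * p) - 1| ≤ K * ε) ∧
      (∀ n, siteDist a b n ≠ 0 → |φ n ^ (2 * p)| ≤ K * ε ^ 2 * (1 / 2) ^ siteDist a b n) := by
  refine ⟨min (1 / 16) (1 / (2 * C)), by positivity, 2 * p * 2 ^ (2 * p) * C + 512, by positivity,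
    fun ε hε hε1 φ hφ hn => ?_⟩
  have hε16 : ε ≤ 1 / 16 := hε1.le.trans (min_le_left _ _)
  have hCε : C * ε ≤ 1 / 2 := by
    have := hε1.le.trans (min_le_right _ _)
    rw [le_div_iff₀ (by positivity)] at this
    linarith
  have hpt : ∀ n, |φ n - limitConfig Up Um n| ≤ C * ε := fun n =>
    (lp.norm_apply_le_norm (by norm_num) (φ - limitConfig Up Um) n).trans hn
  have hin : ∀ n, siteDist a b n = 0 → limitConfig Up Um n = 1 ∨ limitConfig Up Um n = -1 := by
    intro n hn
    rcases limitConfig_cases hdisj n with h | h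
    · exact h.2
    · exact absurd ((hU n).2 (siteDist_eq_zero.1 hn)) h.1
  have hout : ∀ n, siteDist a b n ≠ 0 → limitConfig Up Um n = 0 := by
    intro n hn
    rcases limitConfig_cases hdisj n with h | h
    · exact absurd (siteDist_eq_zero.2 ((hU n).1 h.1)) hn
    · exact h.2
  have hc1 : ∀ n, |limitConfig Up Um n| ≤ 1 := fun n => by
    rcases limitConfig_cases hdisj n with ⟨-, h | h⟩ | ⟨-, h⟩ <;> rw [h] <;> norm_num
  have hsmall : ∀ n, siteDist a b n ≠ 0 → |φ n| ≤ 1 / 2 := fun n hn => by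
    have := hpt n
    rw [hout n hn, sub_zero] at this
    linarith
  have h2 : ∀ n, |φ n| ≤ 2 := fun n => by
    have := abs_sub_abs_le_abs_sub (φ n) (limitConfig Up Um n)
    linarith [hpt n, hc1 n]
  refine ⟨fun n hn => ?_, fun n hn => ?_⟩
  · have e : limitConfig Up Um n ^ (2 * p) = 1 := by
      rcases hin n hn with h | h <;> simp [h, pow_mul]
    rw [← e]
    have h := abs_pow_sub_pow_le (φ n) (limitConfig Up Um n) (2 * p)
    have hm : max |φ n| |limitConfig Up Um n| ≤ 2 := max_le (h2 n) (by linarith [hc1 n])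
    have hm' : max |φ n| |limitConfig Up Um n| ^ (2 * p - 1) ≤ 2 ^ (2 * p) :=
      (pow_le_pow_left₀ (by positivity) hm _).trans
        (pow_le_pow_right₀ (by norm_num) (by omega))
    calc _ ≤ _ := h
      _ ≤ (C * ε) * ((2 * p : ℕ) : ℝ) * 2 ^ (2 * p) := by
          gcongr; exact hpt n
      _ ≤ _ := by push_cast; nlinarith
  · have hd := soliton_decay hp hε hε16 hφ hab h2 hsmall _ n le_rfl
    obtain ⟨k, hk⟩ := Nat.exists_eq_succ_of_ne_zero hn
    have hs := hsmall n hn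
    rw [abs_pow]
    -- One factor ε² is kept for smallness. The remaining powers (64ε²)^k, with 64ε² ≤ 1/4, are
    -- traded for a geometric rate independent of ε.
    calc |φ n| ^ (2 * p) ≤ |φ n| ^ 2 :=
          pow_le_pow_of_le_one (abs_nonneg _) (by linarith) (by omega)
      _ ≤ (2 * (8 * ε) ^ siteDist a b n) ^ 2 := pow_le_pow_left₀ (abs_nonneg _) hd _
      _ = 256 * ε ^ 2 * (64 * ε ^ 2) ^ k := by
          rw [hk, Nat.succ_eq_add_one, mul_pow, ← pow_mul, mul_comm (k + 1) 2, pow_mul, pow_succ]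
          ring
      _ ≤ 256 * ε ^ 2 * (1 / 2) ^ k := by
          gcongr; nlinarith
      _ = 512 * ε ^ 2 * (1 / 2) ^ siteDist a b n := by
          rw [hk, Nat.succ_eq_add_one, pow_succ]; ring
      _ ≤ _ := by
          gcongr
          have : 0 ≤ 2 * (p : ℝ) * 2 ^ (2 * p) * C := by positivity
          linarith

/-! ### Perturbation of a splitting into a nilpotent and an involutive block -/

/-- Complementary idempotents `P`, `Q`, an element `N` of the corner of `P` with square zero, and
an element `J` of the corner of `Q` with square `Q`. -/
structure Splitting {A : Type*} [Ring A] (P Q N J : A) : Prop where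
  add_eq : P + Q = 1
  PP : P * P = P
  PN : P * N = N
  NP : N * P = N
  NN : N * N = 0
  PJ : P * J = 0
  JP : J * P = 0
  JJ : J * J = Q

namespace Splitting

variable {A : Type*} [Ring A] {P Q N J : A} (h : Splitting P Q N J)
include h

theorem Q_eq : Q = 1 - P := by rw [← h.add_eq]; abel
theorem PQ : P * Q = 0 := by rw [h.Q_eq, mul_sub, mul_one, h.PP, sub_self]
theorem QP : Q * P = 0 := by rw [h.Q_eq, sub_mul, one_mul, h.PP, sub_self]
theorem QQ : Q * Q = Q := by nth_rw 1 [h.Q_eq]; rw [sub_mul, one_mul, h.PQ, sub_zero]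
theorem QN : Q * N = 0 := by rw [h.Q_eq, sub_mul, one_mul, h.PN, sub_self]
theorem NQ : N * Q = 0 := by rw [h.Q_eq, mul_sub, mul_one, h.NP, sub_self]
theorem QJ : Q * J = J := by rw [h.Q_eq, sub_mul, one_mul, h.PJ, sub_zero]
theorem JQ : J * Q = J := by rw [h.Q_eq, mul_sub, mul_one, h.JP, sub_zero]

end Splitting

/-- Lets a relation between two factors fire inside a longer product once `simp` has associated
everything to the right. -/
theorem mul_mul_of_mul_eq {A : Type*} [Ring A] {a b c : A} (h : a * b = c) (x : A) :
    a * (b * x) = c * x := by rw [← mul_assoc, h]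

/-- Solution of the Riccati equation for the perturbed invariant subspace. -/
theorem Splitting.exists_riccati {A : Type*} [NormedRing A] [CompleteSpace A] {P Q N J : A}
    (h : Splitting P Q N J) :
    ∃ η : ℝ, 0 < η ∧ ∃ C : ℝ, 0 < C ∧ ∀ F : A, ‖F‖ ≤ η → ∃ H : A, Q * H = H ∧ H * P = H ∧
      ‖H‖ ≤ 1 ∧ ‖H‖ ≤ C * ‖F‖ ∧
      J * H - H * N + Q * (F + F * H - H * F - H * F * H) * P = 0 := by
  set c : ℝ := (‖J‖ + ‖N‖) * (‖Q‖ * ‖P‖) + 1 with hc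
  have hc0 : 0 < c := by positivity
  have hb : ∀ X : A, ‖J * (Q * X * P) + Q * X * P * N‖ ≤ c * ‖X‖ := fun X => by
    have h1 : ‖Q * X * P‖ ≤ ‖Q‖ * ‖P‖ * ‖X‖ := by
      calc ‖Q * X * P‖ ≤ ‖Q‖ * ‖X‖ * ‖P‖ := norm_mul₃_le
        _ = _ := by ring
    calc _ ≤ ‖J * (Q * X * P)‖ + ‖Q * X * P * N‖ := norm_add_le _ _
      _ ≤ ‖J‖ * ‖Q * X * P‖ + ‖Q * X * P‖ * ‖N‖ := add_le_add (norm_mul_le _ _) (norm_mul_le _ _)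
      _ = (‖J‖ + ‖N‖) * ‖Q * X * P‖ := by ring
      _ ≤ (‖J‖ + ‖N‖) * (‖Q‖ * ‖P‖ * ‖X‖) := by gcongr
      _ ≤ c * ‖X‖ := by rw [hc]; nlinarith [norm_nonneg X]
  -- On the unit ball R has Lipschitz constant 4‖F‖, so c‖F‖ ≤ 1/8 gives Ψ the constant 1/2. Then
  -- ‖H‖ ≤ ‖H‖/2 + c‖F‖, hence the constant 2c.
  refine ⟨1 / (8 * c), by positivity, 2 * c, by positivity, fun F hF => ?_⟩
  have hcF : c * ‖F‖ ≤ 1 / 8 := by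
    rw [le_div_iff₀ (by positivity)] at hF; linarith
  set R : A → A := fun H => F + F * H - H * F - H * F * H with hR
  -- The Sylvester map H ↦ JH - HN from the P corner to the Q corner has inverse X ↦ JX + XN,
  -- because J² = Q, N² = 0 and the mixed terms JXN cancel. The Riccati equation is thus a fixed
  -- point equation for Ψ.
  set Ψ : A → A := fun H => -(J * (Q * R H * P) + Q * R H * P * N) with hΨ
  have hlip : ∀ H H' : A, ‖H‖ ≤ 1 → ‖H'‖ ≤ 1 → ‖Ψ H - Ψ H'‖ ≤ 1 / 2 * ‖H - H'‖ := by
    intro H H' hH hH'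
    have e : Ψ H - Ψ H' = -(J * (Q * (R H - R H') * P) + Q * (R H - R H') * P * N) := by
      simp only [hΨ]; noncomm_ring
    have e2 : R H - R H' = F * (H - H') - (H - H') * F - (H - H') * F * H - H' * F * (H - H') := by
      simp only [hR]; noncomm_ring
    have e3 : ‖R H - R H'‖ ≤ 4 * ‖F‖ * ‖H - H'‖ := by
      rw [e2]
      set K := H - H'
      have a1 : ‖F * K‖ ≤ ‖F‖ * ‖K‖ := norm_mul_le _ _
      have a2 : ‖K * F‖ ≤ ‖F‖ * ‖K‖ := (norm_mul_le _ _).trans_eq (mul_comm _ _)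
      have a3 : ‖K * F * H‖ ≤ ‖F‖ * ‖K‖ :=
        (norm_mul_le _ _).trans ((mul_le_of_le_one_right (norm_nonneg _) hH).trans a2)
      have a4 : ‖H' * F * K‖ ≤ ‖F‖ * ‖K‖ := by
        rw [mul_assoc]
        exact (norm_mul_le _ _).trans ((mul_le_of_le_one_left (norm_nonneg _) hH').trans a1)
      have b1 := norm_sub_le (F * K) (K * F)
      have b2 := norm_sub_le (F * K - K * F) (K * F * H)
      have b3 := norm_sub_le (F * K - K * F - K * F * H) (H' * F * K)
      linarith
    rw [e, norm_neg]
    refine (hb _).trans ?_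
    nlinarith [mul_le_mul_of_nonneg_left e3 hc0.le, norm_nonneg (H - H')]
  have hzero : ‖Ψ 0‖ ≤ c * ‖F‖ := by
    have : Ψ 0 = -(J * (Q * F * P) + Q * F * P * N) := by simp [hΨ, hR]
    rw [this, norm_neg]; exact hb F
  have hmaps : MapsTo Ψ (Metric.closedBall 0 1) (Metric.closedBall 0 1) := by
    intro H hH
    rw [mem_closedBall_zero_iff] at *
    have h1 := hlip H 0 hH (by simp)
    have h2 := norm_sub_norm_le (Ψ H) (Ψ 0)
    rw [sub_zero] at h1
    linarith
  have hcontr : ContractingWith (1 / 2) (hmaps.restrict Ψ _ _) := by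
    refine ⟨by rw [← NNReal.coe_lt_coe]; norm_num, LipschitzWith.of_dist_le_mul fun H H' => ?_⟩
    have := hlip H H' (mem_closedBall_zero_iff.1 H.2) (mem_closedBall_zero_iff.1 H'.2)
    rw [Subtype.dist_eq, Subtype.dist_eq, dist_eq_norm, dist_eq_norm]
    simpa using this
  obtain ⟨H, hH, hfix, -⟩ := hcontr.exists_fixedPoint' Metric.isClosed_closedBall.isComplete hmaps
    (x := 0) (by simp) (edist_ne_top _ _)
  rw [mem_closedBall_zero_iff] at hH
  have hfix' : H = -(J * (Q * R H * P) + Q * R H * P * N) := hfix.symm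
  refine ⟨H, ?_, ?_, hH, ?_, ?_⟩
  · rw [hfix', mul_neg, mul_add, ← mul_assoc Q J, h.QJ]
    simp only [← mul_assoc, h.QQ]
  · rw [hfix', neg_mul, add_mul]
    simp only [mul_assoc, h.PP, h.NP]
  · have h1 := hlip H 0 hH (by simp)
    have h2 := norm_sub_norm_le (Ψ H) (Ψ 0)
    rw [sub_zero] at h1
    have h3 : ‖Ψ H‖ = ‖H‖ := by rw [show Ψ H = H from hfix]
    linarith
  · change J * H - H * N + Q * R H * P = 0
    set X := R H
    rw [hfix']
    have s1 := mul_mul_of_mul_eq h.JJ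
    have s2 := mul_mul_of_mul_eq h.QQ
    simp only [mul_neg, neg_mul, mul_add, add_mul, mul_assoc, s1, s2, h.NN, mul_zero]
    abel

/-- A small perturbation of `N + J` is similar to a block triangular operator. -/
theorem Splitting.exists_block_triangular {A : Type*} [NormedRing A] [CompleteSpace A]
    {P Q N J : A} (h : Splitting P Q N J) :
    ∃ η : ℝ, 0 < η ∧ ∃ C : ℝ, 0 < C ∧ ∀ F : A, ‖F‖ ≤ η → ∃ S S' M D B : A,
      S * S' = 1 ∧ S' * S = 1 ∧ S' * (N + J + F) * S = M + B + D ∧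
      P * M = M ∧ M * P = M ∧ Q * D = D ∧ D * Q = D ∧ P * B = B ∧ B * Q = B ∧
      ‖M - N‖ ≤ C * ‖F‖ ∧ ‖D - J‖ ≤ C * ‖F‖ := by
  obtain ⟨η, hη, C, -, H⟩ := h.exists_riccati
  refine ⟨η, hη, ‖P‖ * (‖P‖ + 1) + (‖Q‖ + 1) * ‖Q‖ + 1, by positivity, fun F hF => ?_⟩
  obtain ⟨H, hQH, hHP, hH1, -, hric⟩ := H F hF
  have hPH : P * H = 0 := by rw [← hQH, ← mul_assoc, h.PQ, zero_mul]
  have hHQ : H * Q = 0 := by rw [← hHP, mul_assoc, h.PQ, mul_zero]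
  -- H maps the range of P into that of Q and kills the latter, so 1 + H has inverse 1 - H.
  have hHH : H * H = 0 := by
    calc H * H = H * P * H := by rw [hHP]
      _ = 0 := by rw [mul_assoc, hPH, mul_zero]
  have hNH : N * H = 0 := by
    rw [← h.NP, mul_assoc, hPH, mul_zero]
  have hHJ : H * J = 0 := by
    rw [← h.QJ, ← mul_assoc, hHQ, zero_mul]
  set L := N + J + F with hL
  have r1 := mul_mul_of_mul_eq h.QN
  have r2 := mul_mul_of_mul_eq h.QJ
  have r3 := mul_mul_of_mul_eq hHJ
  have r4 := mul_mul_of_mul_eq hQH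
  have r5 := mul_mul_of_mul_eq h.PN
  have r6 := mul_mul_of_mul_eq h.PJ
  have r7 := mul_mul_of_mul_eq hPH
  have r8 := mul_mul_of_mul_eq h.PP
  have r9 := mul_mul_of_mul_eq h.QQ
  -- The lower left block after conjugation by 1 + H is exactly the left side of the Riccati
  -- equation.
  have hQLP : Q * ((1 - H) * L * (1 + H)) * P = 0 := by
    rw [← hric, hL]
    simp only [mul_add, add_mul, mul_sub, sub_mul, mul_assoc, mul_one, one_mul, r2, r4,
      h.QN, h.NP, h.JP, hHP, hNH, hHJ, mul_zero, zero_mul]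
    abel
  refine ⟨1 + H, 1 - H, P * ((1 - H) * L * (1 + H)) * P, Q * ((1 - H) * L * (1 + H)) * Q,
    P * ((1 - H) * L * (1 + H)) * Q, ?_, ?_, ?_, ?_, ?_, ?_, ?_, ?_, ?_, ?_, ?_⟩
  · simp only [add_mul, mul_sub, mul_one, one_mul, hHH]; abel
  · simp only [mul_add, sub_mul, mul_one, one_mul, hHH]; abel
  · set X := (1 - H) * L * (1 + H)
    calc X = (P + Q) * X * (P + Q) := by rw [h.add_eq, one_mul, mul_one]
      _ = P * X * P + P * X * Q + Q * X * Q + Q * X * P := by noncomm_ring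
      _ = _ := by rw [hQLP, add_zero]
  · simp only [← mul_assoc, h.PP]
  · simp only [mul_assoc, h.PP]
  · simp only [← mul_assoc, h.QQ]
  · simp only [mul_assoc, h.QQ]
  · simp only [← mul_assoc, h.PP]
  · simp only [mul_assoc, h.QQ]
  · have e : P * ((1 - H) * L * (1 + H)) * P - N = P * F * (P + H) := by
      rw [hL]
      simp only [mul_add, add_mul, mul_sub, sub_mul, mul_assoc, mul_one, one_mul, r6, r7,
        h.PN, h.NP, h.JP, hHP, hNH, mul_zero, zero_mul]
      abel
    rw [e]
    calc _ ≤ ‖P‖ * ‖F‖ * ‖P + H‖ := norm_mul₃_le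
      _ ≤ ‖P‖ * ‖F‖ * (‖P‖ + 1) := by
          gcongr; exact (norm_add_le _ _).trans (by linarith)
      _ ≤ _ := by nlinarith [norm_nonneg F, mul_nonneg (mul_nonneg (by positivity : 0 ≤ ‖Q‖ + 1) (norm_nonneg Q)) (norm_nonneg F)]
  · have e : Q * ((1 - H) * L * (1 + H)) * Q - J = (Q - H) * F * Q := by
      rw [hL]
      simp only [mul_add, add_mul, mul_sub, sub_mul, mul_assoc, mul_one, one_mul, r1, r2, r4,
        h.NQ, h.JQ, h.QJ, hHQ, hHJ, mul_zero, zero_mul]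
      abel
    rw [e]
    calc _ ≤ ‖Q - H‖ * ‖F‖ * ‖Q‖ := norm_mul₃_le
      _ ≤ (‖Q‖ + 1) * ‖F‖ * ‖Q‖ := by
          gcongr; exact (norm_sub_le _ _).trans (by linarith)
      _ ≤ _ := by nlinarith [norm_nonneg F, mul_nonneg (mul_nonneg (norm_nonneg P) (by positivity : 0 ≤ ‖P‖ + 1)) (norm_nonneg F)]

/-- Openness of the group of units in quantitative form: elements closer to X than 1/‖X⁻¹‖ are
invertible. -/
theorem isUnit_of_mul_eq_one_of_norm_sub_lt {A : Type*} [NormedRing A] [CompleteSpace A]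
    {X Y X' : A} {c : ℝ} (h1 : X * Y = 1) (h2 : Y * X = 1) (hY : ‖Y‖ ≤ c)
    (hX : ‖X' - X‖ < c⁻¹) : IsUnit X' := by
  nontriviality A
  have hY0 : 0 < ‖Y‖ := by
    rw [norm_pos_iff]; rintro rfl; simp at h1
  exact (Units.ofNearby ⟨X, Y, h1, h2⟩ X' (hX.trans_le (inv_anti₀ hY0 hY))).isUnit

/-- Consequences of the block triangular form, with unperturbed spectrum in the disk of radius `δ`
for the corner of `P` and outside of it for the corner of `Q`. -/
theorem Splitting.exists_block_triangular_isUnit {A : Type*} [NormedRing A] [NormedAlgebra ℂ A]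
    [CompleteSpace A] {P Q N J : A} (h : Splitting P Q N J) {δ : ℝ} (hδ : 0 < δ) (hδ1 : δ < 1) :
    ∃ η : ℝ, 0 < η ∧ ∀ F : A, ‖F‖ ≤ η → ∃ S S' M D B : A,
      S * S' = 1 ∧ S' * S = 1 ∧ S' * (N + J + F) * S = M + B + D ∧
      P * M = M ∧ M * P = M ∧ Q * D = D ∧ D * Q = D ∧ P * B = B ∧ B * Q = B ∧
      (∀ z : ℂ, δ ≤ ‖z‖ → IsUnit (M - z • P + Q)) ∧
      (∀ z : ℂ, ‖z‖ < δ → IsUnit (P + (D - z • Q))) := by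
  obtain ⟨η, hη, C, hC, H⟩ := h.exists_block_triangular
  set c₁ : ℝ := ‖Q‖ + δ⁻¹ * ‖P‖ + (δ⁻¹) ^ 2 * ‖N‖ + 1
  set c₂ : ℝ := ‖P‖ + (1 - δ ^ 2)⁻¹ * (‖J‖ + ‖Q‖) + 1
  have hδ2 : 0 < 1 - δ ^ 2 := by nlinarith
  have hc₁ : 0 < c₁ := by positivity
  have hc₂ : 0 < c₂ := by positivity
  refine ⟨min η (min (c₁⁻¹ / (2 * C)) (c₂⁻¹ / (2 * C))), by positivity, fun F hF => ?_⟩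
  obtain ⟨S, S', M, D, B, h1, h2, h3, h4, h5, h6, h7, h8, h9, h10, h11⟩ :=
    H F (hF.trans (min_le_left _ _))
  have hF1 : C * ‖F‖ < c₁⁻¹ := by
    have := hF.trans ((min_le_right _ _).trans (min_le_left _ _))
    rw [le_div_iff₀ (by positivity)] at this
    have : 0 < c₁⁻¹ := by positivity
    linarith
  have hF2 : C * ‖F‖ < c₂⁻¹ := by
    have := hF.trans ((min_le_right _ _).trans (min_le_right _ _))
    rw [le_div_iff₀ (by positivity)] at this
    have : 0 < c₂⁻¹ := by positivity
    linarith
  refine ⟨S, S', M, D, B, h1, h2, h3, h4, h5, h6, h7, h8, h9, fun z hz => ?_, fun z hz => ?_⟩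
  · have hz0 : z ≠ 0 := by rintro rfl; simp at hz; linarith
    -- Since N² = 0, the Neumann series of (N - z)⁻¹ on the corner stops after two terms. The bound
    -- c₁ is uniform over the unbounded set |z| ≥ δ.
    refine isUnit_of_mul_eq_one_of_norm_sub_lt (X := N - z • P + Q)
      (Y := Q - z⁻¹ • P - (z⁻¹) ^ 2 • N) (c := c₁) ?_ ?_ ?_ ?_
    · simp only [add_mul, mul_sub, sub_mul, smul_mul_assoc, mul_smul_comm, h.NQ, h.NP,
        h.NN, h.PQ, h.PP, h.PN, h.QQ, h.QP, h.QN, smul_zero]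
      rw [← h.add_eq]
      match_scalars <;> field_simp
      ring
    · simp only [mul_add, mul_sub, sub_mul, smul_mul_assoc, mul_smul_comm, h.NQ, h.NP,
        h.NN, h.PQ, h.PP, h.PN, h.QQ, h.QP, h.QN, smul_zero]
      rw [← h.add_eq]
      match_scalars <;> field_simp
      ring
    · have i1 : ‖z⁻¹‖ ≤ δ⁻¹ := by rw [norm_inv]; exact inv_anti₀ hδ hz
      calc ‖Q - z⁻¹ • P - (z⁻¹) ^ 2 • N‖ ≤ ‖Q‖ + ‖z⁻¹ • P‖ + ‖(z⁻¹) ^ 2 • N‖ :=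
            (norm_sub_le _ _).trans (add_le_add_left (norm_sub_le _ _) _)
        _ ≤ ‖Q‖ + δ⁻¹ * ‖P‖ + (δ⁻¹) ^ 2 * ‖N‖ := by
            rw [norm_smul, norm_smul, norm_pow]; gcongr
        _ ≤ c₁ := by simp [c₁]
    · have : M - z • P + Q - (N - z • P + Q) = M - N := by abel
      rw [this]; exact h10.trans_lt hF1
  · have hz2 : 1 - δ ^ 2 ≤ ‖1 - z ^ 2‖ := by
      have := norm_sub_norm_le (1 : ℂ) (z ^ 2)
      rw [norm_one, norm_pow] at this
      nlinarith [norm_nonneg z]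
    have hz0 : 1 - z ^ 2 ≠ 0 := by
      intro h0; rw [h0, norm_zero] at hz2; linarith
    -- From J² = Q, (J - z)(J + z) = 1 - z² on the corner, and |1 - z²| ≥ 1 - δ² in the disk.
    refine isUnit_of_mul_eq_one_of_norm_sub_lt (X := P + (J - z • Q))
      (Y := P + (1 - z ^ 2)⁻¹ • (J + z • Q)) (c := c₂) ?_ ?_ ?_ ?_
    · have e : (J - z • Q) * (J + z • Q) = (1 - z ^ 2) • Q := by
        simp only [mul_add, sub_mul, smul_mul_assoc, mul_smul_comm, h.JJ, h.JQ, h.QJ, h.QQ]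
        module
      rw [mul_add, add_mul, add_mul, mul_smul_comm, mul_smul_comm, e, smul_smul,
        inv_mul_cancel₀ hz0]
      simp only [mul_add, sub_mul, smul_mul_assoc, mul_smul_comm, h.PP, h.PJ, h.PQ, h.JP, h.QP,
        smul_zero, add_zero, zero_add, sub_zero, one_smul, h.add_eq]
    · have e : (J + z • Q) * (J - z • Q) = (1 - z ^ 2) • Q := by
        simp only [mul_sub, add_mul, smul_mul_assoc, mul_smul_comm, h.JJ, h.JQ, h.QJ, h.QQ]
        module
      rw [mul_add, add_mul, add_mul, smul_mul_assoc, smul_mul_assoc, e, smul_smul,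
        inv_mul_cancel₀ hz0]
      simp only [mul_sub, add_mul, smul_mul_assoc, mul_smul_comm, h.PP, h.PJ, h.PQ, h.JP, h.QP,
        smul_zero, add_zero, zero_add, sub_zero, one_smul, h.add_eq]
    · calc ‖P + (1 - z ^ 2)⁻¹ • (J + z • Q)‖ ≤ ‖P‖ + ‖1 - z ^ 2‖⁻¹ * ‖J + z • Q‖ := by
            refine (norm_add_le _ _).trans ?_
            rw [norm_smul, norm_inv]
        _ ≤ ‖P‖ + (1 - δ ^ 2)⁻¹ * (‖J‖ + ‖Q‖) := by
            gcongr
            refine (norm_add_le _ _).trans (add_le_add_right ?_ _)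
            rw [norm_smul]
            exact mul_le_of_le_one_left (norm_nonneg _) (by linarith)
        _ ≤ c₂ := by simp [c₂]
    · have : P + (D - z • Q) - (P + (J - z • Q)) = D - J := by abel
      rw [this]; exact h11.trans_lt hF2

/-! ### Poles of the resolvent of a block triangular operator -/

section Resolvent

variable {A : Type*} [Ring A] [Algebra ℂ A]

/-- The polynomial quotient `(χ(M) - χ(z)) / (M - z)`. -/
def polyQuotient (χ : Polynomial ℂ) (M : A) (z : ℂ) : A :=
  ∑ i ∈ χ.support, χ.coeff i • ∑ j ∈ Finset.range i, M ^ j * (z • (1 : A)) ^ (i - 1 - j)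

/-- Each monomial telescopes as a geometric sum, since M commutes with scalars. When χ annihilates
M, this makes the inverse of M - z an explicit rational function of z. -/
theorem sub_mul_polyQuotient (χ : Polynomial ℂ) (M : A) (z : ℂ) :
    (M - z • 1) * polyQuotient χ M z = Polynomial.aeval M χ - χ.eval z • 1 := by
  have hc : Commute M (z • (1 : A)) := (Commute.one_right M).smul_right z
  rw [polyQuotient, Finset.mul_sum, Polynomial.aeval_eq_sum_range' (Nat.lt_succ_self _),
    Polynomial.eval_eq_sum, Polynomial.sum, Finset.sum_smul]
  have : ∑ i ∈ Finset.range χ.natDegree.succ, χ.coeff i • M ^ i =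
      ∑ i ∈ χ.support, χ.coeff i • M ^ i := by
    refine (Finset.sum_subset (fun i hi => ?_) (fun i _ hi => ?_)).symm
    · exact Finset.mem_range.2 (Nat.lt_succ_of_le (Polynomial.le_natDegree_of_mem_supp i hi))
    · rw [Polynomial.notMem_support_iff.1 hi, zero_smul]
  rw [this, ← Finset.sum_sub_distrib]
  refine Finset.sum_congr rfl fun i _ => ?_
  rw [mul_smul_comm, hc.mul_geom_sum₂, smul_sub, smul_pow, one_pow, smul_smul]

theorem commute_polyQuotient (χ : Polynomial ℂ) {M X : A} (h : Commute M X) (z : ℂ) :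
    Commute (polyQuotient χ M z) X := by
  refine Commute.sum_left _ _ _ fun i _ => Commute.smul_left ?_ _
  refine Commute.sum_left _ _ _ fun j _ => (h.pow_left j).mul_left ?_
  exact ((Commute.one_left X).smul_left z).pow_left _

/-- The inverse of `M - z` in the corner of `P`, extended by the identity. -/
theorem corner_inverse {P Q M : A} (hPQ : P + Q = 1) (hP : P * P = P) (hPM : P * M = M)
    (hMP : M * P = M) {χ : Polynomial ℂ} (hχ : Polynomial.aeval M χ * P = 0) {z : ℂ}
    (hz : χ.eval z ≠ 0) :
    (M - z • P + Q) * ((χ.eval z)⁻¹ • (χ.eval z • Q - P * polyQuotient χ M z)) = 1 ∧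
    ((χ.eval z)⁻¹ • (χ.eval z • Q - P * polyQuotient χ M z)) * (M - z • P + Q) = 1 := by
  have hQ : Q = 1 - P := by rw [← hPQ]; abel
  have hPQ0 : P * Q = 0 := by rw [hQ, mul_sub, mul_one, hP, sub_self]
  have hQP0 : Q * P = 0 := by rw [hQ, sub_mul, one_mul, hP, sub_self]
  have hQQ : Q * Q = Q := by nth_rw 1 [hQ]; rw [sub_mul, one_mul, hPQ0, sub_zero]
  have hQM : Q * M = 0 := by rw [hQ, sub_mul, one_mul, hPM, sub_self]
  have hMQ : M * Q = 0 := by rw [hQ, mul_sub, mul_one, hMP, sub_self]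
  have hcP : Commute M P := hMP.trans hPM.symm
  have hcQ : Commute M Q := hMQ.trans hQM.symm
  have c1 := commute_polyQuotient χ hcP z
  have c2 := commute_polyQuotient χ hcQ z
  have c3 := commute_polyQuotient χ (Commute.refl M) z
  set q := polyQuotient χ M z
  -- As χ(M) vanishes on the corner, the quotient identity leaves only -χ(z), so -q/χ(z) inverts M -
  -- z there.
  have key : (M - z • P) * (P * q) = -(χ.eval z • P) := by
    have h1 := sub_mul_polyQuotient χ M z
    calc (M - z • P) * (P * q) = ((M - z • 1) * q) * P := by
          rw [← mul_assoc, mul_assoc (M - z • 1) q P, c1.eq, ← mul_assoc]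
          simp only [sub_mul, smul_mul_assoc, hP, one_mul]
      _ = _ := by rw [h1, sub_mul, hχ, zero_sub, smul_mul_assoc, one_mul]
  have hcomm : Commute (M - z • P + Q) (χ.eval z • Q - P * q) := by
    have d1 : Commute (M - z • P + Q) Q :=
      (hcQ.sub_left ((show Commute P Q from hPQ0.trans hQP0.symm).smul_left z)).add_left
        (Commute.refl Q)
    have d2 : Commute (M - z • P + Q) P :=
      (hcP.sub_left ((Commute.refl P).smul_left z)).add_left
        (show Commute Q P from hQP0.trans hPQ0.symm)
    have d3 : Commute (M - z • P + Q) q :=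
      (c3.symm.sub_left (c1.symm.smul_left z)).add_left c2.symm
    exact (d1.smul_right _).sub_right (d2.mul_right d3)
  have main : (M - z • P + Q) * (χ.eval z • Q - P * q) = χ.eval z • 1 := by
    rw [mul_sub, add_mul _ _ (P * q), key, ← mul_assoc Q, hQP0, zero_mul, mul_smul_comm, add_mul,
      sub_mul, hMQ, smul_mul_assoc, hPQ0, hQQ, ← hPQ]
    module
  constructor
  · rw [mul_smul_comm, main, smul_smul, inv_mul_cancel₀ hz, one_smul]
  · rw [smul_mul_assoc, ← hcomm.eq, main, smul_smul, inv_mul_cancel₀ hz, one_smul]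

end Resolvent

theorem ringInverse_eq_of_mul_eq_one {A : Type*} [Ring A] {X Y : A} (h1 : X * Y = 1)
    (h2 : Y * X = 1) : Ring.inverse X = Y :=
  Ring.inverse_unit (⟨X, Y, h1, h2⟩ : Aˣ)

theorem analyticAt_polyQuotient {A : Type*} [NormedRing A] [NormedAlgebra ℂ A]
    (χ : Polynomial ℂ) (M : A) (z : ℂ) : AnalyticAt ℂ (polyQuotient χ M) z := by
  unfold polyQuotient
  fun_prop

/-- A meromorphic resolvent has a genuine pole at each point of the spectrum. -/
theorem meromorphicOrderAt_resolvent_neg {A : Type*} [NormedRing A] [NormedAlgebra ℂ A]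
    [CompleteSpace A] {L : A} {z : ℂ} (hm : MeromorphicAt (fun w => Ring.inverse (L - w • 1)) z)
    (hz : ¬ IsUnit (L - z • 1)) (hev : ∀ᶠ w in 𝓝[≠] z, IsUnit (L - w • 1)) :
    meromorphicOrderAt (fun w => Ring.inverse (L - w • 1)) z < 0 := by
  -- Without a pole the resolvent has a limit at z, and passing to the limit in both inverse
  -- identities would invert L - z.
  by_contra hcon
  obtain ⟨c, hc⟩ := tendsto_nhds_of_meromorphicOrderAt_nonneg hm (not_lt.1 hcon)
  have hL : Tendsto (fun w : ℂ => L - w • (1 : A)) (𝓝[≠] z) (𝓝 (L - z • 1)) :=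
    ((by fun_prop : Continuous fun w : ℂ => L - w • (1 : A)).tendsto z).mono_left
      nhdsWithin_le_nhds
  have h1 : (L - z • 1) * c = 1 := by
    refine tendsto_nhds_unique (hL.mul hc) (tendsto_const_nhds.congr' ?_)
    filter_upwards [hev] with w hw
    exact (Ring.mul_inverse_cancel _ hw).symm
  have h2 : c * (L - z • 1) = 1 := by
    refine tendsto_nhds_unique (hc.mul hL) (tendsto_const_nhds.congr' ?_)
    filter_upwards [hev] with w hw
    exact (Ring.inverse_mul_cancel _ hw).symm
  exact hz ⟨⟨_, c, h1, h2⟩, rfl⟩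

section BlockTriangular

variable {E : Type*} [NormedAddCommGroup E] [NormedSpace ℂ E]

/-- The restriction of `M` to the range of `P`. -/
def cornerEnd (P M : E →L[ℂ] E) (hPM : P * M = M) :
    Module.End ℂ (LinearMap.range (P : E →ₗ[ℂ] E)) :=
  LinearMap.restrict (M : E →ₗ[ℂ] E) fun x _ => ⟨M x, congrArg (fun T : E →L[ℂ] E => T x) hPM⟩

theorem mem_range_iff_of_idempotent {P : E →L[ℂ] E} (hP : P * P = P) {x : E} :
    x ∈ LinearMap.range (P : E →ₗ[ℂ] E) ↔ P x = x := by
  constructor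
  · rintro ⟨y, rfl⟩
    exact congrArg (fun T : E →L[ℂ] E => T y) hP
  · exact fun h => ⟨x, h⟩

/-- Cayley–Hamilton on the finite-dimensional range of P, transported to M acting on the whole
space. -/
theorem aeval_charpoly_cornerEnd {P M : E →L[ℂ] E} (hPM : P * M = M)
    [FiniteDimensional ℂ (LinearMap.range (P : E →ₗ[ℂ] E))] :
    Polynomial.aeval M (cornerEnd P M hPM).charpoly * P = 0 := by
  set T := cornerEnd P M hPM
  have hpow : ∀ (i : ℕ) (y : LinearMap.range (P : E →ₗ[ℂ] E)),
      (M ^ i) (y : E) = ((T ^ i) y : E) := by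
    intro i
    induction i with
    | zero => intro y; rfl
    | succ i ih =>
      intro y
      rw [pow_succ, pow_succ]
      exact ih (T y)
  have hpoly : ∀ (f : Polynomial ℂ) (y : LinearMap.range (P : E →ₗ[ℂ] E)),
      (Polynomial.aeval M f) (y : E) = ((Polynomial.aeval T f) y : E) := by
    intro f y
    rw [Polynomial.aeval_eq_sum_range, Polynomial.aeval_eq_sum_range]
    simp [hpow]
  ext x
  have := hpoly T.charpoly ⟨P x, x, rfl⟩
  rw [LinearMap.aeval_self_charpoly] at this
  exact this

/-- A root of the characteristic polynomial produces an eigenvector in the range of P, which the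
operator kills; conversely `corner_inverse` is an explicit inverse away from the roots. -/
theorem isUnit_corner_iff [CompleteSpace E] {P Q M : E →L[ℂ] E} (hPQ : P + Q = 1) (hP : P * P = P)
    (hPM : P * M = M) (hMP : M * P = M)
    [FiniteDimensional ℂ (LinearMap.range (P : E →ₗ[ℂ] E))] (z : ℂ) :
    IsUnit (M - z • P + Q) ↔ (cornerEnd P M hPM).charpoly.eval z ≠ 0 := by
  constructor
  · intro hu h0
    have hev := (Module.End.hasEigenvalue_iff_isRoot_charpoly (cornerEnd P M hPM) z).2 h0
    obtain ⟨y, hy⟩ := hev.exists_hasEigenvector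
    have hy1 : M (y : E) = z • (y : E) := congrArg Subtype.val hy.apply_eq_smul
    have hy2 : P (y : E) = y := (mem_range_iff_of_idempotent hP).1 y.2
    have hy3 : Q (y : E) = 0 := by
      have : (P + Q) (y : E) = y := by rw [hPQ]; rfl
      rw [_root_.add_apply, hy2] at this
      simpa using this
    have hinj := (ContinuousLinearMap.isUnit_iff_bijective.1 hu).1
    refine hy.2 (Subtype.ext (hinj ?_))
    simp [hy1, hy2, hy3]
  · intro h
    obtain ⟨h1, h2⟩ := corner_inverse hPQ hP hPM hMP (aeval_charpoly_cornerEnd hPM) h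
    exact ⟨⟨_, _, h1, h2⟩, rfl⟩

/-- Hypotheses: `L` is similar to the block triangular operator `M + B + D`. -/
structure BlockTriangular (P Q S S' M D B L : E →L[ℂ] E) : Prop where
  add_eq : P + Q = 1
  PP : P * P = P
  SS' : S * S' = 1
  S'S : S' * S = 1
  eq : S' * L * S = M + B + D
  PM : P * M = M
  MP : M * P = M
  QD : Q * D = D
  DQ : D * Q = D
  PB : P * B = B
  BQ : B * Q = B

namespace BlockTriangular

variable {P Q S S' M D B L : E →L[ℂ] E} (h : BlockTriangular P Q S S' M D B L)
include h

theorem Q_eq : Q = 1 - P := by rw [← h.add_eq]; abel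
theorem PQ : P * Q = 0 := by rw [h.Q_eq, mul_sub, mul_one, h.PP, sub_self]
theorem QP : Q * P = 0 := by rw [h.Q_eq, sub_mul, one_mul, h.PP, sub_self]
theorem QQ : Q * Q = Q := by nth_rw 1 [h.Q_eq]; rw [sub_mul, one_mul, h.PQ, sub_zero]
theorem QM : Q * M = 0 := by rw [h.Q_eq, sub_mul, one_mul, h.PM, sub_self]
theorem QB : Q * B = 0 := by rw [h.Q_eq, sub_mul, one_mul, h.PB, sub_self]
theorem BP : B * P = 0 := by rw [← h.BQ, mul_assoc, h.QP, mul_zero]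
theorem DP : D * P = 0 := by rw [← h.DQ, mul_assoc, h.QP, mul_zero]
theorem BB : B * B = 0 := by
  calc B * B = B * Q * B := by rw [h.BQ]
    _ = 0 := by rw [mul_assoc, h.QB, mul_zero]
theorem one_add_mul : (1 + B) * (1 - B) = 1 := by
  rw [mul_sub, mul_one, add_mul, h.BB, one_mul]; abel
theorem one_sub_mul : (1 - B) * (1 + B) = 1 := by
  rw [mul_add, mul_one, sub_mul, h.BB, one_mul]; abel
theorem BM : B * M = 0 := by
  rw [← h.PM, ← mul_assoc, h.BP, zero_mul]

/-- Block elimination: the triangular matrix with rows (M - z, B) and (0, D - z) is diag(1, D - z) ·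
(1 + B) · diag(M - z, 1). Where D - z is invertible, only the finite block can obstruct the
inversion of L - z. -/
theorem factor (z : ℂ) :
    L - z • 1 = S * ((P + (D - z • Q)) * (1 + B) * (M - z • P + Q)) * S' := by
  have e1 : (P + (D - z • Q)) * (1 + B) * (M - z • P + Q) = M + B + D - z • 1 := by
    have hDB : D * B = 0 := by rw [← h.PB, ← mul_assoc, h.DP, zero_mul]
    have hDM : D * M = 0 := by rw [← h.PM, ← mul_assoc, h.DP, zero_mul]
    have e0 : (P + (D - z • Q)) * (1 + B) = P + B + (D - z • Q) := by
      simp only [mul_add, add_mul, sub_mul, smul_mul_assoc, mul_one, h.PB, hDB, h.QB, smul_zero]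
      abel
    rw [e0, ← h.add_eq]
    simp only [mul_add, add_mul, sub_mul, mul_sub, smul_mul_assoc, mul_smul_comm, h.PM, h.PP,
      h.PQ, h.BM, h.BP, h.BQ, hDM, h.DP, h.DQ, h.QM, h.QP, h.QQ, smul_zero]
    module
  rw [e1, ← h.eq, mul_sub, sub_mul, mul_smul_comm, smul_mul_assoc, mul_one, h.SS']
  congr 1
  calc L = (S * S') * L * (S * S') := by rw [h.SS', one_mul, mul_one]
    _ = _ := by simp only [mul_assoc]

theorem isUnit_iff {z : ℂ} (hD : IsUnit (P + (D - z • Q))) :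
    IsUnit (L - z • 1) ↔ IsUnit (M - z • P + Q) := by
  have hS : IsUnit S := ⟨⟨S, S', h.SS', h.S'S⟩, rfl⟩
  have hS' : IsUnit S' := ⟨⟨S', S, h.S'S, h.SS'⟩, rfl⟩
  have hB : IsUnit (1 + B) := ⟨⟨1 + B, 1 - B, h.one_add_mul, h.one_sub_mul⟩, rfl⟩
  rw [h.factor z]
  constructor
  · intro hu
    have h1 := (hS'.mul hu).mul hS
    have h2 : S' * (S * ((P + (D - z • Q)) * (1 + B) * (M - z • P + Q)) * S') * S =
        ((P + (D - z • Q)) * (1 + B)) * (M - z • P + Q) := by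
      simp only [← mul_assoc, h.S'S, one_mul]
      rw [mul_assoc, h.S'S, mul_one]
    rw [h2] at h1
    exact (Units.isUnit_units_mul (hD.mul hB).unit _).1 h1
  · intro hu
    exact (hS.mul ((hD.mul hB).mul hu)).mul hS'

variable [FiniteDimensional ℂ (LinearMap.range (P : E →ₗ[ℂ] E))]

/-- Inverting `factor` writes the resolvent as 1/χ(w) times a function analytic near z: the finite
block contributes a polynomial in w, the infinite block the analytic inverse of P + (D - w Q). -/
theorem meromorphicAt_inverse [CompleteSpace E] {z : ℂ} (hD : IsUnit (P + (D - z • Q))) :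
    MeromorphicAt (fun w => Ring.inverse (L - w • 1)) z ∧
      ∀ᶠ w in 𝓝[≠] z, IsUnit (L - w • 1) := by
  set χ := (cornerEnd P M h.PM).charpoly
  have hχ0 : χ ≠ 0 := (LinearMap.charpoly_monic _).ne_zero
  have hroots : ∀ᶠ w in 𝓝[≠] z, χ.eval w ≠ 0 := by
    have hfin : (χ.roots.toFinset : Set ℂ).Finite := Finset.finite_toSet _
    have h1 : ∀ᶠ w in 𝓝[≠] z, w ∉ ((χ.roots.toFinset : Set ℂ) \ {z}) :=
      nhdsWithin_le_nhds ((hfin.subset sdiff_subset).isClosed.isOpen_compl.mem_nhds (by simp))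
    filter_upwards [h1, self_mem_nhdsWithin] with w hw hwz h0
    exact hw ⟨by simpa [hχ0] using h0, hwz⟩
  have hcont : Continuous fun w : ℂ => P + (D - w • Q) := by fun_prop
  have hDev : ∀ᶠ w in 𝓝[≠] z, IsUnit (P + (D - w • Q)) :=
    nhdsWithin_le_nhds ((Units.isOpen.preimage hcont).mem_nhds hD)
  have hform : ∀ᶠ w in 𝓝[≠] z, (χ.eval w)⁻¹ • (S * ((χ.eval w • Q - P * polyQuotient χ M w) *
      ((1 - B) * Ring.inverse (P + (D - w • Q)))) * S') = Ring.inverse (L - w • 1) := by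
    filter_upwards [hroots, hDev] with w hw hDw
    obtain ⟨i1, i2⟩ := corner_inverse h.add_eq h.PP h.PM h.MP (aeval_charpoly_cornerEnd h.PM) hw
    symm
    have j1 := Ring.mul_inverse_cancel _ hDw
    have j2 := Ring.inverse_mul_cancel _ hDw
    rw [h.factor w]
    have e : (χ.eval w)⁻¹ • (S * ((χ.eval w • Q - P * polyQuotient χ M w) *
        ((1 - B) * Ring.inverse (P + (D - w • Q)))) * S') =
        S * (((χ.eval w)⁻¹ • (χ.eval w • Q - P * polyQuotient χ M w)) *
        ((1 - B) * Ring.inverse (P + (D - w • Q)))) * S' := by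
      rw [smul_mul_assoc, mul_smul_comm, smul_mul_assoc]
    rw [e]
    set X := P + (D - w • Q)
    set X' := Ring.inverse X
    set Y := M - w • P + Q
    set Y' := (χ.eval w)⁻¹ • (χ.eval w • Q - P * polyQuotient χ M w)
    refine ringInverse_eq_of_mul_eq_one ?_ ?_
    · simp only [mul_assoc, mul_mul_of_mul_eq h.S'S, one_mul, mul_mul_of_mul_eq i1,
        mul_mul_of_mul_eq h.one_add_mul, mul_mul_of_mul_eq j1, h.SS']
    · simp only [mul_assoc, mul_mul_of_mul_eq h.S'S, one_mul, mul_mul_of_mul_eq i2,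
        mul_mul_of_mul_eq h.one_sub_mul, mul_mul_of_mul_eq j2, h.SS']
  refine ⟨MeromorphicAt.congr ?_ hform, ?_⟩
  · have hinv : AnalyticAt ℂ (fun w : ℂ => Ring.inverse (P + (D - w • Q))) z := by
      refine AnalyticAt.comp (g := Ring.inverse) ?_ (by fun_prop)
      obtain ⟨u, hu⟩ := hD
      rw [← hu]
      exact analyticAt_inverse u
    have hq := analyticAt_polyQuotient χ M z
    have heval : AnalyticAt ℂ (fun w : ℂ => χ.eval w) z := by
      have := AnalyticAt.aeval_polynomial (analyticAt_id (𝕜 := ℂ) (z := z)) χ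
      simpa using this
    have h1 : MeromorphicAt (fun w : ℂ => (χ.eval w)⁻¹) z := heval.meromorphicAt.inv
    have h2 : AnalyticAt ℂ (fun w : ℂ => S * ((χ.eval w • Q - P * polyQuotient χ M w) *
      ((1 - B) * Ring.inverse (P + (D - w • Q)))) * S') z := by
      refine (analyticAt_const.mul (AnalyticAt.mul ?_ (analyticAt_const.mul hinv))).mul
        analyticAt_const
      exact (heval.smul analyticAt_const).sub (analyticAt_const.mul hq)
    exact h1.smul h2.meromorphicAt
  · filter_upwards [hroots, hDev] with w hw hDw
    exact (h.isUnit_iff hDw).2 ((isUnit_corner_iff h.add_eq h.PP h.PM h.MP w).2 hw)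

/-- On the quotient by the range of S P the operator L - z acts as the invertible D - z, so
generalized eigenvectors lie in that range. There L is conjugate to the finite matrix, whose
algebraic multiplicity at z is that of the root. -/
theorem finrank_maxGenEigenspace [CompleteSpace E] {z : ℂ} (hD : IsUnit (P + (D - z • Q))) :
    FiniteDimensional ℂ (Module.End.maxGenEigenspace (L : Module.End ℂ E) z) ∧
    Module.finrank ℂ (Module.End.maxGenEigenspace (L : Module.End ℂ E) z) =
      (cornerEnd P M h.PM).charpoly.rootMultiplicity z := by
  set T := cornerEnd P M h.PM with hT
  have hLS : L * S = S * (M + B + D) := by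
    rw [← h.eq, ← mul_assoc, ← mul_assoc, h.SS', one_mul]
  have hS'L : S' * L = (M + B + D) * S' := by
    rw [← h.eq, mul_assoc _ S, h.SS', mul_one]
  set i : LinearMap.range (P : E →ₗ[ℂ] E) →ₗ[ℂ] E := (S : E →ₗ[ℂ] E) ∘ₗ Submodule.subtype _
  have hS'S : ∀ x, S' (S x) = x := fun x => congrArg (fun V : E →L[ℂ] E => V x) h.S'S
  have hSinj : Function.Injective S := Function.LeftInverse.injective hS'S
  have hiinj : Function.Injective i := hSinj.comp Subtype.val_injective
  have hint : ∀ x, L (i x) = i (T x) := by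
    intro x
    obtain ⟨x, hx⟩ := x
    have hPx : P x = x := (mem_range_iff_of_idempotent h.PP).1 hx
    have e : L * S * P = S * M := by
      rw [hLS, mul_assoc, add_mul, add_mul, h.BP, h.DP, h.MP]; simp
    have := congrArg (fun V : E →L[ℂ] E => V x) e
    change L (S (P x)) = S (M x) at this
    rw [hPx] at this
    exact this
  have hintk : ∀ (k : ℕ) (x), (((L : Module.End ℂ E) - z • 1) ^ k) (i x) =
      i (((T - z • 1) ^ k) x) := by
    intro k
    induction k with
    | zero => intro x; rfl
    | succ k ih =>
      intro x
      rw [pow_succ, pow_succ, Module.End.mul_apply, Module.End.mul_apply, ← ih]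
      congr 1
      have := hint x
      simp only [LinearMap.sub_apply, LinearMap.smul_apply, Module.End.one_apply, map_sub,
        map_smul, ContinuousLinearMap.coe_coe, this]
  set G := P + (D - z • Q) with hG
  -- Q S' is the projection to the quotient, intertwining L - z with the invertible operator G.
  have hπ : Q * S' * (L - z • 1) = G * (Q * S') := by
    have e1 : Q * (M + B + D) = D := by rw [mul_add, mul_add, h.QM, h.QB, h.QD]; simp
    have e2 : G * Q = D - z • Q := by
      rw [hG, add_mul, sub_mul, h.PQ, h.DQ, smul_mul_assoc, h.QQ, zero_add]
    rw [mul_sub, mul_assoc, hS'L, mul_smul_comm, mul_one, ← mul_assoc, e1, ← mul_assoc, e2,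
      sub_mul, smul_mul_assoc]
  have hπk : ∀ (k : ℕ) (u : E), Q (S' ((((L : Module.End ℂ E) - z • 1) ^ k) u)) =
      (G ^ k) (Q (S' u)) := by
    intro k
    induction k with
    | zero => intro x; rfl
    | succ k ih =>
      intro u
      rw [pow_succ, pow_succ, Module.End.mul_apply, ih]
      change _ = (G ^ k) (G (Q (S' u)))
      congr 1
      exact congrArg (fun V : E →L[ℂ] E => V u) hπ
  have hmap : Module.End.maxGenEigenspace (L : Module.End ℂ E) z =
      (T.maxGenEigenspace z).map i := by
    ext u
    rw [Module.End.mem_maxGenEigenspace, Submodule.mem_map]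
    constructor
    · rintro ⟨k, hk⟩
      have h1 := hπk k u
      rw [hk, map_zero, map_zero] at h1
      have h2 : Q (S' u) = 0 := by
        have hbij := (ContinuousLinearMap.isUnit_iff_bijective.1 (hD.pow k)).1
        exact hbij (by rw [← h1, map_zero])
      have h3 : P (S' u) = S' u := by
        have : (P + Q) (S' u) = S' u := by rw [h.add_eq]; rfl
        rwa [_root_.add_apply, h2, add_zero] at this
      have h4 : i ⟨S' u, S' u, h3⟩ = u := congrArg (fun V : E →L[ℂ] E => V u) h.SS'
      refine ⟨⟨S' u, S' u, h3⟩, ?_, h4⟩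
      rw [Module.End.mem_maxGenEigenspace]
      refine ⟨k, hiinj ?_⟩
      rw [← hintk, h4, hk, map_zero]
    · rintro ⟨x, hx, rfl⟩
      obtain ⟨k, hk⟩ := (Module.End.mem_maxGenEigenspace _ _ _).1 hx
      exact ⟨k, by rw [hintk, hk, map_zero]⟩
  rw [hmap, ← LinearMap.finrank_maxGenEigenspace_eq]
  exact ⟨inferInstance, (Submodule.equivMapOfInjective i hiinj _).finrank_eq.symm⟩

end BlockTriangular

end BlockTriangular

/-- Poles of the resolvent of a block triangular operator on `l² × l²`. -/
theorem BlockTriangular.hasExactlyPoles {P Q S S' M D B L : (Seq 2 × Seq 2) →L[ℂ] (Seq 2 × Seq 2)}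
    (h : BlockTriangular P Q S S' M D B L)
    [FiniteDimensional ℂ (LinearMap.range (P : (Seq 2 × Seq 2) →ₗ[ℂ] (Seq 2 × Seq 2)))] {δ : ℝ}
    (hM : ∀ z : ℂ, δ ≤ ‖z‖ → IsUnit (M - z • P + Q))
    (hD : ∀ z : ℂ, ‖z‖ < δ → IsUnit (P + (D - z • Q))) :
    HasExactlyPoles L (Metric.ball 0 δ)
      (Module.finrank ℂ (LinearMap.range (P : (Seq 2 × Seq 2) →ₗ[ℂ] (Seq 2 × Seq 2)))) := by
  set χ := (cornerEnd P M h.PM).charpoly with hχ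
  have hχ0 : χ ≠ 0 := (LinearMap.charpoly_monic _).ne_zero
  have hmem : ∀ z, z ∈ χ.roots.toFinset ↔ χ.eval z = 0 := fun z => by simp [hχ0]
  have hball : ∀ z, χ.eval z = 0 → ‖z‖ < δ := fun z hz => by
    by_contra hcon
    exact (isUnit_corner_iff h.add_eq h.PP h.PM h.MP z).1 (hM z (not_lt.1 hcon)) hz
  have hreg : ∀ z, ‖z‖ < δ → (IsRegular L z ↔ χ.eval z ≠ 0) := fun z hz =>
    (h.isUnit_iff (hD z hz)).trans (isUnit_corner_iff h.add_eq h.PP h.PM h.MP z)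
  refine ⟨χ.roots.toFinset, fun z => ?_, fun z hz => ?_, ?_⟩
  · rw [hmem, mem_ball_zero_iff]
    constructor
    · intro hz
      exact ⟨hball z hz, fun hr => (hreg z (hball z hz)).1 hr hz⟩
    · rintro ⟨h1, h2⟩
      by_contra h3
      exact h2 ((hreg z h1).2 h3)
  · rw [hmem] at hz
    have hDz := hD z (hball z hz)
    obtain ⟨m1, m2⟩ := h.meromorphicAt_inverse hDz
    refine ⟨m1, meromorphicOrderAt_resolvent_neg m1 ?_ m2, (h.finrank_maxGenEigenspace hDz).1⟩
    exact fun hr => (hreg z (hball z hz)).1 hr hz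
  · have h1 : ∀ z ∈ χ.roots.toFinset, Module.finrank ℂ (genEigenspace L z) = χ.roots.count z := by
      intro z hz
      rw [Polynomial.count_roots]
      exact (h.finrank_maxGenEigenspace (hD z (hball z ((hmem z).1 hz)))).2
    -- All roots lie in the disk, so their multiplicities sum to the degree of χ, the rank of P.
    rw [Finset.sum_congr rfl h1, Multiset.toFinset_sum_count_eq,
      ← (IsAlgClosed.splits χ).natDegree_eq_card_roots, hχ, LinearMap.charpoly_natDegree]

/-- If `L` is close to `N + J`, its resolvent has exactly as many poles near `0` as the rank of
the idempotent `P`. -/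
theorem Splitting.hasExactlyPoles {P Q N J : (Seq 2 × Seq 2) →L[ℂ] (Seq 2 × Seq 2)}
    (h : Splitting P Q N J)
    [FiniteDimensional ℂ (LinearMap.range (P : (Seq 2 × Seq 2) →ₗ[ℂ] (Seq 2 × Seq 2)))] {δ : ℝ}
    (hδ : 0 < δ) (hδ1 : δ < 1) :
    ∃ η : ℝ, 0 < η ∧ ∀ L, ‖L - (N + J)‖ ≤ η → HasExactlyPoles L (Metric.ball 0 δ)
      (Module.finrank ℂ (LinearMap.range (P : (Seq 2 × Seq 2) →ₗ[ℂ] (Seq 2 × Seq 2)))) := by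
  obtain ⟨η, hη, H⟩ := h.exists_block_triangular_isUnit hδ hδ1
  refine ⟨η, hη, fun L hL => ?_⟩
  obtain ⟨S, S', M, D, B, h1, h2, h3, h4, h5, h6, h7, h8, h9, h10, h11⟩ := H _ hL
  rw [add_sub_cancel] at h3
  exact BlockTriangular.hasExactlyPoles ⟨h.add_eq, h.PP, h1, h2, h3, h4, h5, h6, h7, h8, h9⟩
    h10 h11

/-! ### The linearization in the anti-continuum limit -/

theorem norm_shift_le (k : ℤ) (u : Seq 2) : ‖shift k u‖ ≤ ‖u‖ := by
  have h : ‖shift k‖ ≤ 1 := LinearMap.mkContinuous_norm_le _ zero_le_one _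
  simpa using (shift k).le_of_opNorm_le h u

theorem norm_laplacian_le (u : Seq 2) : ‖laplacian u‖ ≤ 4 * ‖u‖ := by
  have h := norm_add_le (shift 1 u - (2 : ℂ) • u) (shift (-1) u)
  have h' := norm_sub_le (shift 1 u) ((2 : ℂ) • u)
  have h1 := norm_shift_le 1 u
  have h2 := norm_shift_le (-1) u
  have h3 : ‖(2 : ℂ) • u‖ = 2 * ‖u‖ := by rw [norm_smul]; norm_num
  change ‖shift 1 u - (2 : ℂ) • u + shift (-1) u‖ ≤ _
  linarith

theorem memℓp_indicator (U : Finset ℤ) (u : Seq 2) :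
    Memℓp (fun n => if n ∈ U then u n else 0) 2 :=
  (lp.memℓp u).mono' fun n => by split_ifs <;> simp

/-- Restriction of a sequence to a finite set of sites. -/
def siteProj (U : Finset ℤ) : Seq 2 →L[ℂ] Seq 2 :=
  LinearMap.mkContinuous
    { toFun := fun u => ⟨fun n => if n ∈ U then u n else 0, memℓp_indicator U u⟩
      map_add' := fun u v => by
        ext n
        change (if n ∈ U then u n + v n else 0) = (if n ∈ U then u n else 0) + if n ∈ U then v n else 0
        split_ifs <;> simp
      map_smul' := fun c u => by
        ext n
        change (if n ∈ U then c * u n else 0) = c * if n ∈ U then u n else 0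
        split_ifs <;> simp } 1 (by
    intro u
    refine norm_le_mul_of_forall_le zero_le_one fun n => ?_
    change ‖if n ∈ U then u n else 0‖ ≤ _
    split_ifs <;> simp)

/-- The projection onto the sites of `U` in both components. -/
def coreProj (U : Finset ℤ) : (Seq 2 × Seq 2) →L[ℂ] (Seq 2 × Seq 2) :=
  (siteProj U).prodMap (siteProj U)

/-- The limiting linearization on the sites of `U`. -/
def coreNilpotent (p : ℕ) (U : Finset ℤ) : (Seq 2 × Seq 2) →L[ℂ] (Seq 2 × Seq 2) :=
  let T := (siteProj U).comp
    (ContinuousLinearMap.fst ℂ (Seq 2) (Seq 2) + ContinuousLinearMap.snd ℂ (Seq 2) (Seq 2))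
  (-((p : ℂ) • T)).prod ((p : ℂ) • T)

/-- The limiting linearization off the sites of `U`. -/
def outerInvolution (U : Finset ℤ) : (Seq 2 × Seq 2) →L[ℂ] (Seq 2 × Seq 2) :=
  let T := ContinuousLinearMap.id ℂ (Seq 2) - siteProj U
  T.prodMap (-T)

theorem ext_apply {S T : (Seq 2 × Seq 2) →L[ℂ] (Seq 2 × Seq 2)}
    (h1 : ∀ u n, (S u).1 n = (T u).1 n) (h2 : ∀ u n, (S u).2 n = (T u).2 n) : S = T :=
  ContinuousLinearMap.ext fun u =>
    Prod.ext (lp.ext (funext fun n => h1 u n)) (lp.ext (funext fun n => h2 u n))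

theorem coreProj_fst (U : Finset ℤ) (u : Seq 2 × Seq 2) (n : ℤ) :
    (coreProj U u).1 n = if n ∈ U then u.1 n else 0 := rfl
theorem coreProj_snd (U : Finset ℤ) (u : Seq 2 × Seq 2) (n : ℤ) :
    (coreProj U u).2 n = if n ∈ U then u.2 n else 0 := rfl
theorem coreNilpotent_fst (p : ℕ) (U : Finset ℤ) (u : Seq 2 × Seq 2) (n : ℤ) :
    (coreNilpotent p U u).1 n = -(p * if n ∈ U then u.1 n + u.2 n else 0) := rfl
theorem coreNilpotent_snd (p : ℕ) (U : Finset ℤ) (u : Seq 2 × Seq 2) (n : ℤ) :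
    (coreNilpotent p U u).2 n = p * if n ∈ U then u.1 n + u.2 n else 0 := rfl
theorem outerInvolution_fst (U : Finset ℤ) (u : Seq 2 × Seq 2) (n : ℤ) :
    (outerInvolution U u).1 n = u.1 n - if n ∈ U then u.1 n else 0 := rfl
theorem outerInvolution_snd (U : Finset ℤ) (u : Seq 2 × Seq 2) (n : ℤ) :
    (outerInvolution U u).2 n = -(u.2 n - if n ∈ U then u.2 n else 0) := rfl

/-- A site-by-site matrix identity: p[[-1, -1], [1, 1]] has square zero on U and diag(1, -1) has
square 1 off U. -/
theorem splitting_core (p : ℕ) (U : Finset ℤ) :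
    Splitting (coreProj U) (1 - coreProj U) (coreNilpotent p U) (outerInvolution U) := by
  constructor
  · abel
  all_goals
    refine ext_apply (fun u n => ?_) (fun u n => ?_)
  all_goals
    simp only [mul_apply_eq_comp, _root_.zero_apply, coreProj_fst,
      coreProj_snd, coreNilpotent_fst, coreNilpotent_snd, outerInvolution_fst, outerInvolution_snd,
      sub_apply, Prod.fst_sub, Prod.snd_sub, lp.coeFn_sub, Pi.sub_apply, one_apply_eq_self,
      Prod.fst_zero, Prod.snd_zero, lp.coeFn_zero, Pi.zero_apply]
    split_ifs <;> simp

theorem range_coreProj (U : Finset ℤ) :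
    FiniteDimensional ℂ (LinearMap.range (coreProj U : (Seq 2 × Seq 2) →ₗ[ℂ] (Seq 2 × Seq 2))) ∧
    Module.finrank ℂ (LinearMap.range (coreProj U : (Seq 2 × Seq 2) →ₗ[ℂ] (Seq 2 × Seq 2))) =
      2 * U.card := by
  set X := LinearMap.range (coreProj U : (Seq 2 × Seq 2) →ₗ[ℂ] (Seq 2 × Seq 2))
  have hX : ∀ x ∈ X, coreProj U x = x := fun x hx =>
    (mem_range_iff_of_idempotent (splitting_core 0 U).PP).1 hx
  let f : X →ₗ[ℂ] ((U → ℂ) × (U → ℂ)) :=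
    { toFun := fun x => (fun n => x.1.1 n, fun n => x.1.2 n)
      map_add' := fun x y => rfl
      map_smul' := fun c x => rfl }
  have hfin : ∀ g : U → ℂ, Memℓp (fun n : ℤ => if h : n ∈ U then g ⟨n, h⟩ else 0) 2 := fun g => by
    refine (memℓp_zero ?_).of_exponent_ge zero_le
    refine U.finite_toSet.subset fun n hn => ?_
    by_contra h
    have h' : n ∉ U := h
    simp [h'] at hn
  have hf : Function.Bijective f := by
    constructor
    · intro x y hxy
      refine Subtype.ext ?_
      rw [← hX x x.2, ← hX y y.2]
      refine Prod.ext (lp.ext (funext fun n => ?_)) (lp.ext (funext fun n => ?_))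
      · rw [coreProj_fst, coreProj_fst]
        split_ifs with h
        · exact congrFun (congrArg Prod.fst hxy) ⟨n, h⟩
        · rfl
      · rw [coreProj_snd, coreProj_snd]
        split_ifs with h
        · exact congrFun (congrArg Prod.snd hxy) ⟨n, h⟩
        · rfl
    · rintro ⟨g, k⟩
      refine ⟨⟨coreProj U (⟨_, hfin g⟩, ⟨_, hfin k⟩), _, rfl⟩, ?_⟩
      refine Prod.ext (funext fun n => ?_) (funext fun n => ?_)
      · change (if (n : ℤ) ∈ U then (if h : (n : ℤ) ∈ U then g ⟨n, h⟩ else 0) else 0) = g n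
        simp
      · change (if (n : ℤ) ∈ U then (if h : (n : ℤ) ∈ U then k ⟨n, h⟩ else 0) else 0) = k n
        simp
  let e := LinearEquiv.ofBijective f hf
  refine ⟨e.symm.finiteDimensional, ?_⟩
  rw [e.finrank_eq]
  simp [two_mul]

theorem norm_linearization_sub_le (p : ℕ) (U : Finset ℤ) {ε K : ℝ} (hε : 0 ≤ ε) (hK : 0 ≤ K)
    {φ : RealSeq} (hφ : ∀ n, |φ n ^ (2 * p) - if n ∈ U then 1 else 0| ≤ K * ε) :
    ‖linearization p ε φ - (coreNilpotent p U + outerInvolution U)‖ ≤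
      (4 + K * (2 * p + 1)) * ε := by
  refine ContinuousLinearMap.opNorm_le_bound _ (by positivity) fun u => ?_
  obtain ⟨a, b⟩ := u
  have hW : ∀ n, ‖(φ n : ℂ) ^ (2 * p) - if n ∈ U then 1 else 0‖ ≤ K * ε := fun n => by
    have : ((φ n : ℂ) ^ (2 * p) - if n ∈ U then 1 else 0) =
        ((φ n ^ (2 * p) - if n ∈ U then 1 else 0 : ℝ) : ℂ) := by split_ifs <;> push_cast <;> rfl
    rw [this, Complex.norm_real]; exact hφ n
  set v := (linearization p ε φ - (coreNilpotent p U + outerInvolution U)) (a, b)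
  have ha : ‖a‖ ≤ ‖(a, b)‖ := norm_fst_le (a, b)
  have hb : ‖b‖ ≤ ‖(a, b)‖ := norm_snd_le (a, b)
  -- Up to the sign s the two components of the difference are the same expression with a and b
  -- exchanged, so one estimate serves both. The Laplacian contributes 4 and the row (1 + p, p)
  -- contributes 2p + 1.
  have key : ∀ (x y c : Seq 2), ‖x‖ ≤ ‖(a, b)‖ → ‖y‖ ≤ ‖(a, b)‖ →
      (∀ n, ∃ s : ℂ, ‖s‖ = 1 ∧ (c n) = s * (ε * laplacian x n +
        ((φ n : ℂ) ^ (2 * p) - if n ∈ U then 1 else 0) * ((1 + p) * x n + p * y n))) →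
      ‖c‖ ≤ (4 + K * (2 * p + 1)) * ε * ‖(a, b)‖ := by
    intro x y c hx hy hc
    set w : Seq 2 := ((1 + p : ℂ)) • x + (p : ℂ) • y
    have hw : ‖w‖ ≤ (2 * p + 1) * ‖(a, b)‖ := by
      refine (norm_add_le _ _).trans ?_
      rw [norm_smul, norm_smul]
      have e1 : ‖(1 + p : ℂ)‖ = 1 + p := by
        rw [show (1 + p : ℂ) = ((1 + p : ℕ) : ℂ) by push_cast; rfl, Complex.norm_natCast]
        push_cast; rfl
      rw [e1, Complex.norm_natCast]
      nlinarith [norm_nonneg x, norm_nonneg y, (Nat.cast_nonneg p : (0 : ℝ) ≤ p)]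
    have hz : Memℓp (fun n => ((φ n : ℂ) ^ (2 * p) - if n ∈ U then 1 else 0) * w n) 2 :=
      memℓp_of_forall_le (lp.memℓp w) (K * ε) fun n => by
        rw [norm_mul]; exact mul_le_mul_of_nonneg_right (hW n) (norm_nonneg _)
    set z : Seq 2 := ⟨_, hz⟩
    have hzn : ‖z‖ ≤ K * ε * ‖w‖ := norm_le_mul_of_forall_le (by positivity) fun n => by
      change ‖_ * w n‖ ≤ _
      rw [norm_mul]; exact mul_le_mul_of_nonneg_right (hW n) (norm_nonneg _)
    have hcz : ‖c‖ ≤ ‖(ε : ℂ) • laplacian x + z‖ := by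
      refine lp.norm_mono (by norm_num) fun n => ?_
      obtain ⟨s, hs, e⟩ := hc n
      rw [e, norm_mul, hs, one_mul]
      exact le_of_eq rfl
    have h1 := norm_add_le ((ε : ℂ) • laplacian x) z
    rw [norm_smul, Complex.norm_real, Real.norm_eq_abs, abs_of_nonneg hε] at h1
    have h2 := norm_laplacian_le x
    have h3 : ε * ‖laplacian x‖ ≤ ε * (4 * ‖(a, b)‖) :=
      mul_le_mul_of_nonneg_left (by linarith) hε
    have h4 : K * ε * ‖w‖ ≤ K * ε * ((2 * p + 1) * ‖(a, b)‖) :=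
      mul_le_mul_of_nonneg_left hw (by positivity)
    linarith
  refine max_le (key a b v.1 ha hb fun n => ⟨-1, by simp, ?_⟩)
    (key b a v.2 hb ha fun n => ⟨1, by simp, ?_⟩)
  · change (linearization p ε φ (a, b)).1 n -
      ((coreNilpotent p U (a, b)).1 n + (outerInvolution U (a, b)).1 n) = _
    rw [linearization_fst, coreNilpotent_fst, outerInvolution_fst, laplacian_apply]
    split_ifs <;> ring
  · change (linearization p ε φ (a, b)).2 n -
      ((coreNilpotent p U (a, b)).2 n + (outerInvolution U (a, b)).2 n) = _
    rw [linearization_snd, coreNilpotent_snd, outerInvolution_snd, laplacian_apply]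
    split_ifs <;> ring

/-- If the potential is close to the characteristic function of `U`, the linearization has exactly
`2 |U|` poles near the origin. -/
theorem linearization_hasExactlyPoles (p : ℕ) (U : Finset ℤ) {δ K : ℝ} (hδ : 0 < δ) (hδ1 : δ < 1)
    (hK : 0 < K) : ∃ ε₀ : ℝ, 0 < ε₀ ∧ ∀ ε, 0 < ε → ε < ε₀ → ∀ φ : RealSeq,
      (∀ n, |φ n ^ (2 * p) - if n ∈ U then 1 else 0| ≤ K * ε) →
      HasExactlyPoles (linearization p ε φ) (Metric.ball 0 δ) (2 * U.card) := by
  obtain ⟨hfd, hrank⟩ := range_coreProj U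
  obtain ⟨η, hη, H⟩ := (splitting_core p U).hasExactlyPoles hδ hδ1
  refine ⟨η / (4 + K * (2 * p + 1)), by positivity, fun ε hε hε0 φ hφ => ?_⟩
  rw [← hrank]
  refine H _ ((norm_linearization_sub_le p U hε.le hK.le hφ).trans ?_)
  rw [lt_div_iff₀ (by positivity)] at hε0
  linarith

/-! ### The Green function of the Dirichlet Laplacian outside an interval -/

/-- The Green function of the Dirichlet Laplacian on the half-line, in terms of the spectral
parameter `l`, where the energy is `2 - l - l⁻¹`. -/
def halfGreen (l : ℂ) (i j : ℕ) : ℂ :=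
  ∑ k ∈ Finset.range (min i j), l ^ (max i j - min i j + 1 + 2 * k)

theorem halfGreen_comm (l : ℂ) (i j : ℕ) : halfGreen l i j = halfGreen l j i := by
  simp only [halfGreen, min_comm, max_comm]

theorem halfGreen_zero_left (l : ℂ) (j : ℕ) : halfGreen l 0 j = 0 := by simp [halfGreen]

theorem halfGreen_zero_right (l : ℂ) (i : ℕ) : halfGreen l i 0 = 0 := by simp [halfGreen]

theorem halfGreen_add_right (l : ℂ) (i t : ℕ) :
    halfGreen l i (i + t) = l ^ (t + 1) * ∑ k ∈ Finset.range i, (l ^ 2) ^ k := by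
  rw [halfGreen, min_eq_left (by omega), max_eq_right (by omega), Finset.mul_sum]
  refine Finset.sum_congr rfl fun k _ => ?_
  rw [← pow_mul, ← pow_add]; congr 1; omega

theorem halfGreen_add_left (l : ℂ) (j t : ℕ) :
    halfGreen l (j + t) j = l ^ (t + 1) * ∑ k ∈ Finset.range j, (l ^ 2) ^ k := by
  rw [halfGreen_comm, halfGreen_add_right]

theorem halfGreen_recurrence (l : ℂ) (i j : ℕ) :
    (1 + l ^ 2) * halfGreen l (i + 1) j =
      l * (halfGreen l (i + 2) j + halfGreen l i j) + if i + 1 = j then l else 0 := by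
  have hS : ∀ i, ∑ k ∈ Finset.range (i + 1), (l ^ 2) ^ k =
      1 + l ^ 2 * ∑ k ∈ Finset.range i, (l ^ 2) ^ k := fun i => by
    rw [geom_sum_succ]; ring
  rcases lt_trichotomy (i + 1) j with h | h | h
  · obtain ⟨t, rfl⟩ := Nat.exists_eq_add_of_lt h
    rw [if_neg h.ne, show i + 1 + t + 1 = (i + 1) + (t + 1) by ring, halfGreen_add_right,
      show (i + 1) + (t + 1) = (i + 2) + t by ring, halfGreen_add_right,
      show (i + 2) + t = i + (t + 2) by ring, halfGreen_add_right, hS (i + 1), hS i]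
    ring
  · subst h
    have e1 := halfGreen_add_right l (i + 1) 0
    have e2 := halfGreen_add_left l (i + 1) 1
    have e3 := halfGreen_add_right l i 1
    rw [if_pos rfl, show i + 2 = i + 1 + 1 by ring, e2, e3]
    rw [add_zero] at e1
    rw [e1, hS i]
    ring
  · obtain ⟨t, ht⟩ := Nat.exists_eq_add_of_lt h
    have hi : i = j + t := by omega
    subst hi
    rw [if_neg h.ne', show j + t + 1 = j + (t + 1) by ring, halfGreen_add_left,
      show j + t + 2 = j + (t + 2) by ring, halfGreen_add_left, halfGreen_add_left]
    ring

/-- Summing the geometric series would give l(l^{|i-j|} - l^{i+j})/(1 - l²), singular in appearance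
at l = ±1. As a sum of min(i, j) terms of modulus at most 1 it stays finite there, which is why
Dirichlet half-lines have no edge resonance. -/
theorem norm_halfGreen_le {l : ℂ} (hl : ‖l‖ ≤ 1) (i j : ℕ) : ‖halfGreen l i j‖ ≤ (min i j : ℕ) := by
  refine (norm_sum_le _ _).trans ?_
  calc ∑ k ∈ Finset.range (min i j), ‖l ^ (max i j - min i j + 1 + 2 * k)‖
      ≤ ∑ k ∈ Finset.range (min i j), (1 : ℝ) :=
        Finset.sum_le_sum fun k _ => by rw [norm_pow]; exact pow_le_one₀ (norm_nonneg _) hl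
    _ = _ := by simp

theorem norm_halfGreen_le_geometric {l : ℂ} (hl : ‖l‖ < 1) (i j : ℕ) :
    ‖halfGreen l i j‖ ≤ ‖l‖ ^ (max i j - min i j) * (1 - ‖l‖)⁻¹ := by
  refine (norm_sum_le _ _).trans ?_
  rw [← tsum_geometric_of_lt_one (norm_nonneg _) hl]
  calc ∑ k ∈ Finset.range (min i j), ‖l ^ (max i j - min i j + 1 + 2 * k)‖
      ≤ ∑ k ∈ Finset.range (min i j), ‖l‖ ^ (max i j - min i j) * ‖l‖ ^ k :=
        Finset.sum_le_sum fun k _ => by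
          rw [norm_pow, ← pow_add]
          exact pow_le_pow_of_le_one (norm_nonneg _) hl.le (by omega)
    _ = ‖l‖ ^ (max i j - min i j) * ∑ k ∈ Finset.range (min i j), ‖l‖ ^ k := by rw [Finset.mul_sum]
    _ ≤ _ := by
        gcongr
        exact (summable_geometric_of_lt_one (norm_nonneg _) hl).sum_le_tsum _
          fun _ _ => by positivity

theorem norm_pow_sub_pow_le {l l' : ℂ} (hl : ‖l‖ ≤ 1) (hl' : ‖l'‖ ≤ 1) (n : ℕ) :
    ‖l ^ n - l' ^ n‖ ≤ n * ‖l - l'‖ := by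
  rw [← (Commute.all l l').mul_geom_sum₂ n, norm_mul, mul_comm]
  refine mul_le_mul_of_nonneg_right ((norm_sum_le _ _).trans ?_) (norm_nonneg _)
  calc ∑ i ∈ Finset.range n, ‖l ^ i * l' ^ (n - 1 - i)‖ ≤ ∑ i ∈ Finset.range n, (1 : ℝ) :=
        Finset.sum_le_sum fun i _ => by
          rw [norm_mul, norm_pow, norm_pow]
          exact mul_le_one₀ (pow_le_one₀ (norm_nonneg _) hl) (by positivity)
            (pow_le_one₀ (norm_nonneg _) hl')
    _ = n := by simp

/-- Hölder continuity of the Green function in the spectral parameter, up to the boundary of the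
unit disk, with an algebraic weight. -/
theorem norm_halfGreen_sub_le {l l' : ℂ} (hl : ‖l‖ ≤ 1) (hl' : ‖l'‖ ≤ 1) {s : ℝ} (hs : 0 < s)
    (hs1 : s ≤ 1) (i j : ℕ) :
    ‖halfGreen l i j - halfGreen l' i j‖ ≤ 2 * j * (i : ℝ) ^ s * ‖l - l'‖ ^ s := by
  rcases Nat.eq_zero_or_pos i with rfl | hi
  · simp [halfGreen_zero_left, hs.ne']
  rcases Nat.eq_zero_or_pos j with rfl | hj
  · simp [halfGreen_zero_right]
  set t := ‖l - l'‖
  have ht : 0 ≤ t := norm_nonneg _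
  set M : ℝ := ((max i j : ℕ) : ℝ)
  set m : ℝ := ((min i j : ℕ) : ℝ)
  have hm0 : 0 < m := by positivity
  have hM0 : 0 < M := by positivity
  have hi0 : (0 : ℝ) < i := by exact_mod_cast hi
  have hj0 : (0 : ℝ) < j := by exact_mod_cast hj
  -- Interpolation between the Lipschitz bound n t and the trivial bound 2; every exponent that
  -- occurs is at most 2M.
  have hterm : ∀ n : ℕ, (n : ℝ) ≤ 2 * M → ‖l ^ n - l' ^ n‖ ≤ 2 * (M ^ s * t ^ s) := by
    intro n hn
    rw [← Real.mul_rpow hM0.le ht]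
    rcases le_total (M * t) 1 with h | h
    · calc ‖l ^ n - l' ^ n‖ ≤ n * t := norm_pow_sub_pow_le hl hl' n
        _ ≤ 2 * M * t := mul_le_mul_of_nonneg_right hn ht
        _ = 2 * (M * t) ^ (1 : ℝ) := by rw [Real.rpow_one]; ring
        _ ≤ 2 * (M * t) ^ s := by
            gcongr 2 * ?_
            exact Real.rpow_le_rpow_of_exponent_ge' (by positivity) h hs.le hs1
    · calc ‖l ^ n - l' ^ n‖ ≤ ‖l ^ n‖ + ‖l' ^ n‖ := norm_sub_le _ _
        _ ≤ 1 + 1 := by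
            rw [norm_pow, norm_pow]
            exact add_le_add (pow_le_one₀ (norm_nonneg _) hl) (pow_le_one₀ (norm_nonneg _) hl')
        _ = 2 * 1 := by norm_num
        _ ≤ 2 * (M * t) ^ s := by
            gcongr
            exact Real.one_le_rpow h hs.le
  have h1 : ‖halfGreen l i j - halfGreen l' i j‖ ≤ m * (2 * (M ^ s * t ^ s)) := by
    rw [halfGreen, halfGreen, ← Finset.sum_sub_distrib]
    refine (norm_sum_le _ _).trans ?_
    calc _ ≤ ∑ k ∈ Finset.range (min i j), 2 * (M ^ s * t ^ s) := by
          refine Finset.sum_le_sum fun k hk => hterm _ ?_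
          rw [Finset.mem_range] at hk
          have : max i j - min i j + 1 + 2 * k ≤ 2 * max i j := by omega
          simp only [M]
          exact_mod_cast this
      _ = _ := by simp [m]
  -- The min carries power 1 and the max only s ≤ 1, so a full weight can be put on the source j and
  -- only s on the observation point i.
  have h2 : m * M ^ s ≤ j * (i : ℝ) ^ s := by
    rcases le_total i j with h | h
    · have hm : m = i := by simp [m, h]
      have hM : M = j := by simp [M, h]
      rw [hm, hM]
      calc (i : ℝ) * (j : ℝ) ^ s = (i : ℝ) ^ s * (i : ℝ) ^ (1 - s) * (j : ℝ) ^ s := by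
            rw [← Real.rpow_add hi0]; simp
        _ ≤ (i : ℝ) ^ s * (j : ℝ) ^ (1 - s) * (j : ℝ) ^ s := by
            gcongr
        _ = j * (i : ℝ) ^ s := by
            rw [mul_assoc, ← Real.rpow_add hj0]; simp [mul_comm]
    · have hm : m = j := by simp [m, h]
      have hM : M = i := by simp [M, h]
      rw [hm, hM]
  calc _ ≤ m * (2 * (M ^ s * t ^ s)) := h1
    _ = 2 * (m * M ^ s) * t ^ s := by ring
    _ ≤ 2 * (j * (i : ℝ) ^ s) * t ^ s := by gcongr
    _ = _ := by ring

/-- The Green function of the Dirichlet Laplacian on the complement of `[a, b]`. -/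
def green (a b : ℤ) (l : ℂ) (n m : ℤ) : ℂ :=
  halfGreen l (n - b).toNat (m - b).toNat + halfGreen l (a - n).toNat (a - m).toNat

theorem green_comm (a b : ℤ) (l : ℂ) (n m : ℤ) : green a b l n m = green a b l m n := by
  rw [green, green, halfGreen_comm, halfGreen_comm l (a - n).toNat]

/-- `Int.toNat` sends everything on or beyond an endpoint to 0, where the half-line function
vanishes. Hence the sum defining `green` covers both half-lines, has no cross terms, and is zero on
the core. -/
theorem green_eq_zero_left {a b : ℤ} (l : ℂ) {n : ℤ} (hn : n ∈ Finset.Icc a b) (m : ℤ) :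
    green a b l n m = 0 := by
  obtain ⟨h1, h2⟩ := Finset.mem_Icc.1 hn
  rw [green, show (n - b).toNat = 0 by omega, show (a - n).toNat = 0 by omega,
    halfGreen_zero_left, halfGreen_zero_left, add_zero]

theorem green_eq_zero_right {a b : ℤ} (l : ℂ) (n : ℤ) {m : ℤ} (hm : m ∈ Finset.Icc a b) :
    green a b l n m = 0 := by
  rw [green_comm, green_eq_zero_left l hm]

theorem green_recurrence {a b : ℤ} (hab : a ≤ b) (l : ℂ) {n : ℤ} (hn : n ∉ Finset.Icc a b)
    (m : ℤ) : (1 + l ^ 2) * green a b l n m =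
      l * (green a b l (n + 1) m + green a b l (n - 1) m) + if n = m then l else 0 := by
  rw [Finset.mem_Icc] at hn
  rcases lt_or_ge b n with h | h
  · obtain ⟨i, hi⟩ : ∃ i : ℕ, n = b + (i + 1) := ⟨(n - b - 1).toNat, by omega⟩
    have e := halfGreen_recurrence l i (m - b).toNat
    have hc : (i + 1 = (m - b).toNat) ↔ n = m := by omega
    simp only [hc] at e
    rw [green, green, green, show (a - n).toNat = 0 by omega, show (a - (n + 1)).toNat = 0 by omega,
      show (a - (n - 1)).toNat = 0 by omega, show (n - b).toNat = i + 1 by omega,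
      show (n + 1 - b).toNat = i + 2 by omega, show (n - 1 - b).toNat = i by omega]
    simp only [halfGreen_zero_left, add_zero]
    exact e
  · obtain ⟨i, hi⟩ : ∃ i : ℕ, n = a - (i + 1) := ⟨(a - n - 1).toNat, by omega⟩
    have e := halfGreen_recurrence l i (a - m).toNat
    have hc : (i + 1 = (a - m).toNat) ↔ n = m := by omega
    simp only [hc] at e
    rw [green, green, green, show (n - b).toNat = 0 by omega, show (n + 1 - b).toNat = 0 by omega,
      show (n - 1 - b).toNat = 0 by omega, show (a - n).toNat = i + 1 by omega,
      show (a - (n + 1)).toNat = i by omega, show (a - (n - 1)).toNat = i + 2 by omega]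
    simp only [halfGreen_zero_left, zero_add]
    rw [e]; ring

/-! ### Algebraic weights and bounds for the Green function -/

theorem one_le_weight (n : ℤ) {s : ℝ} (hs : 0 ≤ s) : 1 ≤ weight s n :=
  Real.one_le_rpow (by nlinarith [sq_nonneg (n : ℝ)]) (by positivity)

theorem weight_one_sq (n : ℤ) : weight 1 n ^ 2 = 1 + (n : ℝ) ^ 2 := by
  unfold weight
  rw [← Real.rpow_natCast, ← Real.rpow_mul (by positivity)]
  norm_num

theorem abs_le_weight_one (n : ℤ) : |(n : ℝ)| ≤ weight 1 n := by
  refine abs_le_of_sq_le_sq ?_ (WSeq.weight_pos 1 n).le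
  rw [weight_one_sq]; linarith

theorem weight_eq_rpow (s : ℝ) (n : ℤ) : weight s n = weight 1 n ^ s := by
  unfold weight
  rw [← Real.rpow_mul (by positivity)]
  congr 1; ring

theorem weight_neg_mul (s : ℝ) (n : ℤ) : weight (-s) n * weight s n = 1 := by
  unfold weight
  rw [← Real.rpow_add (by positivity), neg_div, neg_add_cancel, Real.rpow_zero]

theorem weight_mono (n : ℤ) {s t : ℝ} (h : s ≤ t) : weight s n ≤ weight t n :=
  Real.rpow_le_rpow_of_exponent_le (by nlinarith [sq_nonneg (n : ℝ)]) (by linarith)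

/-- A constant comparing the distance to `[a, b]` with the weight. -/
def distConst (a b : ℤ) : ℝ := 1 + |(a : ℝ)| + |(b : ℝ)|

theorem one_le_distConst (a b : ℤ) : 1 ≤ distConst a b := by
  unfold distConst; linarith [abs_nonneg (a : ℝ), abs_nonneg (b : ℝ)]

theorem toNat_sub_le (a b n : ℤ) : ((n - b).toNat : ℝ) ≤ distConst a b * weight 1 n ∧
    ((a - n).toNat : ℝ) ≤ distConst a b * weight 1 n := by
  have h1 := abs_le_weight_one n
  have h2 := one_le_weight n (zero_le_one)
  have ha := abs_nonneg (a : ℝ)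
  have hb := abs_nonneg (b : ℝ)
  have key : ∀ x y : ℤ, ((x - y).toNat : ℝ) ≤ |(x : ℝ)| + |(y : ℝ)| := fun x y => by
    have h : ((x - y).toNat : ℤ) ≤ |x| + |y| := by
      have h1 := le_abs_self x
      have h2 := neg_abs_le y
      have h3 := abs_nonneg x
      have h4 := abs_nonneg y
      omega
    exact_mod_cast h
  have k1 := key n b
  have k2 := key a n
  unfold distConst
  constructor <;> nlinarith

/-- The bound depends on the source alone and holds on the closed disk, so the kernel maps l¹₁ to
l^∞ uniformly up to and including the band edges. -/
theorem norm_green_le {a b : ℤ} (hab : a ≤ b) {l : ℂ} (hl : ‖l‖ ≤ 1) (n m : ℤ) :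
    ‖green a b l n m‖ ≤ distConst a b * weight 1 m := by
  obtain ⟨h1, h2⟩ := toNat_sub_le a b m
  have hp : 0 ≤ distConst a b * weight 1 m :=
    mul_nonneg (by linarith [one_le_distConst a b]) (WSeq.weight_pos 1 m).le
  rcases le_total m b with h | h
  · rw [green, show (m - b).toNat = 0 by omega, halfGreen_zero_right, zero_add]
    refine (norm_halfGreen_le hl _ _).trans (le_trans ?_ h2)
    exact_mod_cast min_le_right _ _
  · rw [green, show (a - m).toNat = 0 by omega, halfGreen_zero_right, add_zero]
    refine (norm_halfGreen_le hl _ _).trans (le_trans ?_ h1)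
    exact_mod_cast min_le_right _ _

theorem norm_green_sub_le {a b : ℤ} (hab : a ≤ b) {l l' : ℂ} (hl : ‖l‖ ≤ 1) (hl' : ‖l'‖ ≤ 1)
    {s : ℝ} (hs : 0 < s) (hs1 : s ≤ 1) (n m : ℤ) :
    ‖green a b l n m - green a b l' n m‖ ≤
      2 * distConst a b ^ 2 * ‖l - l'‖ ^ s * weight s n * weight 1 m := by
  have hc := one_le_distConst a b
  have hw := WSeq.weight_pos 1 m
  have hwn := WSeq.weight_pos 1 n
  have hws := WSeq.weight_pos s n
  have key : ∀ i j : ℕ, (i : ℝ) ≤ distConst a b * weight 1 n → (j : ℝ) ≤ distConst a b * weight 1 m →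
      ‖halfGreen l i j - halfGreen l' i j‖ ≤
      2 * distConst a b ^ 2 * ‖l - l'‖ ^ s * weight s n * weight 1 m := by
    intro i j hi hj
    have his : (i : ℝ) ^ s ≤ distConst a b * weight s n := by
      calc (i : ℝ) ^ s ≤ (distConst a b * weight 1 n) ^ s := by gcongr
        _ = distConst a b ^ s * weight s n := by
            rw [Real.mul_rpow (by linarith) hwn.le, weight_eq_rpow s]
        _ ≤ distConst a b ^ (1 : ℝ) * weight s n := by gcongr
        _ = _ := by rw [Real.rpow_one]
    calc _ ≤ 2 * j * (i : ℝ) ^ s * ‖l - l'‖ ^ s := norm_halfGreen_sub_le hl hl' hs hs1 i j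
      _ ≤ 2 * (distConst a b * weight 1 m) * (distConst a b * weight s n) * ‖l - l'‖ ^ s := by
          gcongr
      _ = _ := by ring
  obtain ⟨n1, n2⟩ := toNat_sub_le a b n
  obtain ⟨m1, m2⟩ := toNat_sub_le a b m
  rcases le_total m b with h | h
  · rw [green, green, show (m - b).toNat = 0 by omega, halfGreen_zero_right, zero_add,
      halfGreen_zero_right, zero_add]
    exact key _ _ n2 m2
  · rw [green, green, show (a - m).toNat = 0 by omega, halfGreen_zero_right, add_zero,
      halfGreen_zero_right, add_zero]
    exact key _ _ n1 m1

theorem norm_green_le_geometric {a b : ℤ} (hab : a ≤ b) {l : ℂ} (hl : ‖l‖ < 1) (n m : ℤ) :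
    ‖green a b l n m‖ ≤ (1 - ‖l‖)⁻¹ * ‖l‖ ^ (n - m).natAbs := by
  have hp : 0 ≤ (1 - ‖l‖)⁻¹ * ‖l‖ ^ (n - m).natAbs := by
    have : 0 < 1 - ‖l‖ := by linarith
    positivity
  by_cases h : b < n ∧ b < m
  · rw [green, show (a - m).toNat = 0 by omega, halfGreen_zero_right, add_zero]
    refine (norm_halfGreen_le_geometric hl _ _).trans (le_of_eq ?_)
    rw [mul_comm]; congr 2; omega
  by_cases h' : n < a ∧ m < a
  · rw [green, show (m - b).toNat = 0 by omega, halfGreen_zero_right, zero_add]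
    refine (norm_halfGreen_le_geometric hl _ _).trans (le_of_eq ?_)
    rw [mul_comm]; congr 2; omega
  have e1 : halfGreen l (n - b).toNat (m - b).toNat = 0 := by
    rcases Nat.eq_zero_or_pos (n - b).toNat with h0 | h0
    · rw [h0, halfGreen_zero_left]
    · rw [show (m - b).toNat = 0 by omega, halfGreen_zero_right]
  have e2 : halfGreen l (a - n).toNat (a - m).toNat = 0 := by
    rcases Nat.eq_zero_or_pos (a - n).toNat with h0 | h0
    · rw [h0, halfGreen_zero_left]
    · rw [show (a - m).toNat = 0 by omega, halfGreen_zero_right]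
  rw [green, e1, e2]
  simpa using hp

/-! ### Solving the Dirichlet problem with the Green function -/

/-- The potential generated by a source, away from the interval. -/
theorem green_solve {a b : ℤ} (hab : a ≤ b) (l : ℂ) {f : ℤ → ℂ}
    (hf : ∀ n, Summable fun m => green a b l n m * f m) {n : ℤ} (hn : n ∉ Finset.Icc a b) :
    (1 + l ^ 2) * ∑' m, green a b l n m * f m =
      l * (∑' m, green a b l (n + 1) m * f m + ∑' m, green a b l (n - 1) m * f m) + l * f n := by
  have hd : ∑' m, (if n = m then l else 0) * f m = l * f n := by
    rw [tsum_eq_single n (fun m hm => by simp [hm.symm])]; simp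
  have hds : Summable fun m => (if n = m then l else 0) * f m :=
    summable_of_ne_finset_zero (s := {n}) fun m hm => by
      have : n ≠ m := fun h => hm (by simp [h])
      simp [this]
  rw [← hd, ← (hf _).tsum_add (hf _), ← tsum_mul_left, ← tsum_mul_left,
    ← (((hf _).add (hf _)).mul_left l).tsum_add hds]
  refine tsum_congr fun m => ?_
  rw [← mul_assoc, green_recurrence hab l hn m]
  ring

theorem summable_pow_natAbs {r : ℝ} (h0 : 0 ≤ r) (h1 : r < 1) :
    Summable fun k : ℤ => r ^ k.natAbs := by
  refine Summable.of_nat_of_neg ?_ ?_ <;>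
    simpa using summable_geometric_of_lt_one h0 h1

theorem summable_green {a b : ℤ} (hab : a ≤ b) {l : ℂ} (hl : ‖l‖ < 1) (n : ℤ) :
    Summable fun m => ‖green a b l n m‖ := by
  refine Summable.of_nonneg_of_le (fun _ => norm_nonneg _)
    (fun m => norm_green_le_geometric hab hl n m) (Summable.mul_left _ ?_)
  exact (summable_pow_natAbs (norm_nonneg l) hl).comp_injective
    (i := fun m => n - m) sub_right_injective

/-- A bounded sequence vanishing on the interval is the potential of its Dirichlet Laplacian. -/
theorem green_represent {a b : ℤ} (hab : a ≤ b) {l : ℂ} (hl : ‖l‖ < 1) {x : ℤ → ℂ} {C : ℝ}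
    (hx : ∀ n, ‖x n‖ ≤ C) (hx0 : ∀ n ∈ Finset.Icc a b, x n = 0) (n : ℤ) :
    ∑' m, green a b l n m * ((1 + l ^ 2) * x m - l * (x (m + 1) + x (m - 1))) = l * x n := by
  have hs : ∀ y : ℤ → ℂ, (∀ m, ‖y m‖ ≤ C) → ∀ n, Summable fun m => green a b l n m * y m :=
    fun y hy n => by
      refine Summable.of_norm_bounded ((summable_green hab hl n).mul_right C) fun m => ?_
      rw [norm_mul]; exact mul_le_mul_of_nonneg_left (hy m) (norm_nonneg _)
  have s1 := hs x hx n
  have s2 := hs (fun m => x (m + 1)) (fun m => hx _) n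
  have s3 := hs (fun m => x (m - 1)) (fun m => hx _) n
  have e2 : ∑' m, green a b l n m * x (m + 1) = ∑' m, green a b l n (m - 1) * x m := by
    rw [← (Equiv.addRight (1 : ℤ)).tsum_eq (fun m => green a b l n (m - 1) * x m)]
    simp
  have e3 : ∑' m, green a b l n m * x (m - 1) = ∑' m, green a b l n (m + 1) * x m := by
    rw [← (Equiv.subRight (1 : ℤ)).tsum_eq (fun m => green a b l n (m + 1) * x m)]
    simp
  have s2' : Summable fun m => green a b l n (m - 1) * x m := by
    rw [← (Equiv.addRight (1 : ℤ)).summable_iff]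
    simpa [Function.comp_def] using s2
  have s3' : Summable fun m => green a b l n (m + 1) * x m := by
    rw [← (Equiv.subRight (1 : ℤ)).summable_iff]
    simpa [Function.comp_def] using s3
  calc _ = ∑' m, ((1 + l ^ 2) * (green a b l n m * x m)
        - l * (green a b l n m * x (m + 1) + green a b l n m * x (m - 1))) :=
        tsum_congr fun m => by ring
    _ = (1 + l ^ 2) * ∑' m, green a b l n m * x m - l * (∑' m, green a b l n m * x (m + 1)
        + ∑' m, green a b l n m * x (m - 1)) := by
        rw [(s1.mul_left _).tsum_sub ((s2.add s3).mul_left _), tsum_mul_left, tsum_mul_left,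
          s2.tsum_add s3]
    _ = ∑' m, ((1 + l ^ 2) * (green a b l n m * x m)
        - l * (green a b l n (m - 1) * x m + green a b l n (m + 1) * x m)) := by
        rw [e2, e3, (s1.mul_left _).tsum_sub ((s2'.add s3').mul_left _), tsum_mul_left,
          tsum_mul_left, s2'.tsum_add s3']
    -- After summation by parts the recurrence is applied in the second variable. The sites where it
    -- fails lie in the core, where x vanishes.
    _ = l * x n := by
        rw [tsum_eq_single n fun m hm => ?_]
        · by_cases hn : n ∈ Finset.Icc a b
          · simp [hx0 n hn]
          · have := green_recurrence hab l hn n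
            rw [if_pos rfl] at this
            rw [green_comm a b l n (n - 1), green_comm a b l n (n + 1)]
            linear_combination x n * this
        · by_cases hm' : m ∈ Finset.Icc a b
          · simp [hx0 m hm']
          · have := green_recurrence hab l hm' n
            rw [if_neg hm] at this
            rw [green_comm a b l n (m - 1), green_comm a b l n (m + 1), green_comm a b l n m]
            linear_combination x m * this

theorem summable_green_mul {a b : ℤ} (hab : a ≤ b) {l : ℂ} (hl : ‖l‖ < 1) (f : Seq 2) (n : ℤ) :
    Summable fun m => green a b l n m * f m := by
  refine Summable.of_norm_bounded ((summable_green hab hl n).mul_right ‖f‖) fun m => ?_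
  rw [norm_mul]
  exact mul_le_mul_of_nonneg_left (lp.norm_apply_le_norm (by norm_num) f m) (norm_nonneg _)

/-- Inside the unit disk of the spectral parameter, the Green function acts on `l²`. -/
theorem memℓp_green {a b : ℤ} (hab : a ≤ b) {l : ℂ} (hl : ‖l‖ < 1) (f : Seq 2) :
    Memℓp (fun n => ∑' m, green a b l n m * f m) 2 := by
  have hfn : Memℓp (fun n => (‖f n‖ : ℂ)) 2 := (lp.memℓp f).mono' fun n => by simp
  set F : Seq 2 := ⟨_, hfn⟩
  set c : ℤ → ℝ := fun k => (1 - ‖l‖)⁻¹ * ‖l‖ ^ k.natAbs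
  have hc0 : ∀ k, 0 ≤ c k := fun k => by
    have : 0 < 1 - ‖l‖ := by linarith
    positivity
  have hc : Summable c := (summable_pow_natAbs (norm_nonneg l) hl).mul_left _
  -- Young's inequality: the kernel is dominated by a summable convolution kernel c, and the series
  -- of translates of |f| with coefficients c converges absolutely in l².
  have hsum : Summable fun k => (c k : ℂ) • shift k F := by
    refine Summable.of_norm_bounded (hc.mul_right ‖F‖) fun k => ?_
    rw [norm_smul, Complex.norm_real, Real.norm_eq_abs, abs_of_nonneg (hc0 k)]
    exact mul_le_mul_of_nonneg_left (norm_shift_le k F) (hc0 k)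
  set G : Seq 2 := ∑' k, (c k : ℂ) • shift k F
  refine (lp.memℓp G).mono' fun n => ?_
  have hG : HasSum (fun k => ((c k * ‖f (n + k)‖ : ℝ) : ℂ)) (G n) := by
    have h := hsum.hasSum.mapL (lp.evalCLM ℂ (fun _ : ℤ => ℂ) 2 n)
    convert! h using 2 with k
    change _ = (c k : ℂ) * (‖f (n + k)‖ : ℂ)
    push_cast; rfl
  have hG' : HasSum (fun k => c k * ‖f (n + k)‖) ‖G n‖ := by
    have hre := Complex.hasSum_re hG
    simp only [Complex.ofReal_re] at hre
    have him := Complex.hasSum_im hG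
    simp only [Complex.ofReal_im] at him
    have h0 : (G n).im = 0 := him.unique hasSum_zero
    have hpos : 0 ≤ (G n).re := hre.nonneg fun k => mul_nonneg (hc0 k) (norm_nonneg _)
    have : G n = ((G n).re : ℂ) := Complex.ext rfl (by simp [h0])
    rw [this, Complex.norm_real, Real.norm_eq_abs, abs_of_nonneg hpos]
    exact hre
  have hG'' : HasSum (fun m => c (m - n) * ‖f m‖) ‖G n‖ := by
    rw [← (Equiv.addLeft n).hasSum_iff]
    simpa [Function.comp_def] using hG'
  refine tsum_of_norm_bounded hG'' fun m => ?_
  rw [norm_mul]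
  refine mul_le_mul_of_nonneg_right ((norm_green_le_geometric hab hl n m).trans (le_of_eq ?_))
    (norm_nonneg _)
  simp only [c]
  congr 2; omega

/-! ### The spectral parameter -/

/-- The two roots of l² - cl + 1 have product 1, so one lies in the closed disk. On the circle l⁻¹
is the conjugate of l, forcing c = 2 Re l into [-2, 2]. -/
theorem exists_spectral_param (c : ℂ) : ∃ l : ℂ, ‖l‖ ≤ 1 ∧ 1 + l ^ 2 = c * l ∧
    ((∀ x : ℝ, |x| ≤ 2 → c ≠ x) → ‖l‖ < 1) := by
  have hex : ∃ l : ℂ, ‖l‖ ≤ 1 ∧ 1 + l ^ 2 = c * l := by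
    obtain ⟨w, hw⟩ := IsAlgClosed.exists_pow_nat_eq (c ^ 2 - 4) (n := 2) (by norm_num)
    have h1 : ((c + w) / 2) * ((c - w) / 2) = 1 := by linear_combination -hw / 4
    rcases le_total ‖(c + w) / 2‖ 1 with h | h
    · exact ⟨_, h, by linear_combination hw / 4⟩
    · refine ⟨(c - w) / 2, ?_, by linear_combination hw / 4⟩
      have h2 := congrArg norm h1
      rw [norm_mul, norm_one] at h2
      nlinarith [norm_nonneg ((c - w) / 2)]
  obtain ⟨l, hl, he⟩ := hex
  refine ⟨l, hl, he, fun hc => lt_of_le_of_ne hl fun h1 => ?_⟩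
  have hn : l * (starRingEnd ℂ) l = 1 := by
    rw [Complex.mul_conj, Complex.normSq_eq_norm_sq, h1]; norm_num
  refine hc (2 * l.re) ?_ ?_
  · rw [abs_mul, abs_two]
    have := Complex.abs_re_le_norm l
    linarith
  · have h2 : c = l + (starRingEnd ℂ) l := by
      linear_combination (-(starRingEnd ℂ) l) * he + (l - c) * hn
    rw [h2, Complex.add_conj]

/-- Boundary values of the spectral parameter on the real axis. -/
theorem exists_boundary_param (x : ℝ) {τ : ℝ} (hτ : τ = 1 ∨ τ = -1) :
    ∃ l₀ : ℂ, ‖l₀‖ ≤ 1 ∧ 1 + l₀ ^ 2 = x * l₀ ∧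
      ∀ c l : ℂ, ‖l‖ ≤ 1 → 1 + l ^ 2 = c * l → τ * c.im < 0 → ‖l - l₀‖ ^ 2 ≤ ‖c - x‖ := by
  rcases le_or_gt |x| 2 with hx | hx
  · set y : ℝ := τ * √(1 - x ^ 2 / 4)
    have hx2 : x ^ 2 ≤ 4 := by
      rw [← sq_abs]; nlinarith [abs_nonneg x]
    have hy2 : y ^ 2 = 1 - x ^ 2 / 4 := by
      rw [mul_pow, Real.sq_sqrt (by linarith)]
      rcases hτ with h | h <;> rw [h] <;> ring
    set l₀ : ℂ := ⟨x / 2, y⟩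
    have hsum : l₀ + (starRingEnd ℂ) l₀ = x := by
      rw [Complex.add_conj]; simp [l₀]; ring
    have hprod : l₀ * (starRingEnd ℂ) l₀ = 1 := by
      rw [Complex.mul_conj, Complex.normSq_mk]
      norm_cast
      linear_combination hy2
    have hnorm : ‖l₀‖ = 1 := by
      have := congrArg norm hprod
      rw [norm_mul, RCLike.norm_conj, norm_one] at this
      nlinarith [norm_nonneg l₀]
    refine ⟨l₀, hnorm.le, by linear_combination l₀ * hsum - hprod, fun c l hl he hc => ?_⟩
    -- Here l₀ and its conjugate are the two roots at c = x. If l is closer to l₀, this product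
    -- bounds |l - l₀|², a square-root rate that survives at x = ±2, where the roots collide.
    have e1 : (l - l₀) * (l - (starRingEnd ℂ) l₀) = (c - x) * l := by
      linear_combination he + hprod - l * hsum
    have hlsq : Complex.normSq l ≤ 1 := by
      rw [Complex.normSq_eq_norm_sq]; nlinarith [norm_nonneg l]
    have him : l.im * (Complex.normSq l - 1) = c.im * Complex.normSq l := by
      have h : ((1 + l ^ 2) * (starRingEnd ℂ) l).im = (c * l * (starRingEnd ℂ) l).im := by rw [he]
      rw [mul_assoc c, Complex.mul_conj, Complex.im_mul_ofReal, add_mul, one_mul, pow_two, mul_assoc,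
        Complex.mul_conj, Complex.add_im, Complex.conj_im, Complex.im_mul_ofReal] at h
      linarith
    have hl0 : l ≠ 0 := by rintro rfl; norm_num at he
    have hlpos : 0 < Complex.normSq l := Complex.normSq_pos.2 hl0
    -- The imaginary part of the equation ties the sign of Im l to that of Im c because |l| ≤ 1;
    -- this selects l₀ over its conjugate.
    have hτim : 0 ≤ τ * l.im := by
      by_contra hneg
      have h1 : τ * l.im * (Complex.normSq l - 1) = τ * c.im * Complex.normSq l := by
        linear_combination τ * him
      have h2 : τ * c.im * Complex.normSq l < 0 := mul_neg_of_neg_of_pos hc hlpos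
      have h3 : 0 ≤ τ * l.im * (Complex.normSq l - 1) :=
        mul_nonneg_of_nonpos_of_nonpos (by linarith) (by linarith)
      linarith
    have hcmp : ‖l - l₀‖ ≤ ‖l - (starRingEnd ℂ) l₀‖ := by
      refine abs_le_of_sq_le_sq' ?_ (norm_nonneg _) |>.2
      rw [← Complex.normSq_eq_norm_sq, ← Complex.normSq_eq_norm_sq, Complex.normSq_apply,
        Complex.normSq_apply]
      simp only [Complex.sub_re, Complex.sub_im, Complex.conj_re, Complex.conj_im, l₀, y]
      have := mul_nonneg hτim (Real.sqrt_nonneg (1 - x ^ 2 / 4))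
      nlinarith
    have e2 := congrArg norm e1
    rw [norm_mul, norm_mul] at e2
    calc ‖l - l₀‖ ^ 2 ≤ ‖l - l₀‖ * ‖l - (starRingEnd ℂ) l₀‖ := by
          rw [pow_two]; exact mul_le_mul_of_nonneg_left hcmp (norm_nonneg _)
      _ = ‖c - x‖ * ‖l‖ := e2
      _ ≤ ‖c - x‖ := mul_le_of_le_one_right (norm_nonneg _) hl
  · obtain ⟨l₀, h1, h2, h3⟩ := exists_spectral_param x
    have hlt : ‖l₀‖ < 1 := h3 fun y hy hxy => by
      have : x = y := by exact_mod_cast hxy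
      rw [this] at hx; linarith
    have hreal : (starRingEnd ℂ) l₀ = l₀ := by
      have e := congrArg (starRingEnd ℂ) h2
      simp only [map_add, map_one, map_pow, map_mul, Complex.conj_ofReal] at e
      have e1 : ((starRingEnd ℂ) l₀ - l₀) * ((starRingEnd ℂ) l₀ * l₀ - 1) = 0 := by
        linear_combination l₀ * e - (starRingEnd ℂ) l₀ * h2
      rcases mul_eq_zero.1 e1 with e2 | e2
      · exact sub_eq_zero.1 e2
      · have e3 := congrArg norm (sub_eq_zero.1 e2)
        rw [norm_mul, RCLike.norm_conj, norm_one] at e3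
        nlinarith [norm_nonneg l₀]
    obtain ⟨r, rfl⟩ := Complex.conj_eq_iff_real.1 hreal
    refine ⟨r, h1, h2, fun c l hl he _ => ?_⟩
    -- For |x| > 2 the second root is 1/r; clearing it leaves 1 - lr, and |l - r| ≤ |1 - lr| in the
    -- unit disk.
    have e1 : (l - r) * (1 - l * r) = -(r * (c - x) * l) := by
      linear_combination -r * he + l * h2
    have hcmp : ‖l - r‖ ≤ ‖1 - l * r‖ := by
      refine abs_le_of_sq_le_sq' ?_ (norm_nonneg _) |>.2
      have hl2 : l.re ^ 2 + l.im ^ 2 ≤ 1 := by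
        have : ‖l‖ ^ 2 ≤ 1 := by nlinarith [norm_nonneg l]
        rw [← Complex.normSq_eq_norm_sq, Complex.normSq_apply] at this
        linarith
      have hr2 : r ^ 2 ≤ 1 := by
        rw [Complex.norm_real, Real.norm_eq_abs] at h1
        rw [← sq_abs]; nlinarith [abs_nonneg r]
      rw [← Complex.normSq_eq_norm_sq, ← Complex.normSq_eq_norm_sq, Complex.normSq_apply,
        Complex.normSq_apply]
      simp
      nlinarith [mul_nonneg (sub_nonneg.2 hl2) (sub_nonneg.2 hr2)]
    have e2 := congrArg norm e1
    rw [norm_mul, norm_neg, norm_mul, norm_mul] at e2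
    calc ‖l - r‖ ^ 2 ≤ ‖l - r‖ * ‖1 - l * r‖ := by
          rw [pow_two]; exact mul_le_mul_of_nonneg_left hcmp (norm_nonneg _)
      _ = ‖(r : ℂ)‖ * ‖c - x‖ * ‖l‖ := e2
      _ ≤ ‖(r : ℂ)‖ * ‖c - x‖ := mul_le_of_le_one_right (by positivity) hl
      _ ≤ ‖c - x‖ := mul_le_of_le_one_left (norm_nonneg _) h1

/-! ### Operators between weighted spaces -/

theorem hasSum_norm_wSeq (f : WSeq 1 1) : HasSum (fun m => weight 1 m * ‖f.val m‖) ‖f‖ := by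
  have h := lp.hasSum_norm (p := 1) (by norm_num) (WSeq.toSeq 1 1 f)
  simp only [ENNReal.toReal_one, Real.rpow_one] at h
  rw [WSeq.norm_def]
  convert! h using 2 with m
  change _ = ‖(weight 1 m : ℂ) * f.val m‖
  rw [norm_mul, Complex.norm_real, Real.norm_eq_abs, abs_of_pos (WSeq.weight_pos 1 m)]

theorem memℓp_weighted_of_summable {x : ℤ → ℂ} (hx : Summable fun m => weight 1 m * ‖x m‖) :
    Memℓp (weighted 1 x) 1 := by
  refine memℓp_gen ?_
  simp only [ENNReal.toReal_one, Real.rpow_one]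
  convert! hx using 2 with m
  change ‖(weight 1 m : ℂ) * x m‖ = _
  rw [norm_mul, Complex.norm_real, Real.norm_eq_abs, abs_of_pos (WSeq.weight_pos 1 m)]

/-- An element of `l¹₁` from a weighted summable sequence. -/
def wSeqMk (x : ℤ → ℂ) (hx : Summable fun m => weight 1 m * ‖x m‖) : WSeq 1 1 :=
  ⟨x, memℓp_weighted_of_summable hx⟩

theorem summable_kernel_mul {k : ℤ → ℂ} {c : ℝ} (hk : ∀ m, ‖k m‖ ≤ c * weight 1 m)
    (f : WSeq 1 1) : Summable fun m => k m * f.val m := by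
  refine Summable.of_norm_bounded ((hasSum_norm_wSeq f).summable.mul_left c) fun m => ?_
  rw [norm_mul, ← mul_assoc]
  exact mul_le_mul_of_nonneg_right (hk m) (norm_nonneg _)

theorem norm_tsum_kernel_le {k : ℤ → ℂ} {c : ℝ} (hk : ∀ m, ‖k m‖ ≤ c * weight 1 m)
    (f : WSeq 1 1) : ‖∑' m, k m * f.val m‖ ≤ c * ‖f‖ := by
  refine tsum_of_norm_bounded ((hasSum_norm_wSeq f).mul_left c) fun m => ?_
  rw [norm_mul, ← mul_assoc]
  exact mul_le_mul_of_nonneg_right (hk m) (norm_nonneg _)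

/-- An operator into `l¹₁` with weighted summable pointwise bounds. -/
def decayOp {X : Type*} [NormedAddCommGroup X] [NormedSpace ℂ X] (T : X →ₗ[ℂ] (ℤ → ℂ)) (e : ℤ → ℝ)
    (he : Summable fun m => weight 1 m * e m) (hT : ∀ u n, ‖T u n‖ ≤ e n * ‖u‖) :
    X →L[ℂ] WSeq 1 1 :=
  have hs : ∀ u, Summable fun m => weight 1 m * ‖T u m‖ := fun u =>
    Summable.of_nonneg_of_le (fun m => mul_nonneg (WSeq.weight_pos 1 m).le (norm_nonneg _))
      (fun m => by
        have := mul_le_mul_of_nonneg_left (hT u m) (WSeq.weight_pos 1 m).le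
        rwa [← mul_assoc] at this) (he.mul_right ‖u‖)
  LinearMap.mkContinuous
    { toFun := fun u => wSeqMk (T u) (hs u)
      map_add' := fun u v => Subtype.ext (T.map_add u v)
      map_smul' := fun c u => Subtype.ext (T.map_smul c u) } (∑' m, weight 1 m * e m)
    fun u => by
      refine hasSum_le (fun m => ?_) (hasSum_norm_wSeq _) (he.hasSum.mul_right ‖u‖)
      have := mul_le_mul_of_nonneg_left (hT u m) (WSeq.weight_pos 1 m).le
      rwa [← mul_assoc] at this

/-! ### Decoupling of the core -/

section Pointwise

variable (p : ℕ) (a b : ℤ) (ε : ℝ) (W : ℤ → ℂ)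

/-- The part of the Laplacian which involves the sites of `[a, b]`. -/
def coupling (x : ℤ → ℂ) (n : ℤ) : ℂ :=
  if n ∈ Finset.Icc a b then x (n + 1) - 2 * x n + x (n - 1)
  else (if n + 1 ∈ Finset.Icc a b then x (n + 1) else 0)
    + if n - 1 ∈ Finset.Icc a b then x (n - 1) else 0

/-- The first component of the perturbation of the decoupled linearization. -/
def pertFst (x y : ℤ → ℂ) (n : ℤ) : ℂ :=
  -(ε * coupling a b x n) - W n * ((1 + p) * x n + p * y n)

/-- The first component of the linearization with potential `1_{[a,b]} + W`. -/
def linFst (x y : ℤ → ℂ) (n : ℤ) : ℂ :=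
  -ε * (x (n + 1) - 2 * x n + x (n - 1)) + x n
    - ((if n ∈ Finset.Icc a b then 1 else 0) + W n) * ((1 + p) * x n + p * y n)

/-- The first component of the resolvent of the decoupled linearization. -/
def freeFst (Ω l : ℂ) (f g : ℤ → ℂ) (n : ℤ) : ℂ :=
  (ε : ℂ)⁻¹ * ∑' m, green a b l n m * f m
    + if n ∈ Finset.Icc a b then Ω⁻¹ ^ 2 * ((p - Ω) * f n + p * g n) else 0

variable {p a b ε W}

theorem green_sum_eq_zero {l : ℂ} {f : ℤ → ℂ} {n : ℤ} (hn : n ∈ Finset.Icc a b) :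
    ∑' m, green a b l n m * f m = 0 := by
  simp [green_eq_zero_left l hn]

/-- A bounded solution of the resolvent equation solves the integral equation. -/
theorem eq_freeFst_of_lin {Ω l : ℂ} (hab : a ≤ b) (hε : ε ≠ 0) (hΩ : Ω ≠ 0) (hl : ‖l‖ < 1)
    (heq : ε * (1 + l ^ 2) = (2 * ε + 1 - Ω) * l) {x y f g : ℤ → ℂ} {C : ℝ} (hx : ∀ n, ‖x n‖ ≤ C)
    (h1 : ∀ n, linFst p a b ε W x y n - Ω * x n = f n)
    (h2 : ∀ n, -linFst p a b ε W y x n - Ω * y n = g n) (n : ℤ) :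
    x n = freeFst p a b ε Ω l (fun m => f m - pertFst p a b ε W x y m)
      (fun m => g m + pertFst p a b ε W y x m) n := by
  have hε' : (ε : ℂ) ≠ 0 := by exact_mod_cast hε
  have hl0 : l ≠ 0 := by
    rintro rfl
    simp [hε] at heq
  by_cases hn : n ∈ Finset.Icc a b
  · rw [freeFst, green_sum_eq_zero hn, if_pos hn, ← h1 n, ← h2 n]
    simp only [linFst, pertFst, coupling, if_pos hn]
    field_simp
    ring
  · rw [freeFst, if_neg hn, add_zero]
    -- Off the core, the Laplacian of x differs from that of its cut-off x' exactly by the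
    -- `coupling` term, already moved to the right-hand side. So x' solves the Dirichlet problem.
    set x' : ℤ → ℂ := fun m => if m ∈ Finset.Icc a b then 0 else x m with hx'
    have hC : 0 ≤ C := (norm_nonneg _).trans (hx 0)
    have r := green_represent hab hl (x := x') (C := C)
      (fun m => by simp only [hx']; split_ifs <;> simp [hC, hx m])
      (fun m hm => if_pos hm) n
    have hterm : ∀ m, green a b l n m * ((1 + l ^ 2) * x' m - l * (x' (m + 1) + x' (m - 1))) =
        (ε : ℂ)⁻¹ * l * (green a b l n m * (f m - pertFst p a b ε W x y m)) := by
      intro m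
      by_cases hm : m ∈ Finset.Icc a b
      · simp [green_eq_zero_right l n hm]
      · have e : (ε : ℂ)⁻¹ * l * (f m - pertFst p a b ε W x y m) =
            (1 + l ^ 2) * x' m - l * (x' (m + 1) + x' (m - 1)) := by
          rw [← h1 m]
          simp only [linFst, pertFst, coupling, if_neg hm, hx']
          have heq' : (1 + l ^ 2) = (ε : ℂ)⁻¹ * ((2 * ε + 1 - Ω) * l) := by
            rw [← heq]; field_simp
          rw [heq']
          split_ifs <;> field_simp <;> ring
        rw [← e]; ring
    rw [tsum_congr hterm, tsum_mul_left, show x' n = x n from if_neg hn] at r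
    have : l * ((ε : ℂ)⁻¹ * ∑' m, green a b l n m * (f m - pertFst p a b ε W x y m)) = l * x n := by
      rw [← r]; ring
    exact (mul_left_cancel₀ hl0 this).symm

/-- A solution of the integral equation solves the resolvent equation. -/
theorem lin_of_eq_freeFst {Ω l : ℂ} (hab : a ≤ b) (hε : ε ≠ 0) (hΩ : Ω ≠ 0)
    (heq : ε * (1 + l ^ 2) = (2 * ε + 1 - Ω) * l) {x y F G : ℤ → ℂ}
    (hF : ∀ n, Summable fun m => green a b l n m * F m)
    (hx : ∀ n, x n = freeFst p a b ε Ω l F G n)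
    (hy : ∀ n ∈ Finset.Icc a b, y n = Ω⁻¹ ^ 2 * (-(p * F n) - (p + Ω) * G n)) (n : ℤ) :
    linFst p a b ε W x y n - Ω * x n = F n + pertFst p a b ε W x y n := by
  have hε' : (ε : ℂ) ≠ 0 := by exact_mod_cast hε
  have hl0 : l ≠ 0 := by
    rintro rfl
    simp [hε] at heq
  by_cases hn : n ∈ Finset.Icc a b
  · have e1 := hx n
    rw [freeFst, green_sum_eq_zero hn, if_pos hn, mul_zero, zero_add] at e1
    have e2 := hy n hn
    have e3 : -p * x n - p * y n - Ω * x n = F n := by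
      rw [e1, e2]; field_simp; ring
    simp only [linFst, pertFst, coupling, if_pos hn]
    linear_combination e3
  · set z : ℤ → ℂ := fun n => (ε : ℂ)⁻¹ * ∑' m, green a b l n m * F m with hz
    have s := green_solve hab l hF hn
    have hzx : ∀ m, z m = if m ∈ Finset.Icc a b then 0 else x m := fun m => by
      split_ifs with hm
      · simp [hz, green_sum_eq_zero hm]
      · rw [hx m, freeFst, if_neg hm, add_zero]
    have s' : (1 + l ^ 2) * z n = l * (z (n + 1) + z (n - 1)) + (ε : ℂ)⁻¹ * l * F n := by
      simp only [hz]
      linear_combination (ε : ℂ)⁻¹ * s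
    have e : l * ((2 * ε + 1 - Ω) * z n - ε * (z (n + 1) + z (n - 1)) - F n) = 0 := by
      have : (ε : ℂ) * ((ε : ℂ)⁻¹ * l * F n) = l * F n := by field_simp
      linear_combination -z n * heq + ε * s' + this
    have e' := (mul_eq_zero.1 e).resolve_left hl0
    rw [hzx, hzx, hzx, if_neg hn] at e'
    simp only [linFst, pertFst, coupling, if_neg hn]
    split_ifs at e' ⊢ <;> linear_combination e'

end Pointwise

/-! ### The contraction estimate -/

/-- Smallness of the perturbation `W` of the potential: of order `ε` on `[a, b]`, of order `ε²` and
exponentially decaying off `[a, b]`. -/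
structure DecayBound (a b : ℤ) (ε K : ℝ) (W : ℤ → ℂ) : Prop where
  inner : ∀ n ∈ Finset.Icc a b, ‖W n‖ ≤ K * ε
  outer : ∀ n ∉ Finset.Icc a b, ‖W n‖ ≤ K * ε ^ 2 * (1 / 2) ^ siteDist a b n

/-- Weighted bounds, improved by a factor `k` on the sites of `[a, b]`. -/
def CoreBound (a b : ℤ) (k s B : ℝ) (x : ℤ → ℂ) : Prop :=
  ∀ n, ‖x n‖ ≤ B * weight s n ∧ (n ∈ Finset.Icc a b → ‖x n‖ ≤ B * weight s n / k)

/-- One weight comes from the Green function bound at the source, the other from the growth allowed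
to the sequence; the exponential decay of the potential off the core absorbs both. -/
theorem summable_weight_sq_mul (a b : ℤ) :
    Summable fun m => weight 1 m ^ 2 * (1 / 2 : ℝ) ^ siteDist a b m := by
  have h1 : Summable fun m : ℤ => (1 + (m : ℝ) ^ 2) * (1 / 2 : ℝ) ^ m.natAbs := by
    have h2 : Summable fun n : ℕ => (1 + (n : ℝ) ^ 2) * (1 / 2 : ℝ) ^ n := by
      have e1 := summable_pow_mul_geometric_of_norm_lt_one (R := ℝ) 0 (r := 1 / 2) (by norm_num)
      have e2 := summable_pow_mul_geometric_of_norm_lt_one (R := ℝ) 2 (r := 1 / 2) (by norm_num)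
      refine (e1.add e2).congr fun n => ?_
      ring
    refine Summable.of_nat_of_neg ?_ ?_ <;> simpa using h2
  have h5 : ∀ c d : ℕ, (1 / 2 : ℝ) ^ d = 2 ^ c * (1 / 2 : ℝ) ^ (d + c) := fun c d => by
    rw [pow_add, mul_left_comm, ← mul_pow]; norm_num
  refine Summable.of_nonneg_of_le (fun m => by positivity) (fun m => ?_)
    (h1.mul_left (2 ^ (a.natAbs + b.natAbs)))
  rw [weight_one_sq, mul_left_comm, h5 (a.natAbs + b.natAbs)]
  gcongr _ * (_ * ?_)
  refine pow_le_pow_of_le_one (by norm_num) (by norm_num) ?_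
  unfold siteDist; omega

/-- The weight on the neighbours of a site which belong to `[a, b]`. -/
def coreWeight (a b n : ℤ) : ℝ :=
  (if n + 1 ∈ Finset.Icc a b then weight 1 (n + 1) else 0)
    + if n - 1 ∈ Finset.Icc a b then weight 1 (n - 1) else 0

theorem coreWeight_nonneg (a b n : ℤ) : 0 ≤ coreWeight a b n := by
  have h1 := (WSeq.weight_pos 1 (n + 1)).le
  have h2 := (WSeq.weight_pos 1 (n - 1)).le
  unfold coreWeight
  split_ifs <;> linarith

theorem summable_core_weight (a b : ℤ) : Summable fun m => weight 1 m * coreWeight a b m := by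
  refine summable_of_ne_finset_zero (s := Finset.Icc (a - 1) (b + 1)) fun m hm => ?_
  rw [Finset.mem_Icc] at hm
  have h1 : m + 1 ∉ Finset.Icc a b := by rw [Finset.mem_Icc]; omega
  have h2 : m - 1 ∉ Finset.Icc a b := by rw [Finset.mem_Icc]; omega
  rw [coreWeight, if_neg h1, if_neg h2, add_zero, mul_zero]

theorem weight_succ_le {s : ℝ} (h0 : 0 ≤ s) (h1 : s ≤ 1) (n : ℤ) :
    weight s (n + 1) ≤ 2 * weight s n ∧ weight s (n - 1) ≤ 2 * weight s n := by
  have key : ∀ m : ℤ, (m : ℝ) ^ 2 ≤ 3 * (n : ℝ) ^ 2 + 2 → weight s m ≤ 2 * weight s n := by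
    intro m hm
    unfold weight
    calc (1 + (m : ℝ) ^ 2) ^ (s / 2) ≤ (4 * (1 + (n : ℝ) ^ 2)) ^ (s / 2) := by
          gcongr; nlinarith [sq_nonneg (n : ℝ)]
      _ = 4 ^ (s / 2) * (1 + (n : ℝ) ^ 2) ^ (s / 2) :=
          Real.mul_rpow (by norm_num) (by positivity)
      _ ≤ 4 ^ (1 / 2 : ℝ) * (1 + (n : ℝ) ^ 2) ^ (s / 2) := by
          gcongr
          norm_num
      _ = _ := by
          congr 1
          rw [show (4 : ℝ) = 2 ^ (2 : ℝ) by norm_num, ← Real.rpow_mul (by norm_num)]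
          norm_num
  constructor <;> refine key _ ?_ <;> push_cast <;> nlinarith [sq_nonneg ((n : ℝ) - 1), sq_nonneg ((n : ℝ) + 1)]

theorem norm_lin_comb_le (p : ℕ) {x y : ℂ} {B : ℝ} (hx : ‖x‖ ≤ B) (hy : ‖y‖ ≤ B) :
    ‖(1 + p : ℂ) * x + p * y‖ ≤ (2 * p + 1) * B := by
  have e1 : ‖(1 + p : ℂ)‖ = 1 + p := by
    rw [show (1 + p : ℂ) = ((1 + p : ℕ) : ℂ) by push_cast; rfl, Complex.norm_natCast]
    push_cast; rfl
  calc _ ≤ ‖(1 + p : ℂ) * x‖ + ‖(p : ℂ) * y‖ := norm_add_le _ _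
    _ = (1 + p) * ‖x‖ + p * ‖y‖ := by rw [norm_mul, norm_mul, e1, Complex.norm_natCast]
    _ ≤ (1 + p) * B + p * B := by gcongr
    _ = _ := by ring

/-- This is the first row of -Ω⁻¹ - Ω⁻²M, the resolvent of a core matrix M with M² = 0. The bound is
uniform for |Ω| ≥ δ, large Ω included. -/
theorem norm_coefficient_le (p : ℕ) {Ω : ℂ} {δ : ℝ} (hδ : 0 < δ) (hΩ : δ ≤ ‖Ω‖) {f g : ℂ} {B : ℝ}
    (hf : ‖f‖ ≤ B) (hg : ‖g‖ ≤ B) :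
    ‖Ω⁻¹ ^ 2 * ((p - Ω) * f + p * g)‖ ≤ (2 * p * δ⁻¹ ^ 2 + δ⁻¹) * B := by
  have hB : 0 ≤ B := (norm_nonneg _).trans hf
  have hi : ‖Ω⁻¹‖ ≤ δ⁻¹ := by rw [norm_inv]; exact inv_anti₀ hδ hΩ
  have hΩ0 : ‖Ω‖ ≠ 0 := by linarith [hδ.trans_le hΩ] |> fun h : 0 < ‖Ω‖ => h.ne'
  have h1 : ‖(p - Ω) * f + p * g‖ ≤ (2 * p + ‖Ω‖) * B := by
    calc _ ≤ ‖(p - Ω) * f‖ + ‖(p : ℂ) * g‖ := norm_add_le _ _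
      _ ≤ (p + ‖Ω‖) * B + p * B := by
          rw [norm_mul, norm_mul, Complex.norm_natCast]
          have := norm_sub_le (p : ℂ) Ω
          rw [Complex.norm_natCast] at this
          gcongr
      _ = _ := by ring
  rw [norm_mul, norm_pow]
  calc ‖Ω⁻¹‖ ^ 2 * ‖(p - Ω) * f + p * g‖ ≤ ‖Ω⁻¹‖ ^ 2 * ((2 * p + ‖Ω‖) * B) := by gcongr
    _ = (2 * p * ‖Ω⁻¹‖ ^ 2 + ‖Ω⁻¹‖) * B := by
        rw [norm_inv]; field_simp
    _ ≤ _ := by gcongr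


section Contraction

variable {p : ℕ} {a b : ℤ} {ε K k s B : ℝ} {W : ℤ → ℂ} {x y : ℤ → ℂ}

theorem norm_pertFst_le (hε : 0 ≤ ε) {c w v : ℝ} {n : ℤ} (hc : ‖coupling a b x n‖ ≤ c)
    (hw : ‖W n‖ ≤ w) (hx : ‖x n‖ ≤ v) (hy : ‖y n‖ ≤ v) :
    ‖pertFst p a b ε W x y n‖ ≤ ε * c + w * ((2 * p + 1) * v) := by
  have h := norm_lin_comb_le p hx hy
  calc _ ≤ ‖-(ε * coupling a b x n)‖ + ‖W n * ((1 + p) * x n + p * y n)‖ := norm_sub_le _ _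
    _ = ε * ‖coupling a b x n‖ + ‖W n‖ * ‖(1 + p) * x n + p * y n‖ := by
        rw [norm_neg, norm_mul, norm_mul, Complex.norm_real, Real.norm_eq_abs, abs_of_nonneg hε]
    _ ≤ _ := add_le_add (mul_le_mul_of_nonneg_left hc hε)
        (mul_le_mul hw h (norm_nonneg _) ((norm_nonneg _).trans hw))

/-- Into the core everything carries a factor ε, with no gain from k: the neighbours read by the
coupling may lie outside. -/
theorem norm_pertFst_le_inner (hε : 0 ≤ ε) (hW : DecayBound a b ε K W) (hs0 : 0 ≤ s) (hs1 : s ≤ 1)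
    (hB : 0 ≤ B) (hx : CoreBound a b k s B x) (hy : CoreBound a b k s B y) {n : ℤ}
    (hn : n ∈ Finset.Icc a b) :
    ‖pertFst p a b ε W x y n‖ ≤ ε * (6 + K * (2 * p + 1)) * B * weight s n := by
  obtain ⟨w1, w2⟩ := weight_succ_le hs0 hs1 n
  have h1 : ‖coupling a b x n‖ ≤ 6 * B * weight s n := by
    rw [coupling, if_pos hn]
    have t1 := norm_add_le (x (n + 1) - 2 * x n) (x (n - 1))
    have t2 := norm_sub_le (x (n + 1)) (2 * x n)
    have t3 : ‖2 * x n‖ = 2 * ‖x n‖ := by rw [norm_mul]; norm_num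
    have t4 := (hx (n + 1)).1.trans (mul_le_mul_of_nonneg_left w1 hB)
    have t5 := (hx (n - 1)).1.trans (mul_le_mul_of_nonneg_left w2 hB)
    have t6 := (hx n).1
    linarith
  refine (norm_pertFst_le hε h1 (hW.inner n hn) (hx n).1 (hy n).1).trans_eq ?_
  ring

/-- Off the core the coupling reads only core values and so gains 1/k. That gain is essential, as
its ε will be cancelled by the ε⁻¹ of the free resolvent; the potential term has ε to spare. -/
theorem norm_pertFst_le_outer (hε : 0 ≤ ε) (hW : DecayBound a b ε K W) (hs1 : s ≤ 1)
    (hB : 0 ≤ B) (hk : 0 < k) (hx : CoreBound a b k s B x) (hy : CoreBound a b k s B y) {n : ℤ}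
    (hn : n ∉ Finset.Icc a b) :
    ‖pertFst p a b ε W x y n‖ ≤ ε * (B / k) * coreWeight a b n
      + (2 * p + 1) * K * ε ^ 2 * B * (weight 1 n * (1 / 2) ^ siteDist a b n) := by
  have hone : ∀ m, ‖if m ∈ Finset.Icc a b then x m else 0‖ ≤
      B / k * if m ∈ Finset.Icc a b then weight 1 m else 0 := by
    intro m
    split_ifs with hm
    · refine ((hx m).2 hm).trans ?_
      rw [mul_div_right_comm]
      exact mul_le_mul_of_nonneg_left (weight_mono m hs1) (div_nonneg hB hk.le)
    · simp
  have h1 : ‖coupling a b x n‖ ≤ B / k * coreWeight a b n := by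
    rw [coupling, if_neg hn, coreWeight, mul_add]
    exact (norm_add_le _ _).trans (add_le_add (hone _) (hone _))
  have hw := mul_le_mul_of_nonneg_left (weight_mono n hs1) hB
  refine (norm_pertFst_le hε h1 (hW.outer n hn) ((hx n).1.trans hw)
    ((hy n).1.trans hw)).trans_eq ?_
  ring

/-- Sources of the shape produced off the core are summable against one more weight, so the output
is bounded without weight; core sources are invisible to the Green function. -/
theorem norm_green_sum_le (hab : a ≤ b) {l : ℂ} (hl : ‖l‖ ≤ 1) {S Q u v : ℝ}
    (hS : HasSum (fun m => weight 1 m * coreWeight a b m) S)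
    (hQ : HasSum (fun m => weight 1 m ^ 2 * (1 / 2 : ℝ) ^ siteDist a b m) Q) {f : ℤ → ℂ}
    (hu : 0 ≤ u) (hv : 0 ≤ v)
    (hf : ∀ m ∉ Finset.Icc a b, ‖f m‖ ≤
      u * coreWeight a b m + v * (weight 1 m * (1 / 2) ^ siteDist a b m)) (n : ℤ) :
    ‖∑' m, green a b l n m * f m‖ ≤ distConst a b * (u * S + v * Q) := by
  refine tsum_of_norm_bounded (((hS.mul_left u).add (hQ.mul_left v)).mul_left _) fun m => ?_
  have hwm := (WSeq.weight_pos 1 m).le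
  have hc := zero_le_one.trans (one_le_distConst a b)
  have hnn := coreWeight_nonneg a b m
  by_cases hm : m ∈ Finset.Icc a b
  · rw [green_eq_zero_right l n hm, zero_mul, norm_zero]
    positivity
  · rw [norm_mul]
    calc _ ≤ (distConst a b * weight 1 m) *
        (u * coreWeight a b m + v * (weight 1 m * (1 / 2) ^ siteDist a b m)) :=
          mul_le_mul (norm_green_le hab hl n m) (hf m hm) (norm_nonneg _) (mul_nonneg hc hwm)
      _ = _ := by ring

end Contraction

/-- The perturbation of the decoupled linearization is a contraction in weighted spaces. -/
theorem exists_contraction (p : ℕ) {a b : ℤ} (hab : a ≤ b) {K δ : ℝ} (hK : 0 < K) (hδ : 0 < δ) :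
    ∃ k : ℝ, 1 ≤ k ∧ ∃ ε₀ : ℝ, 0 < ε₀ ∧ ∀ ε, 0 < ε → ε < ε₀ → ∀ W, DecayBound a b ε K W →
      ∀ Ω l : ℂ, δ ≤ ‖Ω‖ → ‖l‖ ≤ 1 → ∀ s B : ℝ, 0 ≤ s → s ≤ 1 → 0 ≤ B → ∀ x y : ℤ → ℂ,
      CoreBound a b k s B x → CoreBound a b k s B y →
      CoreBound a b k s (B / 2) (freeFst p a b ε Ω l (pertFst p a b ε W x y)
        fun m => -pertFst p a b ε W y x m) := by
  obtain ⟨c, hcd⟩ : ∃ c, c = distConst a b := ⟨_, rfl⟩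
  have hc : 1 ≤ c := hcd ▸ one_le_distConst a b
  obtain ⟨S, hSs⟩ := summable_core_weight a b
  obtain ⟨Q, hQs⟩ := summable_weight_sq_mul a b
  have hQ : 0 ≤ Q := hQs.nonneg fun m => by positivity
  have hS : 0 ≤ S := hSs.nonneg fun m =>
    mul_nonneg (WSeq.weight_pos _ _).le (coreWeight_nonneg _ _ _)
  obtain ⟨D, hD⟩ : ∃ D, D = 2 * p * δ⁻¹ ^ 2 + δ⁻¹ := ⟨_, rfl⟩
  -- Chosen so that the core-to-outside transfer cS/k is at most 1/4.
  obtain ⟨k, hkd⟩ : ∃ k, k = 1 + 4 * c * S := ⟨_, rfl⟩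
  obtain ⟨R, hR⟩ : ∃ R, R = 6 + K * (2 * p + 1) := ⟨_, rfl⟩
  obtain ⟨M, hM⟩ : ∃ M, M = c * (2 * p + 1) * K * Q := ⟨_, rfl⟩
  have hD0 : 0 ≤ D := by rw [hD]; positivity
  have hk : 1 ≤ k := by
    have : 0 ≤ 4 * c * S := by positivity
    rw [hkd]; linarith
  have hk0 : 0 < k := by linarith
  have hR0 : 0 ≤ R := by rw [hR]; positivity
  have hM0 : 0 ≤ M := by rw [hM]; positivity
  have hDRk : 0 ≤ D * R * k := by positivity
  -- With k fixed, the first bound makes the outside-to-core transfer DRε at most 1/(2k), and the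
  -- second makes the exterior potential contribute at most 1/4.
  refine ⟨k, hk, min (1 / (2 * (D * R * k + 1))) (1 / (4 * (M + 1))),
    lt_min (by positivity) (by positivity), ?_⟩
  intro ε hε hε0 W hW Ω l hΩ hl s B hs0 hs1 hB x y hx hy
  have hε1 : D * R * k * ε ≤ 1 / 2 := by
    have := hε0.le.trans (min_le_left _ _)
    rw [le_div_iff₀ (by positivity)] at this
    linarith
  have hε2 : M * ε ≤ 1 / 4 := by
    have := hε0.le.trans (min_le_right _ _)
    rw [le_div_iff₀ (by positivity)] at this
    linarith
  intro n
  have hw0 := (WSeq.weight_pos s n).le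
  have hcase : n ∈ Finset.Icc a b → ‖freeFst p a b ε Ω l (pertFst p a b ε W x y)
      (fun m => -pertFst p a b ε W y x m) n‖ ≤ B / 2 * weight s n / k := by
    intro hn
    rw [freeFst, green_sum_eq_zero hn, if_pos hn, mul_zero, zero_add]
    refine (norm_coefficient_le p hδ hΩ (norm_pertFst_le_inner hε.le hW hs0 hs1 hB hx hy hn)
      (by rw [norm_neg]; exact norm_pertFst_le_inner hε.le hW hs0 hs1 hB hy hx hn)).trans ?_
    rw [le_div_iff₀ hk0, ← hD, ← hR]
    calc _ = D * R * k * ε * (B * weight s n) := by ring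
      _ ≤ 1 / 2 * (B * weight s n) := mul_le_mul_of_nonneg_right hε1 (mul_nonneg hB hw0)
      _ = _ := by ring
  refine ⟨?_, hcase⟩
  by_cases hn : n ∈ Finset.Icc a b
  · exact (hcase hn).trans (div_le_self (mul_nonneg (by linarith) hw0) hk)
  rw [freeFst, if_neg hn, add_zero]
  have hsum := norm_green_sum_le hab hl hSs hQs (u := ε * (B / k))
    (v := (2 * p + 1) * K * ε ^ 2 * B) (by positivity) (by positivity)
    (fun m hm => norm_pertFst_le_outer (p := p) hε.le hW hs1 hB hk0 hx hy hm) n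
  have hSk : c * S / k ≤ 1 / 4 := by
    rw [div_le_iff₀ hk0, hkd]; linarith
  calc ‖(ε : ℂ)⁻¹ * ∑' m, green a b l n m * pertFst p a b ε W x y m‖
      = ε⁻¹ * ‖∑' m, green a b l n m * pertFst p a b ε W x y m‖ := by
        rw [norm_mul, norm_inv, Complex.norm_real, Real.norm_eq_abs, abs_of_pos hε]
    _ ≤ ε⁻¹ * (distConst a b * (ε * (B / k) * S + (2 * p + 1) * K * ε ^ 2 * B * Q)) :=
        mul_le_mul_of_nonneg_left hsum (inv_nonneg.2 hε.le)
    _ = (c * S / k + M * ε) * B := by rw [hM, ← hcd]; field_simp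
    _ ≤ (1 / 4 + 1 / 4) * B := mul_le_mul_of_nonneg_right (add_le_add hSk hε2) hB
    _ = B / 2 * 1 := by ring
    _ ≤ B / 2 * weight s n := mul_le_mul_of_nonneg_left (one_le_weight n hs0) (by linarith)

/-! ### The operator form of the integral equation -/

theorem norm_val_le (f : WSeq 1 1) (n : ℤ) : ‖f.val n‖ ≤ ‖f‖ := by
  have h := le_hasSum (hasSum_norm_wSeq f) n
    fun m _ => mul_nonneg (WSeq.weight_pos 1 m).le (norm_nonneg _)
  have := one_le_weight n zero_le_one
  nlinarith [norm_nonneg (f.val n)]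

section Pert

variable (p : ℕ) (a b : ℤ) (ε : ℝ) (W : ℤ → ℂ)

theorem pertFst_add (x y x' y' : ℤ → ℂ) (n : ℤ) :
    pertFst p a b ε W (x + x') (y + y') n = pertFst p a b ε W x y n + pertFst p a b ε W x' y' n := by
  simp only [pertFst, coupling, Pi.add_apply]
  split_ifs <;> ring

theorem pertFst_smul (c : ℂ) (x y : ℤ → ℂ) (n : ℤ) :
    pertFst p a b ε W (c • x) (c • y) n = c * pertFst p a b ε W x y n := by
  simp only [pertFst, coupling, Pi.smul_apply, smul_eq_mul]
  split_ifs <;> ring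

theorem norm_coupling_le {x : ℤ → ℂ} {B : ℝ} (hx : ∀ n, ‖x n‖ ≤ B) (n : ℤ) :
    ‖coupling a b x n‖ ≤ (if n ∈ Finset.Icc (a - 1) (b + 1) then 4 else 0) * B := by
  have hB : 0 ≤ B := (norm_nonneg _).trans (hx 0)
  have h1 : ∀ m, ‖if m ∈ Finset.Icc a b then x m else 0‖ ≤ B := fun m => by
    split_ifs
    · exact hx m
    · simpa using hB
  by_cases hn : n ∈ Finset.Icc a b
  · have h2 : n ∈ Finset.Icc (a - 1) (b + 1) := by
      rw [Finset.mem_Icc] at hn ⊢; omega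
    rw [coupling, if_pos hn, if_pos h2]
    have t1 := norm_add_le (x (n + 1) - 2 * x n) (x (n - 1))
    have t2 := norm_sub_le (x (n + 1)) (2 * x n)
    have t3 : ‖2 * x n‖ = 2 * ‖x n‖ := by rw [norm_mul]; norm_num
    linarith [hx (n + 1), hx (n - 1), hx n]
  · rw [coupling, if_neg hn]
    by_cases h2 : n ∈ Finset.Icc (a - 1) (b + 1)
    · rw [if_pos h2]
      refine (norm_add_le _ _).trans ?_
      linarith [h1 (n + 1), h1 (n - 1)]
    · rw [if_neg h2]
      rw [Finset.mem_Icc] at h2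
      have h3 : n + 1 ∉ Finset.Icc a b := by rw [Finset.mem_Icc]; omega
      have h4 : n - 1 ∉ Finset.Icc a b := by rw [Finset.mem_Icc]; omega
      rw [if_neg h3, if_neg h4]; simp

/-- The perturbation as a linear map into sequences. -/
def pertLin : (Seq ∞ × Seq ∞) →ₗ[ℂ] (ℤ → ℂ) where
  toFun u := pertFst p a b ε W u.1 u.2
  map_add' u v := funext fun n => pertFst_add p a b ε W u.1 u.2 v.1 v.2 n
  map_smul' c u := funext fun n => pertFst_smul p a b ε W c u.1 u.2 n

theorem norm_fst_apply_le (u : Seq ∞ × Seq ∞) (n : ℤ) : ‖u.1 n‖ ≤ ‖u‖ :=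
  (lp.norm_apply_le_norm (by simp) u.1 n).trans (norm_fst_le u)

theorem norm_snd_apply_le (u : Seq ∞ × Seq ∞) (n : ℤ) : ‖u.2 n‖ ≤ ‖u‖ :=
  (lp.norm_apply_le_norm (by simp) u.2 n).trans (norm_snd_le u)

variable {W} in
/-- The first component of the perturbation as an operator into `l¹₁`. -/
def pertOpFst (hW : Summable fun m => weight 1 m * ‖W m‖) : (Seq ∞ × Seq ∞) →L[ℂ] WSeq 1 1 :=
  decayOp (pertLin p a b ε W)
    (fun n => |ε| * (if n ∈ Finset.Icc (a - 1) (b + 1) then 4 else 0) + ‖W n‖ * (2 * p + 1))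
    (by
      have h1 : Summable fun m : ℤ =>
          weight 1 m * (|ε| * (if m ∈ Finset.Icc (a - 1) (b + 1) then 4 else 0)) :=
        summable_of_ne_finset_zero (s := Finset.Icc (a - 1) (b + 1)) fun m hm => by
          rw [if_neg hm, mul_zero, mul_zero]
      refine (h1.add (hW.mul_right (2 * (p : ℝ) + 1))).congr fun m => ?_
      ring)
    (fun u n => by
      have h2 := norm_lin_comb_le p (norm_fst_apply_le u n) (norm_snd_apply_le u n)
      have h3 := norm_coupling_le a b (norm_fst_apply_le u) n
      calc ‖pertFst p a b ε W u.1 u.2 n‖ ≤ ‖-(ε * coupling a b u.1 n)‖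
            + ‖W n * ((1 + p) * u.1 n + p * u.2 n)‖ := norm_sub_le _ _
        _ = |ε| * ‖coupling a b u.1 n‖ + ‖W n‖ * ‖(1 + p) * u.1 n + p * u.2 n‖ := by
            rw [norm_neg, norm_mul, norm_mul, Complex.norm_real, Real.norm_eq_abs]
        _ ≤ _ := add_le_add (mul_le_mul_of_nonneg_left h3 (abs_nonneg _))
            (mul_le_mul_of_nonneg_left h2 (norm_nonneg _))
        _ = _ := by ring)

variable {W} in
/-- The perturbation of the decoupled linearization. -/
def pertOp (hW : Summable fun m => weight 1 m * ‖W m‖) :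
    (Seq ∞ × Seq ∞) →L[ℂ] (WSeq 1 1 × WSeq 1 1) :=
  (pertOpFst p a b ε hW).prod (-((pertOpFst p a b ε hW).comp
    ((ContinuousLinearMap.snd ℂ _ _).prod (ContinuousLinearMap.fst ℂ _ _))))

variable {W}

theorem pertOp_fst (hW : Summable fun m => weight 1 m * ‖W m‖) (u : Seq ∞ × Seq ∞) (n : ℤ) :
    (pertOp p a b ε hW u).1.val n = pertFst p a b ε W u.1 u.2 n := rfl

theorem pertOp_snd (hW : Summable fun m => weight 1 m * ‖W m‖) (u : Seq ∞ × Seq ∞) (n : ℤ) :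
    (pertOp p a b ε hW u).2.val n = -pertFst p a b ε W u.2 u.1 n := rfl

end Pert

section Free

variable (p : ℕ) {a b : ℤ} (ε : ℝ) {Ω l : ℂ} {f g f' g' : ℤ → ℂ}

theorem freeFst_sub (n : ℤ) (hf : Summable fun m => green a b l n m * f m)
    (hf' : Summable fun m => green a b l n m * f' m) :
    freeFst p a b ε Ω l (fun m => f m - f' m) (fun m => g m - g' m) n =
      freeFst p a b ε Ω l f g n - freeFst p a b ε Ω l f' g' n := by
  simp only [freeFst, mul_sub, hf.tsum_sub hf']
  split_ifs <;> ring

theorem freeFst_add (n : ℤ) (hf : Summable fun m => green a b l n m * f m)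
    (hf' : Summable fun m => green a b l n m * f' m) :
    freeFst p a b ε Ω l (fun m => f m + f' m) (fun m => g m + g' m) n =
      freeFst p a b ε Ω l f g n + freeFst p a b ε Ω l f' g' n := by
  simp only [freeFst, mul_add, hf.tsum_add hf']
  split_ifs <;> ring

theorem freeFst_smul (c : ℂ) (n : ℤ) :
    freeFst p a b ε Ω l (fun m => c * f m) (fun m => c * g m) n =
      c * freeFst p a b ε Ω l f g n := by
  have : ∑' m, green a b l n m * (c * f m) = c * ∑' m, green a b l n m * f m := by
    rw [← tsum_mul_left]; exact tsum_congr fun m => by ring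
  simp only [freeFst, this]
  split_ifs <;> ring

theorem freeFst_neg (n : ℤ) : freeFst p a b ε Ω l (fun m => -f m) (fun m => -g m) n =
    -freeFst p a b ε Ω l f g n := by
  simpa using freeFst_smul p ε (f := f) (g := g) (-1) n

theorem summable_green_wSeq (hab : a ≤ b) (hl : ‖l‖ ≤ 1) (f : WSeq 1 1) (n : ℤ) :
    Summable fun m => green a b l n m * f.val m :=
  summable_kernel_mul (fun m => norm_green_le hab hl n m) f

theorem norm_freeFst_le (hab : a ≤ b) {δ : ℝ} (hδ : 0 < δ) (hΩ : δ ≤ ‖Ω‖) (hl : ‖l‖ ≤ 1)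
    (F : WSeq 1 1 × WSeq 1 1) (n : ℤ) : ‖freeFst p a b ε Ω l F.1.val F.2.val n‖ ≤
      (|ε|⁻¹ * distConst a b + (2 * p * δ⁻¹ ^ 2 + δ⁻¹)) * ‖F‖ := by
  have h1 := norm_tsum_kernel_le (fun m => norm_green_le hab hl n m) F.1
  have h2 : ‖F.1‖ ≤ ‖F‖ := norm_fst_le F
  have h3 : ‖F.2‖ ≤ ‖F‖ := norm_snd_le F
  have hc := zero_le_one.trans (one_le_distConst a b)
  rw [add_mul]
  refine (norm_add_le _ _).trans (add_le_add ?_ ?_)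
  · rw [norm_mul, norm_inv, Complex.norm_real, Real.norm_eq_abs, mul_assoc]
    exact mul_le_mul_of_nonneg_left (h1.trans (mul_le_mul_of_nonneg_left h2 hc)) (by positivity)
  · split_ifs
    · exact norm_coefficient_le p hδ hΩ ((norm_val_le _ n).trans h2) ((norm_val_le _ n).trans h3)
    · rw [norm_zero]; positivity

/-- The first component of the resolvent of the decoupled linearization, as an operator. -/
def freeOpFst (hab : a ≤ b) {δ : ℝ} (hδ : 0 < δ) (hΩ : δ ≤ ‖Ω‖) (hl : ‖l‖ ≤ 1) :
    (WSeq 1 1 × WSeq 1 1) →L[ℂ] Seq ∞ :=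
  LinearMap.mkContinuous
    { toFun := fun F => ⟨freeFst p a b ε Ω l F.1.val F.2.val, memℓp_infty
        ⟨_, by rintro _ ⟨n, rfl⟩; exact norm_freeFst_le p ε hab hδ hΩ hl F n⟩⟩
      map_add' := fun F G => by
        ext n
        exact freeFst_add p ε n (summable_green_wSeq hab hl F.1 n) (summable_green_wSeq hab hl G.1 n)
      map_smul' := fun c F => by
        ext n
        exact freeFst_smul p ε c n }
    (|ε|⁻¹ * distConst a b + (2 * p * δ⁻¹ ^ 2 + δ⁻¹))
    fun F => lp.norm_le_of_forall_le' _ fun n => norm_freeFst_le p ε hab hδ hΩ hl F n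

end Free

/-- The spectral parameters of the two components of the decoupled linearization. -/
structure SpectralParam (ε : ℝ) (Ω : ℂ) where
  fst : ℂ
  snd : ℂ
  norm_fst_le : ‖fst‖ ≤ 1
  norm_snd_le : ‖snd‖ ≤ 1
  fst_eq : ε * (1 + fst ^ 2) = (2 * ε + 1 - Ω) * fst
  snd_eq : ε * (1 + snd ^ 2) = (2 * ε + 1 - -Ω) * snd

section Free

variable (p : ℕ) {a b : ℤ} {ε : ℝ} {Ω : ℂ} (hab : a ≤ b) {δ : ℝ} (hδ : 0 < δ) (hΩ : δ ≤ ‖Ω‖)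
  (P : SpectralParam ε Ω)

/-- The resolvent of the decoupled linearization. -/
def freeOp : (WSeq 1 1 × WSeq 1 1) →L[ℂ] (Seq ∞ × Seq ∞) :=
  (freeOpFst p ε hab hδ hΩ P.norm_fst_le).prod
    (-((freeOpFst p ε hab hδ (hΩ.trans_eq (norm_neg Ω).symm) P.norm_snd_le).comp
    ((ContinuousLinearMap.snd ℂ _ _).prod (ContinuousLinearMap.fst ℂ _ _))))

theorem freeOp_fst (F : WSeq 1 1 × WSeq 1 1) (n : ℤ) :
    (freeOp p hab hδ hΩ P F).1 n = freeFst p a b ε Ω P.fst F.1.val F.2.val n := rfl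

theorem freeOp_snd (F : WSeq 1 1 × WSeq 1 1) (n : ℤ) :
    (freeOp p hab hδ hΩ P F).2 n = -freeFst p a b ε (-Ω) P.snd F.2.val F.1.val n := rfl

theorem norm_freeOp_apply_le (F : WSeq 1 1 × WSeq 1 1) : ‖freeOp p hab hδ hΩ P F‖ ≤
    (|ε|⁻¹ * distConst a b + (2 * p * δ⁻¹ ^ 2 + δ⁻¹)) * ‖F‖ := by
  refine norm_prod_le_iff.2 ⟨lp.norm_le_of_forall_le' _ fun n => ?_,
    lp.norm_le_of_forall_le' _ fun n => ?_⟩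
  · exact norm_freeFst_le p ε hab hδ hΩ P.norm_fst_le F n
  · rw [freeOp_snd, norm_neg]
    refine (norm_freeFst_le p ε hab hδ (hΩ.trans_eq (norm_neg Ω).symm) P.norm_snd_le
      (F.2, F.1) n).trans_eq ?_
    rw [Prod.norm_mk, max_comm]; rfl

end Free

/-! ### Solvability from the contraction estimate -/

/-- Weighted bounds for both components. -/
def PairBound (a b : ℤ) (k s B : ℝ) (u : Seq ∞ × Seq ∞) : Prop :=
  CoreBound a b k s B u.1 ∧ CoreBound a b k s B u.2

theorem coreBound_of_le {a b : ℤ} {k s B : ℝ} (hk : 1 ≤ k) (hB : 0 ≤ B) {x : ℤ → ℂ}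
    (hx : ∀ n, ‖x n‖ ≤ B * weight s n) : CoreBound a b k s (k * B) x := by
  intro n
  have hw := (WSeq.weight_pos s n).le
  refine ⟨(hx n).trans ?_, fun _ => (hx n).trans_eq ?_⟩
  · rw [mul_assoc]
    exact le_mul_of_one_le_left (by positivity) hk
  · field_simp

theorem pairBound_of_norm_le {a b : ℤ} {k s B : ℝ} (hk : 1 ≤ k) (hs : 0 ≤ s) {u : Seq ∞ × Seq ∞}
    (hu : ‖u‖ ≤ B) : PairBound a b k s (k * B) u := by
  have hB : 0 ≤ B := (norm_nonneg _).trans hu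
  have key : ∀ x : ℤ → ℂ, (∀ n, ‖x n‖ ≤ B) → CoreBound a b k s (k * B) x := fun x hx =>
    coreBound_of_le hk hB fun n => (hx n).trans (le_mul_of_one_le_right hB (one_le_weight n hs))
  exact ⟨key _ fun n => (norm_fst_apply_le u n).trans hu,
    key _ fun n => (norm_snd_apply_le u n).trans hu⟩

theorem norm_le_of_pairBound {a b : ℤ} {k B : ℝ} {u : Seq ∞ × Seq ∞}
    (hu : PairBound a b k 0 B u) : ‖u‖ ≤ B := by
  have key : ∀ x : Seq ∞, CoreBound a b k 0 B x → ‖x‖ ≤ B := fun x hx =>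
    lp.norm_le_of_forall_le' _ fun n => by simpa [weight] using (hx n).1
  exact norm_prod_le_iff.2 ⟨key _ hu.1, key _ hu.2⟩

/-- Contraction in weighted spaces. -/
def IsContraction (a b : ℤ) (k : ℝ) (A : (Seq ∞ × Seq ∞) →L[ℂ] (Seq ∞ × Seq ∞)) : Prop :=
  ∀ s B : ℝ, 0 ≤ s → s ≤ 1 → 0 ≤ B → ∀ u, PairBound a b k s B u → PairBound a b k s (B / 2) (A u)

theorem norm_neg_pow {R : Type*} [NormedRing R] (x : R) (j : ℕ) : ‖(-x) ^ j‖ = ‖x ^ j‖ := by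
  rcases Nat.even_or_odd j with h | h
  · rw [h.neg_pow]
  · rw [h.neg_pow, norm_neg]

namespace IsContraction

variable {a b : ℤ} {k : ℝ} {A : (Seq ∞ × Seq ∞) →L[ℂ] (Seq ∞ × Seq ∞)}

/-- A contracts only in a norm equivalent to the sup norm with constant k, so ‖A^j‖ ≤ k 2^{-j}. Some
power has norm below 1, and 1 + A is a commuting factor of the invertible 1 - (-A)^j. -/
theorem isUnit (hA : IsContraction a b k A) (hk : 1 ≤ k) : IsUnit (1 + A) := by
  have h1 : ∀ j u, PairBound a b k 0 (k * ‖u‖ * (1 / 2) ^ j) ((A ^ j) u) := by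
    intro j u
    induction j with
    | zero => simpa using pairBound_of_norm_le hk le_rfl le_rfl
    | succ j ih =>
      have h := hA 0 _ le_rfl zero_le_one (by positivity) _ ih
      rw [pow_succ' A, pow_succ, ← mul_assoc, mul_one_div]
      exact h
  obtain ⟨j, hj⟩ := exists_pow_lt_of_lt_one (show 0 < 1 / k by positivity)
    (show (1 / 2 : ℝ) < 1 by norm_num)
  have h2 : ‖(-A) ^ j‖ < 1 := by
    have h3 : ‖A ^ j‖ ≤ k * (1 / 2) ^ j := ContinuousLinearMap.opNorm_le_bound _ (by positivity)
      fun u => (norm_le_of_pairBound (h1 j u)).trans_eq (by ring)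
    have h4 : ‖(-A) ^ j‖ = ‖A ^ j‖ := norm_neg_pow A j
    rw [h4]
    refine h3.trans_lt ?_
    rwa [lt_div_iff₀ (by positivity), mul_comm] at hj
  have h5 := isUnit_one_sub_of_norm_lt_one h2
  rw [← mul_neg_geom_sum, sub_neg_eq_add] at h5
  have hc : Commute (1 + A) (∑ i ∈ Finset.range j, (-A) ^ i) := by
    refine Commute.sum_right _ _ _ fun i _ => ?_
    exact ((Commute.one_left _).add_left (((Commute.refl A).neg_right).pow_right i))
  exact (hc.isUnit_mul_iff.1 h5).1

/-- The a priori estimate for `d + A d = v`. -/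
theorem pairBound (hA : IsContraction a b k A) (hk : 1 ≤ k) {s X : ℝ} (hs0 : 0 ≤ s) (hs1 : s ≤ 1)
    (hX : 0 ≤ X) {d v : Seq ∞ × Seq ∞} (hd : d + A d = v) (hv : PairBound a b k s X v) :
    PairBound a b k s (2 * X) d := by
  -- Boundedness of d gives a crude weighted bound since weights are at least 1. Each substitution
  -- into d = v - A d halves the excess over 2X.
  have h1 : ∀ j : ℕ, PairBound a b k s (2 * X + k * ‖d‖ * (1 / 2) ^ j) d := by
    intro j
    induction j with
    | zero =>
      have h := pairBound_of_norm_le (a := a) (b := b) (s := s) hk hs0 (le_refl ‖d‖)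
      have hmono : ∀ x : ℤ → ℂ, CoreBound a b k s (k * ‖d‖) x →
          CoreBound a b k s (2 * X + k * ‖d‖ * (1 / 2) ^ 0) x := by
        intro x hx n
        have hw := (WSeq.weight_pos s n).le
        have h2 : k * ‖d‖ * weight s n ≤ (2 * X + k * ‖d‖ * (1 / 2) ^ 0) * weight s n :=
          mul_le_mul_of_nonneg_right (by simpa using hX) hw
        exact ⟨(hx n).1.trans h2, fun hn => ((hx n).2 hn).trans (by gcongr)⟩
      exact ⟨hmono _ h.1, hmono _ h.2⟩
    | succ j ih =>
      have h := hA s _ hs0 hs1 (by positivity) _ ih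
      have key : ∀ x y z : ℤ → ℂ, (∀ n, x n + y n = z n) → CoreBound a b k s X z →
          CoreBound a b k s ((2 * X + k * ‖d‖ * (1 / 2) ^ j) / 2) y →
          CoreBound a b k s (2 * X + k * ‖d‖ * (1 / 2) ^ (j + 1)) x := by
        intro x y z hxyz hz hy n
        have h0 : ‖x n‖ ≤ ‖z n‖ + ‖y n‖ := by
          rw [← hxyz n]
          simpa using norm_sub_le (x n + y n) (y n)
        refine ⟨h0.trans ((add_le_add (hz n).1 (hy n).1).trans_eq ?_), fun hn =>
          h0.trans ((add_le_add ((hz n).2 hn) ((hy n).2 hn)).trans_eq ?_)⟩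
        · ring
        · ring
      refine ⟨key d.1 (A d).1 v.1 (fun n => ?_) hv.1 h.1, key d.2 (A d).2 v.2 (fun n => ?_) hv.2 h.2⟩
      · rw [← hd]; rfl
      · rw [← hd]; rfl
  have hlim : Tendsto (fun j : ℕ => 2 * X + k * ‖d‖ * (1 / 2) ^ j) atTop (𝓝 (2 * X)) := by
    simpa using (tendsto_pow_atTop_nhds_zero_of_lt_one (r := (1 / 2 : ℝ)) (by norm_num)
      (by norm_num)).const_mul (k * ‖d‖) |>.const_add (2 * X)
  have key : ∀ x : ℤ → ℂ, (∀ j : ℕ, CoreBound a b k s (2 * X + k * ‖d‖ * (1 / 2) ^ j) x) →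
      CoreBound a b k s (2 * X) x := fun x hx n =>
    ⟨ge_of_tendsto' (hlim.mul_const _) fun j => (hx j n).1, fun hn =>
      ge_of_tendsto' ((hlim.mul_const _).div_const _) fun j => (hx j n).2 hn⟩
  exact ⟨key _ fun j => (h1 j).1, key _ fun j => (h1 j).2⟩

theorem norm_le (hA : IsContraction a b k A) (hk : 1 ≤ k) {d v : Seq ∞ × Seq ∞}
    (hd : d + A d = v) : ‖d‖ ≤ 2 * k * ‖v‖ := by
  have h := hA.pairBound hk le_rfl zero_le_one (X := k * ‖v‖) (by positivity) hd
    (pairBound_of_norm_le hk le_rfl le_rfl)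
  exact (norm_le_of_pairBound h).trans_eq (by ring)

end IsContraction

theorem DecayBound.summable {a b : ℤ} {ε K : ℝ} {W : ℤ → ℂ} (hW : DecayBound a b ε K W)  :
    Summable fun m => weight 1 m * ‖W m‖ := by
  have h1 : Summable fun m : ℤ => if m ∈ Finset.Icc a b then weight 1 m * ‖W m‖ else 0 :=
    summable_of_ne_finset_zero (s := Finset.Icc a b) fun m hm => if_neg hm
  refine Summable.of_nonneg_of_le
    (fun m => mul_nonneg (WSeq.weight_pos 1 m).le (norm_nonneg _)) (fun m => ?_)
    (h1.add (((summable_weight_sq_mul a b).mul_left (|K| * ε ^ 2))))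
  have hw := one_le_weight m zero_le_one
  by_cases hm : m ∈ Finset.Icc a b
  · rw [if_pos hm]
    exact le_add_of_nonneg_right (by positivity)
  · rw [if_neg hm, zero_add]
    have h2 := hW.outer m hm
    have h3 : K * ε ^ 2 * (1 / 2) ^ siteDist a b m ≤ |K| * ε ^ 2 * (1 / 2) ^ siteDist a b m := by
      gcongr; exact le_abs_self K
    calc weight 1 m * ‖W m‖ ≤ weight 1 m ^ 2 * (|K| * ε ^ 2 * (1 / 2) ^ siteDist a b m) := by
          refine mul_le_mul ?_ (h2.trans h3) (norm_nonneg _) (by positivity)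
          nlinarith
      _ = _ := by ring

/-- The composition of the perturbation with the resolvent of the decoupled linearization is a
contraction. -/
theorem exists_isContraction (p : ℕ) {a b : ℤ} (hab : a ≤ b) {K δ : ℝ} (hK : 0 < K) (hδ : 0 < δ) :
    ∃ k : ℝ, 1 ≤ k ∧ ∃ ε₀ : ℝ, 0 < ε₀ ∧ ∀ ε, 0 < ε → ε < ε₀ → ∀ W (hW : DecayBound a b ε K W)
      (Ω : ℂ) (hΩ : δ ≤ ‖Ω‖) (P : SpectralParam ε Ω), IsContraction a b k
        ((freeOp p hab hδ hΩ P).comp (pertOp p a b ε hW.summable)) := by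
  obtain ⟨k, hk, ε₀, hε₀, h⟩ := exists_contraction p hab hK hδ
  refine ⟨k, hk, ε₀, hε₀, fun ε hε hε1 W hW Ω hΩ P s B hs0 hs1 hB u hu => ⟨?_, ?_⟩⟩
  · exact h ε hε hε1 W hW Ω P.fst hΩ P.norm_fst_le s B hs0 hs1 hB _ _ hu.1 hu.2
  -- The second row becomes the first under exchanging components, Ω ↦ -Ω and a change of sign.
  · have h2 := h ε hε hε1 W hW (-Ω) P.snd (hΩ.trans_eq (norm_neg Ω).symm) P.norm_snd_le s B hs0 hs1
      hB _ _ hu.2 hu.1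
    have h3 : ∀ n, ((freeOp p hab hδ hΩ P).comp (pertOp p a b ε hW.summable) u).2 n =
        freeFst p a b ε (-Ω) P.snd (pertFst p a b ε W u.2 u.1)
          (fun m => -pertFst p a b ε W u.1 u.2 m) n := by
      intro n
      rw [ContinuousLinearMap.comp_apply, freeOp_snd, ← freeFst_neg]
      simp only [pertOp_fst, pertOp_snd, neg_neg]
    intro n
    rw [h3]
    exact h2 n

/-! ### The resolvent off the bands -/

/-- The deviation of the potential from its limit `1_{[a,b]}`. -/
def potentialDev (p : ℕ) (a b : ℤ) (φ : RealSeq) (n : ℤ) : ℂ :=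
  (φ n : ℂ) ^ (2 * p) - if n ∈ Finset.Icc a b then 1 else 0

theorem shifted_fst (p : ℕ) (a b : ℤ) (ε : ℝ) (φ : RealSeq) (Ω : ℂ) (u : Seq 2 × Seq 2) (n : ℤ) :
    (shifted (linearization p ε φ) Ω u).1 n =
      linFst p a b ε (potentialDev p a b φ) u.1 u.2 n - Ω * u.1 n := by
  change (linearization p ε φ (u.1, u.2)).1 n - Ω * u.1 n = _
  rw [linearization_fst, linFst, potentialDev]
  ring

theorem shifted_snd (p : ℕ) (a b : ℤ) (ε : ℝ) (φ : RealSeq) (Ω : ℂ) (u : Seq 2 × Seq 2) (n : ℤ) :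
    (shifted (linearization p ε φ) Ω u).2 n =
      -linFst p a b ε (potentialDev p a b φ) u.2 u.1 n - Ω * u.2 n := by
  change (linearization p ε φ (u.1, u.2)).2 n - Ω * u.2 n = _
  rw [linearization_snd, linFst, potentialDev]
  ring

/-- The inclusion `l² ⊆ l^∞`. -/
def toInfty (x : Seq 2) : Seq ∞ := ⟨x, (lp.memℓp x).of_exponent_ge le_top⟩

theorem coe_mk {q : ℝ≥0∞} (x : ℤ → ℂ) (hx : Memℓp x q) : ⇑(⟨x, hx⟩ : Seq q) = x := rfl

theorem coe_toInfty (x : Seq 2) : ⇑(toInfty x) = ⇑x := coe_mk _ _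

theorem incl_fst_apply (F : WSeq 1 1 × WSeq 1 1) (n : ℤ) : (incl F).1 n = F.1.val n := rfl

theorem incl_snd_apply (F : WSeq 1 1 × WSeq 1 1) (n : ℤ) : (incl F).2 n = F.2.val n := rfl

theorem pair_add_eq_iff {u v w : Seq ∞ × Seq ∞} :
    u + v = w ↔ (∀ n, u.1 n + v.1 n = w.1 n) ∧ ∀ n, u.2 n + v.2 n = w.2 n :=
  ⟨fun h => h ▸ ⟨fun _ => rfl, fun _ => rfl⟩,
    fun h => Prod.ext (lp.ext (funext h.1)) (lp.ext (funext h.2))⟩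

section Resolvent

variable {p : ℕ} {a b : ℤ} {ε : ℝ} {Ω : ℂ} (hab : a ≤ b) {δ : ℝ} (hδ : 0 < δ) (hΩ : δ ≤ ‖Ω‖)
  (P : SpectralParam ε Ω) {φ : RealSeq}
  (hW : Summable fun m => weight 1 m * ‖potentialDev p a b φ m‖)

theorem ne_zero_of_le_norm (hδ : 0 < δ) (hΩ : δ ≤ ‖Ω‖) : Ω ≠ 0 :=
  norm_pos_iff.1 (hδ.trans_le hΩ)

/-- Bounded solutions of the resolvent equation solve the integral equation. -/
theorem add_freeOp_pertOp {W : ℤ → ℂ} (hW : Summable fun m => weight 1 m * ‖W m‖) (hε : ε ≠ 0)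
    (h1 : ‖P.fst‖ < 1) (h2 : ‖P.snd‖ < 1) {v : Seq ∞ × Seq ∞} {F : WSeq 1 1 × WSeq 1 1}
    (e1 : ∀ n, linFst p a b ε W v.1 v.2 n - Ω * v.1 n = F.1.val n)
    (e2 : ∀ n, -linFst p a b ε W v.2 v.1 n - Ω * v.2 n = F.2.val n) :
    v + (freeOp p hab hδ hΩ P).comp (pertOp p a b ε hW) v = freeOp p hab hδ hΩ P F := by
  have hΩ0 := ne_zero_of_le_norm hδ hΩ
  rw [ContinuousLinearMap.comp_apply]
  refine pair_add_eq_iff.2 ⟨fun n => ?_, fun n => ?_⟩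
  · have e3 := eq_freeFst_of_lin hab hε hΩ0 h1 P.fst_eq (norm_fst_apply_le v) e1 e2 n
    have e4 : v.1 n = freeFst p a b ε Ω P.fst
        (fun m => F.1.val m - (pertOp p a b ε hW v).1.val m)
        (fun m => F.2.val m - (pertOp p a b ε hW v).2.val m) n := by
      simp only [pertOp_fst, pertOp_snd, sub_neg_eq_add]
      exact e3
    rw [freeOp_fst, freeOp_fst, e4,
      freeFst_sub p ε n (summable_green_wSeq hab P.norm_fst_le _ n)
        (summable_green_wSeq hab P.norm_fst_le _ n)]
    ring
  · have e3 := eq_freeFst_of_lin hab hε (neg_ne_zero.2 hΩ0) h2 P.snd_eq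
      (f := fun m => -F.2.val m) (g := fun m => -F.1.val m) (norm_snd_apply_le v)
      (fun n => by rw [← e2 n]; ring) (fun n => by rw [← e1 n]; ring) n
    have e4 : v.2 n = -freeFst p a b ε (-Ω) P.snd
        (fun m => F.2.val m - (pertOp p a b ε hW v).2.val m)
        (fun m => F.1.val m - (pertOp p a b ε hW v).1.val m) n := by
      simp only [pertOp_fst, pertOp_snd, sub_neg_eq_add]
      rw [← freeFst_neg]
      simp only [neg_add, neg_sub]
      simp only [sub_eq_add_neg, add_comm] at e3 ⊢
      exact e3
    rw [freeOp_snd, freeOp_snd, e4, freeFst_sub p ε n (summable_green_wSeq hab P.norm_snd_le _ n)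
        (summable_green_wSeq hab P.norm_snd_le _ n)]
    ring

/-- Solutions in `l²` of the resolvent equation solve the integral equation. -/
theorem add_freeOp_pertOp_of_shifted (hε : ε ≠ 0) (h1 : ‖P.fst‖ < 1) (h2 : ‖P.snd‖ < 1)
    {u : Seq 2 × Seq 2} {F : WSeq 1 1 × WSeq 1 1}
    (hu : shifted (linearization p ε φ) Ω u = incl F) :
    (toInfty u.1, toInfty u.2) + (freeOp p hab hδ hΩ P).comp (pertOp p a b ε hW)
      (toInfty u.1, toInfty u.2) = freeOp p hab hδ hΩ P F := by
  refine add_freeOp_pertOp hab hδ hΩ P hW hε h1 h2 (fun n => ?_) fun n => ?_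
  · rw [coe_toInfty, coe_toInfty, ← shifted_fst, hu, incl_fst_apply]
  · rw [coe_toInfty, coe_toInfty, ← shifted_snd, hu, incl_snd_apply]

theorem memℓp_freeFst {l : ℂ} (hab : a ≤ b) (hl : ‖l‖ < 1) (f : Seq 2) (g : ℤ → ℂ) :
    Memℓp (freeFst p a b ε Ω l f g) 2 := by
  have h1 := (memℓp_green hab hl f).const_smul (ε : ℂ)⁻¹
  have h2 : Memℓp (fun n => if n ∈ Finset.Icc a b then Ω⁻¹ ^ 2 * ((p - Ω) * f n + p * g n) else 0)
      2 := by
    refine memℓp_gen (summable_of_ne_finset_zero (s := Finset.Icc a b) fun n hn => ?_)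
    rw [if_neg hn]; simp
  exact h1.add h2

/-- The resolvent equation is solvable in `l²`. -/
theorem surjective_shifted (hε : ε ≠ 0) (h1 : ‖P.fst‖ < 1) (h2 : ‖P.snd‖ < 1)
    (hA : IsUnit (1 + (freeOp p hab hδ hΩ P).comp (pertOp p a b ε hW))) :
    Function.Surjective (shifted (linearization p ε φ) Ω) := by
  intro F
  have hΩ0 := ne_zero_of_le_norm hδ hΩ
  set W := potentialDev p a b φ
  let v : Seq ∞ × Seq ∞ := (toInfty ⟨_, memℓp_freeFst (p := p) (ε := ε) (Ω := Ω) hab h1 F.1 F.2⟩,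
    -toInfty ⟨_, memℓp_freeFst (p := p) (ε := ε) (Ω := -Ω) hab h2 F.2 F.1⟩)
  obtain ⟨w, hw⟩ := (ContinuousLinearMap.isUnit_iff_bijective.1 hA).2 v
  rw [add_apply, one_apply_eq_self, ContinuousLinearMap.comp_apply,
    pair_add_eq_iff] at hw
  obtain ⟨hw1, hw2⟩ := hw
  simp only [freeOp_fst] at hw1
  simp only [freeOp_snd] at hw2
  set G := pertOp p a b ε hW w with hG
  -- Bootstrap from l^∞ to l²: w is the free resolvent applied to F minus the perturbation of w.
  -- That perturbation lies in l¹₁ ⊆ l², and for |l| < 1 the free resolvent preserves l².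
  let F' : Seq 2 × Seq 2 := F - incl G
  have s1 : ∀ n, w.1 n = freeFst p a b ε Ω P.fst F'.1 F'.2 n := by
    intro n
    have e : w.1 n + freeFst p a b ε Ω P.fst G.1.val G.2.val n =
        freeFst p a b ε Ω P.fst F.1 F.2 n := hw1 n
    rw [eq_sub_iff_add_eq.2 e, ← freeFst_sub p ε n (summable_green_mul hab h1 F.1 n)
      (summable_green_wSeq hab P.norm_fst_le _ n)]
    rfl
  have s2 : ∀ n, w.2 n = -freeFst p a b ε (-Ω) P.snd F'.2 F'.1 n := by
    intro n
    have e : w.2 n + -freeFst p a b ε (-Ω) P.snd G.2.val G.1.val n =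
        -freeFst p a b ε (-Ω) P.snd F.2 F.1 n := hw2 n
    have e' : w.2 n = -(freeFst p a b ε (-Ω) P.snd F.2 F.1 n -
        freeFst p a b ε (-Ω) P.snd G.2.val G.1.val n) := by linear_combination e
    rw [e', ← freeFst_sub p ε n (summable_green_mul hab h2 F.2 n)
      (summable_green_wSeq hab P.norm_snd_le _ n)]
    rfl
  have s2' : ∀ n, w.2 n = freeFst p a b ε (-Ω) P.snd (-F'.2) (-F'.1) n := by
    intro n
    rw [s2, ← freeFst_neg]; rfl
  obtain ⟨u₁, hu₁⟩ : ∃ u₁ : Seq 2, ⇑u₁ = w.1 :=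
    ⟨⟨w.1, by rw [funext s1]; exact memℓp_freeFst hab h1 F'.1 F'.2⟩, coe_mk _ _⟩
  obtain ⟨u₂, hu₂⟩ : ∃ u₂ : Seq 2, ⇑u₂ = w.2 :=
    ⟨⟨w.2, by rw [funext s2']; exact memℓp_freeFst hab h2 (-F'.2) _⟩, coe_mk _ _⟩
  refine ⟨(u₁, u₂), Prod.ext (lp.ext (funext fun n => ?_)) (lp.ext (funext fun n => ?_))⟩
  · rw [shifted_fst p a b, hu₁, hu₂]
    have := lin_of_eq_freeFst (W := W) hab hε hΩ0 P.fst_eq (x := w.1) (y := w.2) (F := F'.1)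
      (G := F'.2) (summable_green_mul hab h1 F'.1) s1 (fun n hn => by
        rw [s2, freeFst, green_sum_eq_zero hn, if_pos hn, mul_zero, zero_add, inv_neg, neg_sq]
        ring) n
    refine this.trans ?_
    change (F.1 n - pertFst p a b ε W w.1 w.2 n) + pertFst p a b ε W w.1 w.2 n = _
    ring
  · rw [shifted_snd p a b, hu₁, hu₂]
    have := lin_of_eq_freeFst (W := W) hab hε (neg_ne_zero.2 hΩ0) P.snd_eq (x := w.2) (y := w.1)
      (F := (-F'.2 : Seq 2)) (G := (-F'.1 : Seq 2)) (summable_green_mul hab h2 (-F'.2)) s2'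
      (fun n hn => by
        rw [s1, freeFst, green_sum_eq_zero hn, if_pos hn, mul_zero, zero_add, inv_neg, neg_sq]
        change _ = Ω⁻¹ ^ 2 * (-(p * -F'.2 n) - (p + -Ω) * -F'.1 n)
        ring) n
    have e : -linFst p a b ε W w.2 w.1 n - Ω * w.2 n = -(linFst p a b ε W w.2 w.1 n - -Ω * w.2 n) := by
      ring
    refine e.trans ?_
    rw [this]
    change -(-(F.2 n - -pertFst p a b ε W w.2 w.1 n) + pertFst p a b ε W w.2 w.1 n) = _
    ring

/-- An l² null vector is bounded and solves the homogeneous integral equation, so it vanishes; with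
surjectivity, the open mapping theorem gives a bounded inverse. -/
theorem isRegular_of_isUnit (hε : ε ≠ 0) (h1 : ‖P.fst‖ < 1) (h2 : ‖P.snd‖ < 1)
    (hA : IsUnit (1 + (freeOp p hab hδ hΩ P).comp (pertOp p a b ε hW))) :
    IsRegular (linearization p ε φ) Ω := by
  refine ContinuousLinearMap.isUnit_iff_bijective.2
    ⟨(injective_iff_map_eq_zero _).2 fun u hu => ?_, surjective_shifted hab hδ hΩ P hW hε h1 h2 hA⟩
  have e := add_freeOp_pertOp_of_shifted hab hδ hΩ P hW hε h1 h2 (u := u) (F := 0) (by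
    rw [hu]; rfl)
  rw [map_zero] at e
  have e' := (ContinuousLinearMap.isUnit_iff_bijective.1 hA).1 (e.trans (map_zero (1 + _)).symm)
  have f1 : ∀ n, u.1 n = 0 := fun n => congrArg (fun z : Seq ∞ × Seq ∞ => z.1 n) e'
  have f2 : ∀ n, u.2 n = 0 := fun n => congrArg (fun z : Seq ∞ × Seq ∞ => z.2 n) e'
  exact Prod.ext (lp.ext (funext f1)) (lp.ext (funext f2))

end Resolvent

/-- Off the bands the spectral parameters can be chosen in the open unit disk. -/
theorem exists_spectralParam {ε : ℝ} (hε : 0 < ε) {Ω : ℂ} (hΩ : Ω ∉ Complex.ofReal '' bands ε) :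
    ∃ P : SpectralParam ε Ω, ‖P.fst‖ < 1 ∧ ‖P.snd‖ < 1 := by
  have hε' : (ε : ℂ) ≠ 0 := by exact_mod_cast hε.ne'
  obtain ⟨l, h1, h2, h3⟩ := exists_spectral_param ((2 * ε + 1 - Ω) / ε)
  obtain ⟨l', h1', h2', h3'⟩ := exists_spectral_param ((2 * ε + 1 - -Ω) / ε)
  refine ⟨⟨l, l', h1, h1', by rw [h2]; field_simp, by rw [h2']; field_simp⟩, h3 fun x hx he => hΩ ?_,
    h3' fun x hx he => hΩ ?_⟩
  · rw [div_eq_iff hε'] at he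
    obtain ⟨hx1, hx2⟩ := abs_le.1 hx
    refine ⟨2 * ε + 1 - x * ε, Or.inl ⟨by nlinarith, by nlinarith⟩, ?_⟩
    push_cast
    linear_combination he
  · rw [div_eq_iff hε'] at he
    obtain ⟨hx1, hx2⟩ := abs_le.1 hx
    refine ⟨x * ε - (2 * ε + 1), Or.inr ⟨by nlinarith, by nlinarith⟩, ?_⟩
    push_cast
    linear_combination -he

/-! ### Boundary values on the bands -/

/-- Approaching Ω₀ from side σ moves (2ε + 1 - Ω)/ε to imaginary part -σμ/ε, and the second
parameter the opposite way; hence the signs σ and -σ. The distance to the real value is μ/ε, and its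
square root is the rate. -/
theorem exists_boundary_spectralParam {ε : ℝ} (hε : 0 < ε) (Ω₀ : ℝ) {σ : ℝ} (hσ : σ = 1 ∨ σ = -1) :
    ∃ P₀ : SpectralParam ε Ω₀, ∀ μ : ℝ, 0 < μ → ∀ P : SpectralParam ε (Ω₀ + σ * μ * Complex.I),
      ‖P.fst - P₀.fst‖ ≤ √(μ / ε) ∧ ‖P.snd - P₀.snd‖ ≤ √(μ / ε) := by
  have hε' : (ε : ℂ) ≠ 0 := by exact_mod_cast hε.ne'
  have hσ' : -σ = 1 ∨ -σ = -1 := by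
    rcases hσ with h | h
    · exact Or.inr (by rw [h])
    · exact Or.inl (by rw [h, neg_neg])
  have hσ1 : |σ| = 1 := by rcases hσ with h | h <;> simp [h]
  have hσ2 : σ * σ = 1 := by rcases hσ with h | h <;> simp [h]
  obtain ⟨l, h1, h2, h3⟩ := exists_boundary_param ((2 * ε + 1 - Ω₀) / ε) hσ
  obtain ⟨l', h1', h2', h3'⟩ := exists_boundary_param ((2 * ε + 1 - -Ω₀) / ε) hσ'
  push_cast at h2 h2'
  refine ⟨⟨l, l', h1, h1', by rw [h2]; field_simp, by rw [h2']; field_simp⟩, fun μ hμ P => ⟨?_, ?_⟩⟩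
  · have e : 1 + P.fst ^ 2 =
        (((2 * ε + 1 - Ω₀) / ε : ℝ) + (-(σ * μ / ε) : ℝ) * Complex.I) * P.fst := by
      refine mul_left_cancel₀ hε' (P.fst_eq.trans ?_)
      push_cast
      field_simp
      ring
    have h := h3 _ P.fst P.norm_fst_le e (by
      rw [Complex.add_im, Complex.ofReal_im, Complex.im_ofReal_mul, Complex.I_im, zero_add, mul_one]
      have : σ * -(σ * μ / ε) = -(μ / ε) := by linear_combination -(μ / ε) * hσ2
      rw [this]
      exact neg_neg_of_pos (by positivity))
    refine Real.le_sqrt_of_sq_le (h.trans_eq ?_)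
    rw [add_sub_cancel_left, norm_mul, Complex.norm_I, Complex.norm_real, Real.norm_eq_abs, abs_neg,
      abs_div, abs_mul, hσ1, abs_of_pos hμ, abs_of_pos hε, one_mul, mul_one]
  · have e : 1 + P.snd ^ 2 =
        (((2 * ε + 1 - -Ω₀) / ε : ℝ) + (σ * μ / ε : ℝ) * Complex.I) * P.snd := by
      refine mul_left_cancel₀ hε' (P.snd_eq.trans ?_)
      push_cast
      field_simp
      ring
    have h := h3' _ P.snd P.norm_snd_le e (by
      rw [Complex.add_im, Complex.ofReal_im, Complex.im_ofReal_mul, Complex.I_im, zero_add, mul_one]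
      have : -σ * (σ * μ / ε) = -(μ / ε) := by linear_combination -(μ / ε) * hσ2
      rw [this]
      exact neg_neg_of_pos (by positivity))
    refine Real.le_sqrt_of_sq_le (h.trans_eq ?_)
    rw [add_sub_cancel_left, norm_mul, Complex.norm_I, Complex.norm_real, Real.norm_eq_abs,
      abs_div, abs_mul, hσ1, abs_of_pos hμ, abs_of_pos hε, one_mul, mul_one]

/-- A bound for the variation of the decoupled resolvent with the spectral parameter. -/
def freeGap (p : ℕ) (a b : ℤ) (ε s : ℝ) (Ω Ω₀ : ℂ) (r : ℝ) : ℝ :=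
  |ε|⁻¹ * (2 * distConst a b ^ 2 * r ^ s)
    + (‖Ω⁻¹ ^ 2 * (p - Ω) - Ω₀⁻¹ ^ 2 * (p - Ω₀)‖ + ‖Ω⁻¹ ^ 2 * p - Ω₀⁻¹ ^ 2 * p‖)

theorem freeGap_nonneg (p : ℕ) (a b : ℤ) (ε s : ℝ) (Ω Ω₀ : ℂ) {r : ℝ} (hr : 0 ≤ r) :
    0 ≤ freeGap p a b ε s Ω Ω₀ r := by
  unfold freeGap; positivity

theorem tendsto_freeGap (p : ℕ) (a b : ℤ) (ε : ℝ) {s : ℝ} (hs : 0 < s) {Ω₀ : ℂ} (hΩ : Ω₀ ≠ 0)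
    {Ω : ℝ → ℂ} {r : ℝ → ℝ} {F : Filter ℝ} (h1 : Tendsto Ω F (𝓝 Ω₀)) (h2 : Tendsto r F (𝓝 0)) :
    Tendsto (fun μ => freeGap p a b ε s (Ω μ) Ω₀ (r μ)) F (𝓝 0) := by
  have e1 : Tendsto (fun μ => r μ ^ s) F (𝓝 0) := by
    simpa [Real.zero_rpow hs.ne'] using h2.rpow_const (Or.inr hs.le)
  have e2 := (h1.inv₀ hΩ).pow 2
  have e3 : Tendsto (fun μ => ‖(Ω μ)⁻¹ ^ 2 * (p - Ω μ) - Ω₀⁻¹ ^ 2 * (p - Ω₀)‖) F (𝓝 0) := by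
    exact tendsto_iff_norm_sub_tendsto_zero.1 (e2.mul (h1.const_sub (p : ℂ)))
  have e4 : Tendsto (fun μ => ‖(Ω μ)⁻¹ ^ 2 * p - Ω₀⁻¹ ^ 2 * p‖) F (𝓝 0) := by
    exact tendsto_iff_norm_sub_tendsto_zero.1 (e2.mul_const (p : ℂ))
  have e5 := ((e1.const_mul (2 * distConst a b ^ 2)).const_mul |ε|⁻¹).add (e3.add e4)
  rw [mul_zero, mul_zero, add_zero, add_zero] at e5
  exact e5

/-- The exterior part inherits the Hölder continuity of the Green function, at the price of a weight
of order s on the output; the core part is continuous in Ω away from 0. -/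
theorem norm_freeFst_sub_le (p : ℕ) {a b : ℤ} (hab : a ≤ b) (ε : ℝ) {Ω Ω₀ l l₀ : ℂ} (hl : ‖l‖ ≤ 1)
    (hl₀ : ‖l₀‖ ≤ 1) {s : ℝ} (hs : 0 < s) (hs1 : s ≤ 1) {r : ℝ} (hr : ‖l - l₀‖ ≤ r)
    (f g : WSeq 1 1) {M : ℝ} (hf : ‖f‖ ≤ M) (hg : ‖g‖ ≤ M) (n : ℤ) :
    ‖freeFst p a b ε Ω l f.val g.val n - freeFst p a b ε Ω₀ l₀ f.val g.val n‖ ≤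
      freeGap p a b ε s Ω Ω₀ r * M * weight s n := by
  have hM : 0 ≤ M := (norm_nonneg _).trans hf
  have hw := one_le_weight n hs.le
  have h1 : ‖∑' m, (green a b l n m - green a b l₀ n m) * f.val m‖ ≤
      2 * distConst a b ^ 2 * r ^ s * weight s n * M := by
    refine (norm_tsum_kernel_le (fun m => norm_green_sub_le hab hl hl₀ hs hs1 n m) f).trans ?_
    have hr0 := (norm_nonneg _).trans hr
    gcongr
  have e : freeFst p a b ε Ω l f.val g.val n - freeFst p a b ε Ω₀ l₀ f.val g.val n =
      (ε : ℂ)⁻¹ * ∑' m, (green a b l n m - green a b l₀ n m) * f.val m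
        + if n ∈ Finset.Icc a b then (Ω⁻¹ ^ 2 * (p - Ω) - Ω₀⁻¹ ^ 2 * (p - Ω₀)) * f.val n
          + (Ω⁻¹ ^ 2 * p - Ω₀⁻¹ ^ 2 * p) * g.val n else 0 := by
    simp only [sub_mul (green a b l n _), (summable_green_wSeq hab hl f n).tsum_sub
      (summable_green_wSeq hab hl₀ f n), freeFst]
    split_ifs <;> ring
  rw [e]
  calc _ ≤ |ε|⁻¹ * (2 * distConst a b ^ 2 * r ^ s * weight s n * M)
        + (‖Ω⁻¹ ^ 2 * (p - Ω) - Ω₀⁻¹ ^ 2 * (p - Ω₀)‖ + ‖Ω⁻¹ ^ 2 * p - Ω₀⁻¹ ^ 2 * p‖) *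
          (M * weight s n) := by
        refine (norm_add_le _ _).trans (add_le_add ?_ ?_)
        · rw [norm_mul, norm_inv, Complex.norm_real, Real.norm_eq_abs]
          gcongr
        · split_ifs
          · refine (norm_add_le _ _).trans ?_
            have h2 := ((norm_val_le f n).trans hf).trans (le_mul_of_one_le_right hM hw)
            have h3 := ((norm_val_le g n).trans hg).trans (le_mul_of_one_le_right hM hw)
            rw [norm_mul, norm_mul, add_mul]
            gcongr
          · rw [norm_zero]; positivity
    _ = _ := by rw [freeGap]; ring

section Boundary

variable {p : ℕ} {a b : ℤ} {ε k δ : ℝ} {φ : RealSeq}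

/-- The difference of two solutions of the integral equation, for different spectral parameters. -/
theorem pairBound_sub (hab : a ≤ b) (hδ : 0 < δ) {W : ℤ → ℂ}
    (hW : Summable fun m => weight 1 m * ‖W m‖) {Ω Ω₀ : ℂ} (hΩ : δ ≤ ‖Ω‖) (hΩ₀ : δ ≤ ‖Ω₀‖)
    (P : SpectralParam ε Ω) (P₀ : SpectralParam ε Ω₀) (hk : 1 ≤ k)
    (hA : IsContraction a b k ((freeOp p hab hδ hΩ P).comp (pertOp p a b ε hW)))
    {F : WSeq 1 1 × WSeq 1 1} {u u₀ : Seq ∞ × Seq ∞}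
    (hu : u + (freeOp p hab hδ hΩ P).comp (pertOp p a b ε hW) u = freeOp p hab hδ hΩ P F)
    (hu₀ : u₀ + (freeOp p hab hδ hΩ₀ P₀).comp (pertOp p a b ε hW) u₀ = freeOp p hab hδ hΩ₀ P₀ F)
    {s r M : ℝ} (hs : 0 < s) (hs1 : s ≤ 1) (hr : ‖P.fst - P₀.fst‖ ≤ r) (hr' : ‖P.snd - P₀.snd‖ ≤ r)
    (hM : ‖F - pertOp p a b ε hW u₀‖ ≤ M) :
    PairBound a b k s
      (2 * (k * ((freeGap p a b ε s Ω Ω₀ r + freeGap p a b ε s (-Ω) (-Ω₀) r) * M))) (u - u₀) := by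
  have hr0 := (norm_nonneg _).trans hr
  have hM0 := (norm_nonneg _).trans hM
  have g1 := freeGap_nonneg p a b ε s Ω Ω₀ hr0
  have g2 := freeGap_nonneg p a b ε s (-Ω) (-Ω₀) hr0
  have hG1 : ‖(F - pertOp p a b ε hW u₀).1‖ ≤ M := (norm_fst_le _).trans hM
  have hG2 : ‖(F - pertOp p a b ε hW u₀).2‖ ≤ M := (norm_snd_le _).trans hM
  rw [ContinuousLinearMap.comp_apply] at hu hu₀
  -- Subtracting the equations so that only the contraction at Ω acts on u - u₀ leaves the
  -- difference of free resolvents on the fixed source F minus the perturbation of u₀.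
  have hd : (u - u₀) + (freeOp p hab hδ hΩ P).comp (pertOp p a b ε hW) (u - u₀) =
      freeOp p hab hδ hΩ P (F - pertOp p a b ε hW u₀)
        - freeOp p hab hδ hΩ₀ P₀ (F - pertOp p a b ε hW u₀) := by
    rw [ContinuousLinearMap.comp_apply, map_sub, map_sub, map_sub, map_sub, ← hu, ← hu₀]
    abel
  generalize F - pertOp p a b ε hW u₀ = G at hd hG1 hG2
  refine hA.pairBound hk hs.le hs1 (by positivity) hd ⟨coreBound_of_le hk (by positivity) fun n => ?_,
    coreBound_of_le hk (by positivity) fun n => ?_⟩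
  · have h := norm_freeFst_sub_le p hab ε (Ω := Ω) (Ω₀ := Ω₀) P.norm_fst_le P₀.norm_fst_le hs hs1 hr
      G.1 G.2 hG1 hG2 n
    refine h.trans ?_
    have hw := (WSeq.weight_pos s n).le
    gcongr
    linarith
  · have h := norm_freeFst_sub_le p hab ε (Ω := -Ω) (Ω₀ := -Ω₀) P.norm_snd_le P₀.norm_snd_le hs hs1
      hr' G.2 G.1 hG2 hG1 n
    have e : (freeOp p hab hδ hΩ P G - freeOp p hab hδ hΩ₀ P₀ G).2 n =
        -(freeFst p a b ε (-Ω) P.snd G.2.val G.1.val n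
          - freeFst p a b ε (-Ω₀) P₀.snd G.2.val G.1.val n) := by
      rw [neg_sub', ← freeOp_snd p hab hδ hΩ P]
      rfl
    rw [e, norm_neg]
    refine h.trans ?_
    have hw := (WSeq.weight_pos s n).le
    gcongr
    linarith

/-- The limit solves the integral equation with boundary spectral parameters, which is still
uniquely solvable because the contraction covers the closed disk. Its norm is at most 2k times that
of the free resolvent. -/
theorem exists_boundaryValue (hab : a ≤ b) (hδ : 0 < δ) (hδ1 : δ ≤ 1) (hε : 0 < ε) (hk : 1 ≤ k)
    (hW : Summable fun m => weight 1 m * ‖potentialDev p a b φ m‖)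
    (hA : ∀ (Ω : ℂ) (hΩ : δ ≤ ‖Ω‖) (P : SpectralParam ε Ω),
      IsContraction a b k ((freeOp p hab hδ hΩ P).comp (pertOp p a b ε hW)))
    {Ω₀ : ℝ} (hΩ₀ : Ω₀ ∈ bands ε) {σ : ℝ} (hσ : σ = 1 ∨ σ = -1) :
    ∃ T : (WSeq 1 1 × WSeq 1 1) →L[ℂ] (Seq ∞ × Seq ∞),
      IsBoundaryValue (linearization p ε φ) σ Ω₀ T ∧
      ‖T‖ ≤ 2 * k * (ε⁻¹ * distConst a b + (2 * p * δ⁻¹ ^ 2 + δ⁻¹)) := by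
  obtain ⟨P₀, hP₀⟩ := exists_boundary_spectralParam hε Ω₀ hσ
  have hΩabs : 1 ≤ |Ω₀| := by
    rcases hΩ₀ with h | h
    · exact h.1.trans (le_abs_self _)
    · exact (le_neg.1 h.2).trans (neg_le_abs _)
  have hΩδ : δ ≤ ‖(Ω₀ : ℂ)‖ := by
    rw [Complex.norm_real, Real.norm_eq_abs]; linarith
  have hΩ00 := ne_zero_of_le_norm hδ hΩδ
  have hc := zero_le_one.trans (one_le_distConst a b)
  have hA₀ := hA Ω₀ hΩδ P₀
  have hunit := hA₀.isUnit hk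
  obtain ⟨T, hT⟩ : ∃ T : (WSeq 1 1 × WSeq 1 1) →L[ℂ] (Seq ∞ × Seq ∞), ∀ F,
      T F + (freeOp p hab hδ hΩδ P₀).comp (pertOp p a b ε hW) (T F) = freeOp p hab hδ hΩδ P₀ F := by
    refine ⟨(Ring.inverse (1 + (freeOp p hab hδ hΩδ P₀).comp (pertOp p a b ε hW))).comp
      (freeOp p hab hδ hΩδ P₀), fun F => ?_⟩
    exact congrArg (fun B : (Seq ∞ × Seq ∞) →L[ℂ] (Seq ∞ × Seq ∞) => B (freeOp p hab hδ hΩδ P₀ F))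
      (Ring.mul_inverse_cancel _ hunit)
  refine ⟨T, fun s hs η hη => ?_, ContinuousLinearMap.opNorm_le_bound _ (by positivity) fun F => ?_⟩
  -- The Hölder and contraction estimates require exponents at most 1; convergence with the weaker
  -- weight `min s 1` implies it for s.
  · have hs' : 0 < min s 1 := lt_min hs one_pos
    have t1 : Tendsto (fun μ : ℝ => (Ω₀ : ℂ) + σ * μ * Complex.I) (𝓝[>] 0) (𝓝 Ω₀) := by
      have : Continuous fun μ : ℝ => (Ω₀ : ℂ) + σ * μ * Complex.I := by fun_prop
      simpa using (this.tendsto 0).mono_left nhdsWithin_le_nhds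
    have t2 : Tendsto (fun μ : ℝ => √(μ / ε)) (𝓝[>] 0) (𝓝 0) := by
      have : Continuous fun μ : ℝ => √(μ / ε) := by fun_prop
      simpa using (this.tendsto 0).mono_left nhdsWithin_le_nhds
    have t3 := (tendsto_freeGap p a b ε hs' hΩ00 t1 t2).add
      (tendsto_freeGap p a b ε hs' (neg_ne_zero.2 hΩ00) t1.neg t2)
    have t4 := (t3.const_mul (2 * k)).mul_const (1 + ‖pertOp p a b ε hW‖ * ‖T‖)
    rw [add_zero, mul_zero, zero_mul] at t4
    filter_upwards [t4.eventually_le_const hη, self_mem_nhdsWithin] with μ hμη hμ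
    have hμ0 : (0 : ℝ) < μ := hμ
    set Ω : ℂ := Ω₀ + σ * μ * Complex.I with hΩdef
    have hre : Ω.re = Ω₀ := by simp [hΩdef]
    have him : Ω.im = σ * μ := by simp [hΩdef]
    have hΩ : δ ≤ ‖Ω‖ := by
      have := Complex.abs_re_le_norm Ω
      rw [hre] at this
      linarith
    have hΩb : Ω ∉ Complex.ofReal '' bands ε := by
      rintro ⟨x, _, hx⟩
      have h := congrArg Complex.im hx
      rw [Complex.ofReal_im, him] at h
      rcases hσ with h' | h' <;> rw [h'] at h <;> linarith
    obtain ⟨P, h1, h2⟩ := exists_spectralParam hε hΩb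
    have hreg := isRegular_of_isUnit hab hδ hΩ P hW hε.ne' h1 h2 ((hA Ω hΩ P).isUnit hk)
    refine ⟨hreg, fun F => ?_⟩
    obtain ⟨u, hu⟩ : ∃ u, u = res (linearization p ε φ) Ω (incl F) := ⟨_, rfl⟩
    have hsh : shifted (linearization p ε φ) Ω u = incl F := by
      rw [hu]
      exact congrArg (fun B : (Seq 2 × Seq 2) →L[ℂ] (Seq 2 × Seq 2) => B (incl F))
        (Ring.mul_inverse_cancel _ hreg)
    rw [← hu]
    have hM : ‖F - pertOp p a b ε hW (T F)‖ ≤ (1 + ‖pertOp p a b ε hW‖ * ‖T‖) * ‖F‖ := by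
      have e1 := norm_sub_le F (pertOp p a b ε hW (T F))
      have e2 := (pertOp p a b ε hW).le_opNorm (T F)
      have e3 := mul_le_mul_of_nonneg_left (T.le_opNorm F) (norm_nonneg (pertOp p a b ε hW))
      linarith
    obtain ⟨r1, r2⟩ := hP₀ μ hμ0 P
    obtain ⟨b1, b2⟩ := pairBound_sub hab hδ hW hΩ hΩδ P P₀ hk (hA Ω hΩ P)
      (add_freeOp_pertOp_of_shifted hab hδ hΩ P hW hε.ne' h1 h2 hsh) (hT F) hs' (min_le_right _ _)
      r1 r2 hM
    have key : ∀ (n : ℤ) (z : ℂ) (X : ℝ), 0 ≤ X → X ≤ η * ‖F‖ → ‖z‖ ≤ X * weight (min s 1) n →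
        weight (-s) n * ‖z‖ ≤ η * ‖F‖ := by
      intro n z X hX0 hX hz
      have hw1 := (WSeq.weight_pos (-s) n).le
      have hw2 := (WSeq.weight_pos (min s 1) n).le
      calc weight (-s) n * ‖z‖ ≤ weight (-min s 1) n * (X * weight (min s 1) n) :=
            mul_le_mul (weight_mono n (neg_le_neg (min_le_left _ _))) hz (norm_nonneg _)
              (WSeq.weight_pos _ n).le
        _ = X * (weight (-min s 1) n * weight (min s 1) n) := by ring
        _ = X := by rw [weight_neg_mul, mul_one]
        _ ≤ _ := hX
    have hX : 2 * (k * ((freeGap p a b ε (min s 1) Ω Ω₀ √(μ / ε)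
        + freeGap p a b ε (min s 1) (-Ω) (-Ω₀) √(μ / ε)) *
          ((1 + ‖pertOp p a b ε hW‖ * ‖T‖) * ‖F‖))) ≤ η * ‖F‖ := by
      refine le_trans (le_of_eq ?_) (mul_le_mul_of_nonneg_right hμη (norm_nonneg F))
      ring
    have hX0 := add_nonneg (freeGap_nonneg p a b ε (min s 1) Ω Ω₀ (Real.sqrt_nonneg (μ / ε)))
      (freeGap_nonneg p a b ε (min s 1) (-Ω) (-Ω₀) (Real.sqrt_nonneg (μ / ε)))
    exact fun n => ⟨key n _ _ (by positivity) hX (b1 n).1, key n _ _ (by positivity) hX (b2 n).1⟩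
  · refine (hA₀.norm_le hk (hT F)).trans ?_
    have h := norm_freeOp_apply_le p hab hδ hΩδ P₀ F
    rw [abs_of_pos hε] at h
    calc _ ≤ 2 * k * ((ε⁻¹ * distConst a b + (2 * p * δ⁻¹ ^ 2 + δ⁻¹)) * ‖F‖) := by gcongr
      _ = _ := by ring

end Boundary

theorem decayBound_potentialDev {p : ℕ} {a b : ℤ} {ε K : ℝ} {φ : RealSeq}
    (h1 : ∀ n, siteDist a b n = 0 → |φ n ^ (2 * p) - 1| ≤ K * ε)
    (h2 : ∀ n, siteDist a b n ≠ 0 → |φ n ^ (2 * p)| ≤ K * ε ^ 2 * (1 / 2) ^ siteDist a b n) :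
    DecayBound a b ε K (potentialDev p a b φ) := by
  refine ⟨fun n hn => ?_, fun n hn => ?_⟩
  · have h := h1 n (siteDist_eq_zero.2 (Finset.mem_Icc.1 hn))
    rw [potentialDev, if_pos hn]
    rwa [← Real.norm_eq_abs, ← Complex.norm_real, Complex.ofReal_sub, Complex.ofReal_pow,
      Complex.ofReal_one] at h
  · have h := h2 n fun h0 => hn (Finset.mem_Icc.2 (siteDist_eq_zero.1 h0))
    rw [potentialDev, if_neg hn, sub_zero]
    rwa [← Real.norm_eq_abs, ← Complex.norm_real, Complex.ofReal_pow] at h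

end DNLS

end

/-! ### Assembly of the theorem -/

theorem theorem3 (p : ℕ) (hp : 2 ≤ p) (Up Um : Finset ℤ) (hdisj : Disjoint Up Um)
    (hne : (Up ∪ Um).Nonempty) (hsc : DNLS.IsSimplyConnected (Up ∪ Um)) :
    ∃ ρ : ℝ, 0 < ρ ∧ ∀ δ : ℝ, 0 < δ → δ < 1 →
      ∃ ε₀ : ℝ, 0 < ε₀ ∧ ∃ C : ℝ, 0 < C ∧ ∀ ε : ℝ, 0 < ε → ε < ε₀ →
        ∃ φ : DNLS.RealSeq,
          -- `φ` is the discrete soliton: the unique stationary solution near the limiting one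
          (DNLS.IsStationary p ε φ ∧ ‖φ - DNLS.limitConfig Up Um‖ < ρ) ∧
          (∀ ψ : DNLS.RealSeq, DNLS.IsStationary p ε ψ →
            ‖ψ - DNLS.limitConfig Up Um‖ < ρ → ψ = φ) ∧
          ‖φ - DNLS.limitConfig Up Um‖ ≤ C * ε ∧
          -- the resolvent is bounded outside the disk and the bands
          (∀ Ω : ℂ, Ω ∉ Metric.ball (0 : ℂ) δ → Ω ∉ Complex.ofReal '' DNLS.bands ε →
            DNLS.IsRegular (DNLS.linearization p ε φ) Ω) ∧
          -- exactly `2N` poles in the disk, counting multiplicities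
          DNLS.HasExactlyPoles (DNLS.linearization p ε φ) (Metric.ball (0 : ℂ) δ)
            (2 * (Up.card + Um.card)) ∧
          -- boundary values on the bands, with a bound uniform in `Ω` and `ε`
          (∀ Ω ∈ DNLS.bands ε,
            ∃ Rp Rm : (DNLS.WSeq 1 1 × DNLS.WSeq 1 1) →L[ℂ] (DNLS.Seq ∞ × DNLS.Seq ∞),
              DNLS.IsBoundaryValue (DNLS.linearization p ε φ) 1 Ω Rp ∧
              DNLS.IsBoundaryValue (DNLS.linearization p ε φ) (-1) Ω Rm ∧
              ‖Rp‖ ≤ C * ε⁻¹ ∧ ‖Rm‖ ≤ C * ε⁻¹) := by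
  have hp1 : 1 ≤ p := by omega
  obtain ⟨a, b, hab, hU⟩ := DNLS.exists_Icc_of_isSimplyConnected hne hsc
  have hUI : Up ∪ Um = Finset.Icc a b := by
    ext n; rw [hU, Finset.mem_Icc]
  obtain ⟨ρ, hρ, _, ε₁, hε₁, C₁, hC₁, hsol⟩ := DNLS.exists_soliton p hp1 hdisj
  obtain ⟨ε₂, hε₂, K, hK, hpot⟩ := DNLS.soliton_potential_bound p hp1 hdisj hab hU C₁ hC₁
  refine ⟨ρ, hρ, fun δ hδ hδ1 => ?_⟩
  obtain ⟨ε₃, hε₃, hpoles⟩ := DNLS.linearization_hasExactlyPoles p (Finset.Icc a b) hδ hδ1 hK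
  obtain ⟨k, hk, ε₄, hε₄, hcon⟩ := DNLS.exists_isContraction p hab hK hδ
  have hc := zero_le_one.trans (DNLS.one_le_distConst a b)
  set c := DNLS.distConst a b
  -- The cap ε < 1 lets ε⁻¹ absorb the O(1) core contribution to the boundary resolvent and ε² be
  -- replaced by ε in the pole count. C is a sum so as to dominate both the distance and the
  -- resolvent constants.
  refine ⟨min (min (min ε₁ ε₂) (min ε₃ ε₄)) 1, by positivity,
    C₁ + 2 * k * (c + (2 * p * δ⁻¹ ^ 2 + δ⁻¹)), by positivity, fun ε hε hε0 => ?_⟩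
  simp only [lt_min_iff] at hε0
  obtain ⟨⟨⟨he1, he2⟩, he3, he4⟩, he5⟩ := hε0
  obtain ⟨φ, hst, hnear, huniq, hdist⟩ := hsol ε hε he1
  obtain ⟨hin, hout⟩ := hpot ε hε he2 φ hst hdist
  have hW := DNLS.decayBound_potentialDev hin hout
  have hA := hcon ε hε he4 _ hW
  have hbound : 2 * k * (ε⁻¹ * c + (2 * p * δ⁻¹ ^ 2 + δ⁻¹)) ≤
      (C₁ + 2 * k * (c + (2 * p * δ⁻¹ ^ 2 + δ⁻¹))) * ε⁻¹ := by
    have hinv : 1 ≤ ε⁻¹ := (one_le_inv₀ hε).2 he5.le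
    have hD : 0 ≤ 2 * p * δ⁻¹ ^ 2 + δ⁻¹ := by positivity
    calc _ ≤ 2 * k * (ε⁻¹ * c + (2 * p * δ⁻¹ ^ 2 + δ⁻¹) * ε⁻¹) := by
          gcongr
          exact le_mul_of_one_le_right hD hinv
      _ = 2 * k * (c + (2 * p * δ⁻¹ ^ 2 + δ⁻¹)) * ε⁻¹ := by ring
      _ ≤ _ := by
          gcongr
          linarith
  refine ⟨φ, ⟨hst, hnear⟩, huniq, hdist.trans ?_, fun Ω hΩ hΩb => ?_, ?_, fun Ω hΩ => ?_⟩
  · gcongr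
    exact le_add_of_nonneg_right (by positivity)
  · have hΩδ : δ ≤ ‖Ω‖ := by simpa using hΩ
    obtain ⟨P, h1, h2⟩ := DNLS.exists_spectralParam hε hΩb
    exact DNLS.isRegular_of_isUnit hab hδ hΩδ P hW.summable hε.ne' h1 h2 ((hA Ω hΩδ P).isUnit hk)
  · rw [← Finset.card_union_of_disjoint hdisj, hUI]
    refine hpoles ε hε he3 φ fun n => ?_
    split_ifs with hn
    · exact hin n (DNLS.siteDist_eq_zero.2 (Finset.mem_Icc.1 hn))
    · rw [sub_zero]
      refine (hout n fun h0 => hn (Finset.mem_Icc.2 (DNLS.siteDist_eq_zero.1 h0))).trans ?_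
      have h1 : ((1 : ℝ) / 2) ^ DNLS.siteDist a b n ≤ 1 := pow_le_one₀ (by norm_num) (by norm_num)
      calc K * ε ^ 2 * (1 / 2) ^ DNLS.siteDist a b n ≤ K * ε ^ 2 * 1 := by gcongr
        _ = K * ε * ε := by ring
        _ ≤ K * ε * 1 := by gcongr
        _ = _ := mul_one _
  · obtain ⟨Rp, hRp, hRp'⟩ := DNLS.exists_boundaryValue hab hδ hδ1.le hε hk hW.summable hA hΩ
      (Or.inl rfl)
    obtain ⟨Rm, hRm, hRm'⟩ := DNLS.exists_boundaryValue hab hδ hδ1.le hε hk hW.summable hA hΩ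
      (Or.inr rfl)
    exact ⟨Rp, Rm, hRp, hRm, hRp'.trans hbound, hRm'.trans hbound⟩
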